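/- Let $\nu>0$ and $0<a<b\le L$. For $\xi>0$ let $G_\xi=-\partial_x^2+\xi^2x^2+\frac{\nu^2-1/4}{x^2}$ be the operator on the real space $L^2(0,L)$ with domain $D(G_\xi)=\{g\in H_0^1(0,L):\ G_\xi g\in L^2(0,L)\}$, where $G_\xi g$ is taken in the sense of distributions. For $f_0\in L^2(0,L)$, a solution of $$\partial_t f-\partial_x^2 f+\xi^2x^2 f+\frac{\nu^2-1/4}{x^2}f=0\ \text{ in }(0,T)\times(0,L),\qquad f(t,0)=f(t,L)=0,\qquad f(0,\cdot)=f_0,$$ is a function $f\in C([0,T];L^2(0,L))\cap L^2(0,T;H_0^1(0,L))$ with $f(0)=f_0$ such that, for every $g\in D(G_\xi)$, the map $t\mapsto (f(t),g)_{L^2(0,L)}$ is absolutely continuous on $[0,T]$ and $\frac{d}{dt}(f(t),g)_{L^2(0,L)}=-(f(t),G_\xi g)_{L^2(0,L)}$ for almost every $t\in(0,T)$. **Proposition.** For every $T>0$, every $\epsilon>0$ and every $\delta\in(0,2/3)$, there exist $\xi_0>0$ and $C>0$ such that for every $\xi\ge\xi_0$, every $f_0\in L^2(0,L)$ and every solution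 $f$ of the above system, $$\int_0^L|f(T,x)|^2\,dx\le C\left(e^{\frac{\xi}{\sqrt{1-3\delta/2}}(a+\epsilon/2)^2}+e^{2\epsilon\xi}\right)\int_0^T\int_a^b|f(t,x)|^2\,dx\,dt.$$ -/

import Mathlib

open MeasureTheory Set
open scoped ContDiff

/-- Lebesgue measure on the interval `(0, L)`. -/
noncomputable abbrev intervalMeasure (L : ℝ) : Measure ℝ := volume.restrict (Ioo 0 L)

/-- The real Hilbert space `L²(0, L)`. -/
abbrev L2Interval (L : ℝ) : Type := Lp ℝ 2 (intervalMeasure L)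

/-- `φ ∈ C_c^∞(0, L)`. -/
structure IsTestFunction (L : ℝ) (φ : ℝ → ℝ) : Prop where
  contDiff : ContDiff ℝ ∞ φ
  hasCompactSupport : HasCompactSupport φ
  tsupport_subset : tsupport φ ⊆ Ioo 0 L

/-- The space `H₀¹(0, L)`, as the closure of `C_c^∞(0, L)` for the `H¹` norm. A function `u` is
recorded together with its weak derivative `u'`: the elements are the pairs `(u, u')`, and the set
is the closure in `L² × L²` of the pairs `(φ, φ')` with `φ ∈ C_c^∞(0, L)`. -/
def H10 (L : ℝ) : Set (L2Interval L × L2Interval L) :=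
  closure {p | ∃ φ : ℝ → ℝ, IsTestFunction L φ ∧
    p.1 =ᵐ[intervalMeasure L] φ ∧ p.2 =ᵐ[intervalMeasure L] deriv φ}

/-- The potential `ξ² x² + (ν² - 1/4) / x²`. -/
noncomputable def grushinPotential (ν ξ x : ℝ) : ℝ :=
  ξ ^ 2 * x ^ 2 + (ν ^ 2 - 1 / 4) / x ^ 2

/-- The graph of the operator `G_ξ = -∂ₓ² + ξ² x² + (ν² - 1/4) / x²` on `L²(0, L)` with domain
`D(G_ξ) = {g ∈ H₀¹(0, L) : G_ξ g ∈ L²(0, L)}`: here `g ∈ D(G_ξ)` and `G_ξ g = h`, where `G_ξ g` is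
taken in the sense of distributions on `(0, L)`. -/
def IsGrushinImage (L ν ξ : ℝ) (g h : L2Interval L) : Prop :=
  ∃ g' : L2Interval L, (g, g') ∈ H10 L ∧
    ∀ φ : ℝ → ℝ, IsTestFunction L φ →
      ∫ x in Ioo 0 L, (g' x * deriv φ x + grushinPotential ν ξ x * g x * φ x) =
        ∫ x in Ioo 0 L, h x * φ x

/-- `f` is the weak solution on `(0, T)` of `∂ₜ f - ∂ₓ² f + ξ² x² f + (ν² - 1/4) / x² f = 0` on
`(0, L)` with homogeneous Dirichlet conditions and initial datum `f₀`: it belongs to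
`C([0, T]; L²(0, L)) ∩ L²(0, T; H₀¹(0, L))`, and for every `g ∈ D(G_ξ)` the function
`t ↦ (f(t), g)` is absolutely continuous on `[0, T]` with derivative `-(f(t), G_ξ g)` almost
everywhere. -/
structure IsGrushinSolution (L ν ξ T : ℝ) (f₀ : L2Interval L) (f : ℝ → L2Interval L) : Prop where
  initial : f 0 = f₀
  continuousOn : ContinuousOn f (Icc 0 T)
  memH10 : ∃ f' : ℝ → L2Interval L, MemLp f' 2 (volume.restrict (Ioo 0 T)) ∧
    ∀ᵐ t ∂(volume.restrict (Ioo 0 T)), (f t, f' t) ∈ H10 L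
  weak : ∀ g h : L2Interval L, IsGrushinImage L ν ξ g h →
    AbsolutelyContinuousOnInterval (fun t => inner ℝ (f t) g) 0 T ∧
    ∀ᵐ t ∂(volume.restrict (Ioo 0 T)),
      HasDerivAt (fun s => inner ℝ (f s) g) (-(inner ℝ (f t) h)) t

/-! Write E(x) = x^(ν+1/2) e^(ξx²/2) and λ₀ = 2ξ(ν+1). E is a positive increasing solution of G_ξ E
= -λ₀ E, so for u = Eψ one has (G_ξ + λ₀)u = -(E²ψ')'/E. All estimates are made on this flux form,
where the singular potential no longer appears.

Reduction to single modes. The inverse of G_ξ + λ₀ is B B*, where B has the kernel E(x)/E(y) on x <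
y. This kernel is at most 1 because E increases, so B B* is Hilbert–Schmidt, and its eigenvalues 1/μ
satisfy ∑ μ⁻² ≤ L⁴ uniformly in ξ. Hence ‖f(T)‖² ≤ L⁴ M² as soon as μ|(f(T), φ)| ≤ M for every unit
eigenfunction φ = Eψ (`norm_sq_le_of_forall_eigenvector`). It remains to observe each mode with a
constant uniform in μ (`exists_forall_profile_le`).

Observation of a mode. A cut-off χ whose transition lies in [a₁, a₂] ⊂ (a, b) splits φ into χφ and
(1-χ)φ. On the left, ψ = ψ(0) ∑ (-μ)^i ψ_i with ψ_0 = 1 and (E²ψ_{i+1}')' = E²ψ_i, so that |ψ_i| ≤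
x^(2i)/(i!)². On the right there is a similar series starting from L. The functions v_{i+1} = χEψ_i
belong to the domain of G_ξ, and G_ξ v_{i+1} = -v_i - λ₀ v_{i+1} - k_i with k_i supported in [a₁,
a₂]. Pair f(t) with ∑ w_i(t) v_{i+1}, where w_i is (-1)^i times the i-th derivative of κ(t)
e^(μ(t-S)) and κ is a cut-off in time. The derivative of the pairing telescopes to the localised
terms ∑ w_i (f, k_i), and at t = S the pairing is (f(S), χφ) (`IsGrushinSolution.abs_inner_le`). The
series converge because κ is taken of Gevrey order 3/2, below the order 2 allowed by (i!)². The
price in μ is e^(θμ), with θ as small as desired.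

Costs. The left piece costs |ψ(0)| E(a₂), which is polynomial in μ times e^(ξa₂²/2). The right piece
costs μ|∫ E²ψ| / E(a₁). An Agmon estimate with weight e^(κξx²) bounds the integral by e^(ξa²/2)
e^(λτ), where λ = μ - λ₀ ≥ 0, and E(a₁) cancels the first exponential. Observing up to S = T/2
leaves the decay e^(-λT/2) on [T/2, T]. It pays for every loss in λ, while the gap between a₂ and a
+ ε/2 pays for the part of e^(2θμ) coming from λ₀. The resulting bound e^(ξ(a+ε/2)²) is stronger
than the one claimed, since √(1-3δ/2) ≤ 1. -/

open Filter Topology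

/-! ### Hilbert–Schmidt operators and spectral bounds. -/

section Hilbert

variable {H : Type*} [NormedAddCommGroup H] [InnerProductSpace ℝ H]

/-- An orthonormal family stays orthonormal when a unit vector orthogonal to it is added. -/
theorem orthonormal_option {ι : Type*} {e : ι → H} (he : Orthonormal ℝ e) {w : H} (hw : ‖w‖ = 1)
    (h : ∀ i, inner ℝ (e i) w = 0) : Orthonormal ℝ (fun o : Option ι => o.elim w e) := by
  refine ⟨?_, ?_⟩
  · rintro (_ | i)
    · exact hw
    · exact he.1 i
  · rintro (_ | i) (_ | j) hij
    · exact absurd rfl hij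
    · simpa [real_inner_comm] using h j
    · simpa using h i
    · exact he.2 fun h => hij (by rw [h])

/-- A Hilbert–Schmidt operator is compact. -/
theorem isCompactOperator_of_sum_sq_le [CompleteSpace H] (T : H →L[ℝ] H) (C : ℝ)
    (hT : ∀ (ι : Type) [Fintype ι] (e : ι → H), Orthonormal ℝ e → ∑ i, ‖T (e i)‖ ^ 2 ≤ C) :
    IsCompactOperator T := by
  let S : Set ℝ := {r | ∃ (n : ℕ) (e : Fin n → H), Orthonormal ℝ e ∧ r = ∑ i, ‖T (e i)‖ ^ 2}
  have hne : S.Nonempty := ⟨0, 0, Fin.elim0, ⟨fun i => i.elim0, fun i => i.elim0⟩, by simp⟩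
  have hbd : BddAbove S := ⟨C, by rintro _ ⟨n, e, he, rfl⟩; exact hT _ e he⟩
  have key : ∀ ε : ℝ, 0 < ε → ∃ P : H →L[ℝ] H, IsCompactOperator P ∧ ‖T - P‖ ≤ ε := by
    intro ε hε
    -- Take an orthonormal family whose sum is within ε² of the supremum. One more orthogonal unit
    -- vector adds at most ε², so T has norm at most ε on the orthogonal complement of the span and
    -- is ε-close to the finite rank operator T P.
    obtain ⟨_, ⟨n, e, he, rfl⟩, hlt⟩ :=
      exists_lt_of_lt_csSup hne (show sSup S - ε ^ 2 < sSup S by nlinarith)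
    let F : Submodule ℝ H := Submodule.span ℝ (range e)
    have : FiniteDimensional ℝ F := FiniteDimensional.span_of_finite ℝ (finite_range e)
    let P : H →L[ℝ] H := F.starProjection
    have hP : IsCompactOperator P := by
      have h1 : IsCompactOperator (F.orthogonalProjectionOnto) :=
        isCompactOperator_of_locallyCompactSpace_dom F.orthogonalProjectionOnto
      exact h1.clm_comp F.subtypeL
    refine ⟨T ∘L P, hP.clm_comp T, ContinuousLinearMap.opNorm_le_bound _ hε.le fun v => ?_⟩
    have e1 : (T - T ∘L P) v = T (v - P v) := by simp
    rw [e1]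
    set w := v - P v with hw
    have hwF : w ∈ Fᗮ := F.sub_starProjection_mem_orthogonal v
    have hwn : ‖w‖ ≤ ‖v‖ := by
      have h2 : ‖v‖ ^ 2 = ‖P v‖ ^ 2 + ‖w‖ ^ 2 := by
        have h3 : inner ℝ (P v) w = 0 := hwF _ (F.starProjection_apply_mem v)
        have h4 : v = P v + w := by simp [hw]
        conv_lhs => rw [h4]
        rw [norm_add_sq_real, h3]; ring
      nlinarith [norm_nonneg v, norm_nonneg w, sq_nonneg ‖P v‖]
    refine le_trans ?_ (mul_le_mul_of_nonneg_left hwn hε.le)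
    by_cases hw0 : w = 0
    · simp [hw0]
    have hwpos : 0 < ‖w‖ := norm_pos_iff.2 hw0
    have ho : Orthonormal ℝ (fun o : Option (Fin n) => o.elim (‖w‖⁻¹ • w) e) := by
      refine orthonormal_option he ?_ fun i => ?_
      · rw [norm_smul, norm_inv, norm_norm, inv_mul_cancel₀ hwpos.ne']
      · rw [inner_smul_right, hwF _ (Submodule.subset_span (mem_range_self i)), mul_zero]
    have hle : ∑ o : Option (Fin n), ‖T (o.elim (‖w‖⁻¹ • w) e)‖ ^ 2 ≤ sSup S := by
      refine le_csSup hbd ?_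
      let eq := Fintype.equivFin (Option (Fin n))
      refine ⟨_, fun i => (eq.symm i).elim (‖w‖⁻¹ • w) e, ho.comp _ eq.symm.injective, ?_⟩
      exact (Equiv.sum_comp eq.symm (fun o : Option (Fin n) =>
        ‖T (o.elim (‖w‖⁻¹ • w) e)‖ ^ 2)).symm
    rw [Fintype.sum_option] at hle
    simp only [Option.elim] at hle
    have h5 : ‖T (‖w‖⁻¹ • w)‖ ^ 2 ≤ ε ^ 2 := by linarith
    have h6 : ‖T (‖w‖⁻¹ • w)‖ ≤ ε := abs_le_of_sq_le_sq' h5 hε.le |>.2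
    rw [map_smul, norm_smul, norm_inv, norm_norm, inv_mul_le_iff₀ hwpos] at h6
    linarith
  choose P hPc hPn using fun n : ℕ => key (1 / ((n : ℝ) + 1)) (by positivity)
  refine isCompactOperator_of_tendsto (l := Filter.atTop) (F := P) ?_
    (Filter.Eventually.of_forall hPc)
  rw [tendsto_iff_norm_sub_tendsto_zero]
  refine squeeze_zero (fun _ => norm_nonneg _) (fun n => ?_) tendsto_one_div_add_atTop_nhds_zero_nat
  rw [norm_sub_rev]; exact hPn n

/-- A bound for `‖v‖` from bounds for the components of `v` along the eigenvectors of an injective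
self-adjoint Hilbert–Schmidt operator. -/
theorem norm_sq_le_of_forall_eigenvector [CompleteSpace H] (T : H →L[ℝ] H) (C : ℝ)
    (hT : ∀ (ι : Type) [Fintype ι] (e : ι → H), Orthonormal ℝ e → ∑ i, ‖T (e i)‖ ^ 2 ≤ C)
    (hsymm : (T : H →ₗ[ℝ] H).IsSymmetric) (hinj : ∀ v, T v = 0 → v = 0) (v : H) (K : ℝ)
    (hK : 0 ≤ K)
    (hv : ∀ (m : ℝ) (φ : H), m ≠ 0 → ‖φ‖ = 1 → T φ = m • φ → (inner ℝ v φ) ^ 2 ≤ m ^ 2 * K) :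
    ‖v‖ ^ 2 ≤ C * K := by
  have hC : 0 ≤ C := by
    simpa using hT (Fin 0) Fin.elim0 ⟨fun i => i.elim0, fun i => i.elim0⟩
  have hcomp := isCompactOperator_of_sum_sq_le T C hT
  have hbot : (⨆ m : ℝ, Module.End.eigenspace (T : H →ₗ[ℝ] H) m)ᗮ = ⊥ :=
    ContinuousLinearMap.orthogonalComplement_iSup_eigenspaces_eq_bot hcomp hsymm
  set U := ⨆ m : ℝ, Module.End.eigenspace (T : H →ₗ[ℝ] H) m with hU
  have hdense : U.topologicalClosure = ⊤ := by
    rw [Submodule.topologicalClosure_eq_top_iff]; exact hbot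
  have horth := hsymm.orthogonalFamily_eigenspaces
  -- By duality and density it suffices to pair v with finite sums of eigenvectors. The component in
  -- a given eigenspace is itself an eigenvector, so multiplicities play no role.
  have key : ∀ x ∈ U, |inner ℝ v x| ≤ Real.sqrt (C * K) * ‖x‖ := by
    intro x hx
    obtain ⟨g, hg, rfl⟩ := (Submodule.mem_iSup_iff_exists_finsupp _ _).1 hx
    have hg' : ∀ m, T (g m) = m • g m := fun m => by
      simpa using Module.End.mem_eigenspace_iff.1 (hg m)
    have hgne : ∀ m ∈ g.support, g m ≠ 0 := fun m hm => Finsupp.mem_support_iff.1 hm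
    have hm0 : ∀ m ∈ g.support, m ≠ 0 := by
      rintro m hm rfl
      exact hgne 0 hm (hinj _ (by rw [hg' 0, zero_smul]))
    have hpos : ∀ m ∈ g.support, 0 < ‖g m‖ := fun m hm => norm_pos_iff.2 (hgne m hm)
    have hortho : ∀ m m', m ≠ m' → inner ℝ (g m) (g m') = 0 := fun m m' h =>
      horth h ⟨g m, hg m⟩ ⟨g m', hg m'⟩
    rw [Finsupp.sum]
    have hterm : ∀ m ∈ g.support, |inner ℝ v (g m)| ≤ (|m| * Real.sqrt K) * ‖g m‖ := by
      intro m hm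
      have h1 := hv m (‖g m‖⁻¹ • g m) (hm0 m hm)
        (by rw [norm_smul, norm_inv, norm_norm, inv_mul_cancel₀ (hpos m hm).ne'])
        (by rw [map_smul, hg' m, smul_comm])
      rw [inner_smul_right] at h1
      have h2 : |‖g m‖⁻¹ * inner ℝ v (g m)| ≤ |m| * Real.sqrt K := by
        rw [← Real.sqrt_sq_eq_abs, ← Real.sqrt_sq_eq_abs m, ← Real.sqrt_mul (sq_nonneg m)]
        exact Real.sqrt_le_sqrt h1
      rw [abs_mul, abs_inv, abs_norm, inv_mul_le_iff₀ (hpos m hm)] at h2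
      linarith
    have hnorm : ‖∑ m ∈ g.support, g m‖ ^ 2 = ∑ m ∈ g.support, ‖g m‖ ^ 2 := by
      rw [← real_inner_self_eq_norm_sq, sum_inner]
      refine Finset.sum_congr rfl fun m hm => ?_
      rw [inner_sum, Finset.sum_eq_single_of_mem m hm fun m' _ h => hortho m m' h.symm,
        real_inner_self_eq_norm_sq]
    -- The normalised components form an orthonormal family on which ‖T e‖² = m², so the
    -- Hilbert–Schmidt bound controls the sum of the m².
    have hsum : ∑ m ∈ g.support, (|m| * Real.sqrt K) ^ 2 ≤ C * K := by
      have ho : Orthonormal ℝ (fun m : g.support => ‖g m‖⁻¹ • g m) := by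
        refine ⟨fun m => ?_, fun m m' h => ?_⟩
        · rw [norm_smul, norm_inv, norm_norm, inv_mul_cancel₀ (hpos m m.2).ne']
        · change inner ℝ (‖g m‖⁻¹ • g m) (‖g m'‖⁻¹ • g m') = 0
          rw [inner_smul_left, inner_smul_right,
            hortho m m' fun h' => h (Subtype.ext h'), mul_zero, mul_zero]
      have h3 := hT _ _ ho
      have h4 : ∀ m : g.support, ‖T (‖g m‖⁻¹ • g m)‖ ^ 2 = (m : ℝ) ^ 2 := fun m => by
        rw [map_smul, hg', smul_comm, norm_smul, norm_smul, norm_inv, norm_norm,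
          inv_mul_cancel₀ (hpos m m.2).ne', mul_one, Real.norm_eq_abs, sq_abs]
      simp only [h4] at h3
      rw [Finset.sum_coe_sort g.support (fun m : ℝ => m ^ 2)] at h3
      calc ∑ m ∈ g.support, (|m| * Real.sqrt K) ^ 2 = (∑ m ∈ g.support, m ^ 2) * K := by
            rw [Finset.sum_mul]
            exact Finset.sum_congr rfl fun m _ => by rw [mul_pow, sq_abs, Real.sq_sqrt hK]
        _ ≤ C * K := mul_le_mul_of_nonneg_right h3 hK
    calc |inner ℝ v (∑ m ∈ g.support, g m)| ≤ ∑ m ∈ g.support, |inner ℝ v (g m)| := by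
          rw [inner_sum]; exact Finset.abs_sum_le_sum_abs _ _
      _ ≤ ∑ m ∈ g.support, (|m| * Real.sqrt K) * ‖g m‖ := Finset.sum_le_sum hterm
      _ ≤ Real.sqrt (∑ m ∈ g.support, (|m| * Real.sqrt K) ^ 2) *
            Real.sqrt (∑ m ∈ g.support, ‖g m‖ ^ 2) := Real.sum_mul_le_sqrt_mul_sqrt _ _ _
      _ ≤ Real.sqrt (C * K) * ‖∑ m ∈ g.support, g m‖ := by
          rw [← hnorm, Real.sqrt_sq (norm_nonneg _)]
          exact mul_le_mul_of_nonneg_right (Real.sqrt_le_sqrt hsum) (norm_nonneg _)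
  have hall : |inner ℝ v v| ≤ Real.sqrt (C * K) * ‖v‖ := by
    have hmem : v ∈ closure (U : Set H) := by
      rw [← Submodule.topologicalClosure_coe, hdense]; trivial
    have hcl : IsClosed {x : H | |inner ℝ v x| ≤ Real.sqrt (C * K) * ‖x‖} :=
      isClosed_le (by fun_prop) (by fun_prop)
    exact closure_minimal (fun x hx => key x hx) hcl hmem
  rw [real_inner_self_eq_norm_sq, abs_of_nonneg (sq_nonneg _)] at hall
  have h7 : ‖v‖ ≤ Real.sqrt (C * K) := by
    rcases (norm_nonneg v).eq_or_lt with h | h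
    · rw [← h]; exact Real.sqrt_nonneg _
    · nlinarith
  calc ‖v‖ ^ 2 ≤ Real.sqrt (C * K) ^ 2 := by gcongr
    _ = C * K := Real.sq_sqrt (mul_nonneg hC hK)

end Hilbert

/-! ### Integral operators with bounded kernel on L²(0, L). -/

section L2

variable {L : ℝ}

theorem inner_eq_integral (u v : L2Interval L) :
    inner ℝ u v = ∫ x in Ioo 0 L, u x * v x := by
  rw [L2.inner_def]
  refine integral_congr_ae (Filter.Eventually.of_forall fun x => ?_)
  simp [mul_comm]

theorem norm_sq_eq_integral (v : L2Interval L) : ‖v‖ ^ 2 = ∫ x in Ioo 0 L, v x ^ 2 := by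
  rw [← real_inner_self_eq_norm_sq, inner_eq_integral]
  simp only [sq]

theorem memLp_of_abs_le {g : ℝ → ℝ} (hg : AEStronglyMeasurable g (intervalMeasure L)) (C : ℝ)
    (h : ∀ x ∈ Ioo 0 L, |g x| ≤ C) : MemLp g 2 (intervalMeasure L) :=
  MemLp.of_bound hg C ((ae_restrict_iff' measurableSet_Ioo).2 (Filter.Eventually.of_forall h))

theorem integrable_coe (v : L2Interval L) : Integrable v (intervalMeasure L) :=
  (Lp.memLp v).integrable one_le_two

theorem integral_mul_eq_inner {g h : ℝ → ℝ} (hg : MemLp g 2 (intervalMeasure L))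
    (hh : MemLp h 2 (intervalMeasure L)) :
    ∫ x in Ioo 0 L, g x * h x = inner ℝ hg.toLp hh.toLp := by
  rw [inner_eq_integral]
  refine integral_congr_ae ?_
  filter_upwards [hg.coeFn_toLp, hh.coeFn_toLp] with x h1 h2
  rw [h1, h2]

theorem norm_toLp_sq {g : ℝ → ℝ} (hg : MemLp g 2 (intervalMeasure L)) :
    ‖hg.toLp‖ ^ 2 = ∫ x in Ioo 0 L, g x ^ 2 := by
  rw [← real_inner_self_eq_norm_sq, ← integral_mul_eq_inner hg hg]
  simp only [sq]

theorem norm_toLp_sq_le {g : ℝ → ℝ} (hL : 0 ≤ L) (hg : MemLp g 2 (intervalMeasure L)) (C : ℝ)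
    (h : ∀ x ∈ Ioo 0 L, |g x| ≤ C) : ‖hg.toLp‖ ^ 2 ≤ C ^ 2 * L := by
  rw [norm_toLp_sq]
  calc ∫ x in Ioo 0 L, g x ^ 2 ≤ ∫ _ in Ioo 0 L, C ^ 2 := by
        refine setIntegral_mono_on hg.integrable_sq (by simp) measurableSet_Ioo fun x hx => ?_
        rw [← sq_abs]
        exact pow_le_pow_left₀ (abs_nonneg _) (h x hx) 2
    _ = C ^ 2 * L := by simp [hL, mul_comm]

/-- A bounded measurable kernel. -/
structure IsBoundedKernel (K : ℝ → ℝ → ℝ) : Prop where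
  measurable : Measurable (Function.uncurry K)
  abs_le : ∀ x y, |K x y| ≤ 1

namespace IsBoundedKernel

variable {K : ℝ → ℝ → ℝ} (hK : IsBoundedKernel K)
include hK

theorem swap : IsBoundedKernel (fun x y => K y x) :=
  ⟨hK.measurable.comp measurable_swap, fun x y => hK.abs_le y x⟩

theorem memLp (x : ℝ) : MemLp (K x) 2 (intervalMeasure L) :=
  memLp_of_abs_le (hK.measurable.comp measurable_prodMk_left).aestronglyMeasurable 1
    fun y _ => hK.abs_le x y

theorem integral_eq_inner (v : L2Interval L) (x : ℝ) :
    ∫ y in Ioo 0 L, K x y * v y = inner ℝ (hK.memLp x).toLp v := by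
  rw [inner_eq_integral]
  refine integral_congr_ae ?_
  filter_upwards [(hK.memLp (L := L) x).coeFn_toLp] with y h1
  rw [h1]

theorem norm_sq_le (hL : 0 ≤ L) (x : ℝ) :
    ‖((hK.memLp x).toLp : L2Interval L)‖ ^ 2 ≤ L := by
  simpa using norm_toLp_sq_le hL (hK.memLp x) 1 fun y _ => hK.abs_le x y

theorem abs_integral_le (hL : 0 ≤ L) (v : L2Interval L) (x : ℝ) :
    |∫ y in Ioo 0 L, K x y * v y| ≤ Real.sqrt L * ‖v‖ := by
  rw [hK.integral_eq_inner]
  refine (abs_real_inner_le_norm _ _).trans (mul_le_mul_of_nonneg_right ?_ (norm_nonneg _))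
  exact Real.le_sqrt_of_sq_le (hK.norm_sq_le hL x)

theorem memLp_integral (hL : 0 ≤ L) (v : L2Interval L) :
    MemLp (fun x => ∫ y in Ioo 0 L, K x y * v y) 2 (intervalMeasure L) := by
  refine memLp_of_abs_le ?_ _ fun x _ => hK.abs_integral_le hL v x
  refine StronglyMeasurable.aestronglyMeasurable ?_
  refine StronglyMeasurable.integral_prod_right (f := fun x y => K x y * v y) ?_
  exact hK.measurable.stronglyMeasurable.mul
    ((Lp.stronglyMeasurable v).comp_measurable measurable_snd)

end IsBoundedKernel

/-- The integral operator on `L²(0, L)` with a given bounded kernel. -/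
noncomputable def kernelOp (hL : 0 ≤ L) {K : ℝ → ℝ → ℝ} (hK : IsBoundedKernel K) :
    L2Interval L →L[ℝ] L2Interval L :=
  LinearMap.mkContinuous
    { toFun := fun v => (hK.memLp_integral hL v).toLp
      map_add' := fun u v => by
        rw [← MemLp.toLp_add]
        refine MemLp.toLp_congr _ _ (Filter.Eventually.of_forall fun x => ?_)
        simp only [Pi.add_apply]
        rw [hK.integral_eq_inner, hK.integral_eq_inner, hK.integral_eq_inner, inner_add_right]
      map_smul' := fun c v => by
        rw [RingHom.id_apply, ← MemLp.toLp_const_smul]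
        refine MemLp.toLp_congr _ _ (Filter.Eventually.of_forall fun x => ?_)
        simp only [Pi.smul_apply]
        rw [hK.integral_eq_inner, hK.integral_eq_inner, inner_smul_right, smul_eq_mul] }
    L fun v => by
      change ‖(hK.memLp_integral hL v).toLp‖ ≤ _
      refine abs_le_of_sq_le_sq' ?_ (by positivity) |>.2
      refine (norm_toLp_sq_le hL _ (Real.sqrt L * ‖v‖) fun x _ => hK.abs_integral_le hL v x).trans ?_
      rw [mul_pow, Real.sq_sqrt hL]
      exact le_of_eq (by ring)

theorem kernelOp_coeFn (hL : 0 ≤ L) {K : ℝ → ℝ → ℝ} (hK : IsBoundedKernel K) (v : L2Interval L) :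
    kernelOp hL hK v =ᵐ[intervalMeasure L] fun x => ∫ y in Ioo 0 L, K x y * v y :=
  (hK.memLp_integral hL v).coeFn_toLp

/-- For fixed x the inner integrals are the coefficients of K(x, ·) along the e i. Bessel bounds the
sum of their squares by ‖K(x, ·)‖² ≤ L, and integration in x gives the second factor L. -/
theorem sum_norm_kernelOp_sq_le (hL : 0 ≤ L) {K : ℝ → ℝ → ℝ} (hK : IsBoundedKernel K)
    {ι : Type} [Fintype ι] (e : ι → L2Interval L) (he : Orthonormal ℝ e) :
    ∑ i, ‖kernelOp hL hK (e i)‖ ^ 2 ≤ L ^ 2 := by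
  have h1 : ∀ i, ‖kernelOp hL hK (e i)‖ ^ 2 =
      ∫ x in Ioo 0 L, (∫ y in Ioo 0 L, K x y * e i y) ^ 2 := fun i =>
    norm_toLp_sq (hK.memLp_integral hL (e i))
  simp only [h1]
  rw [← integral_finsetSum _ fun i _ => (hK.memLp_integral hL (e i)).integrable_sq]
  calc ∫ x in Ioo 0 L, ∑ i, (∫ y in Ioo 0 L, K x y * e i y) ^ 2 ≤ ∫ _ in Ioo 0 L, L := by
        refine setIntegral_mono_on
          (integrable_finsetSum _ fun i _ => (hK.memLp_integral hL (e i)).integrable_sq)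
          (by simp) measurableSet_Ioo fun x _ => ?_
        refine le_trans (le_of_eq ?_) ((he.sum_inner_products_le (s := Finset.univ)
          ((hK.memLp x).toLp : L2Interval L)).trans (hK.norm_sq_le hL x))
        refine Finset.sum_congr rfl fun i _ => ?_
        rw [hK.integral_eq_inner, real_inner_comm, Real.norm_eq_abs, sq_abs]
    _ = L ^ 2 := by simp [hL, sq]

theorem inner_kernelOp (hL : 0 ≤ L) {K : ℝ → ℝ → ℝ} (hK : IsBoundedKernel K) (u v : L2Interval L) :
    inner ℝ (kernelOp hL hK u) v = inner ℝ u (kernelOp hL hK.swap v) := by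
  rw [inner_eq_integral, inner_eq_integral]
  have h1 : ∫ x in Ioo 0 L, kernelOp hL hK u x * v x =
      ∫ x in Ioo 0 L, ∫ y in Ioo 0 L, K x y * u y * v x := by
    refine integral_congr_ae ?_
    filter_upwards [kernelOp_coeFn hL hK u] with x hx
    rw [hx, integral_mul_const]
  have h2 : ∫ y in Ioo 0 L, u y * kernelOp hL hK.swap v y =
      ∫ y in Ioo 0 L, ∫ x in Ioo 0 L, K x y * u y * v x := by
    refine integral_congr_ae ?_
    filter_upwards [kernelOp_coeFn hL hK.swap v] with y hy
    rw [hy, ← integral_const_mul]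
    refine integral_congr_ae (Filter.Eventually.of_forall fun x => ?_)
    simp only; ring
  rw [h1, h2]
  refine integral_integral_swap ?_
  have h3 : Integrable (fun z : ℝ × ℝ => v z.1 * u z.2)
      ((intervalMeasure L).prod (intervalMeasure L)) :=
    (integrable_coe v).mul_prod (integrable_coe u)
  refine h3.mono ?_ (Filter.Eventually.of_forall fun z => ?_)
  · refine StronglyMeasurable.aestronglyMeasurable ?_
    exact (hK.measurable.stronglyMeasurable.mul
      ((Lp.stronglyMeasurable u).comp_measurable measurable_snd)).mul
      ((Lp.stronglyMeasurable v).comp_measurable measurable_fst)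
  · simp only [Function.uncurry, norm_mul, Real.norm_eq_abs]
    have := hK.abs_le z.1 z.2
    calc |K z.1 z.2| * |u z.2| * |v z.1| ≤ 1 * |u z.2| * |v z.1| := by gcongr
      _ = |v z.1| * |u z.2| := by ring

end L2

/-! ### The positive solution E and its ratio kernel. -/

section Weight

/-- The positive solution `x ^ (ν + 1/2) e ^ (ξ x² / 2)` of `G_ξ u = -2 ξ (ν + 1) u`, extended as an
even function. -/
noncomputable def growth (ν ξ x : ℝ) : ℝ := |x| ^ (ν + 1 / 2) * Real.exp (ξ * x ^ 2 / 2)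

/-- The logarithmic derivative of `growth ν ξ`. -/
noncomputable def growthRate (ν ξ x : ℝ) : ℝ := (ν + 1 / 2) / x + ξ * x

variable {ν ξ : ℝ}

theorem growth_pos {x : ℝ} (hx : 0 < x) : 0 < growth ν ξ x :=
  mul_pos (Real.rpow_pos_of_pos (abs_pos.2 hx.ne') _) (Real.exp_pos _)

theorem growth_nonneg (x : ℝ) : 0 ≤ growth ν ξ x :=
  mul_nonneg (Real.rpow_nonneg (abs_nonneg _) _) (Real.exp_pos _).le

theorem growth_zero (hν : 0 < ν) : growth ν ξ 0 = 0 := by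
  simp [growth, Real.zero_rpow (by positivity : ν + 2⁻¹ ≠ 0)]

theorem continuous_growth (hν : 0 < ν) : Continuous (growth ν ξ) := by
  unfold growth
  exact (continuous_abs.rpow_const fun _ => Or.inr (by positivity)).mul (by fun_prop)

theorem growth_mono (hν : 0 < ν) (hξ : 0 ≤ ξ) {x y : ℝ} (hx : 0 ≤ x) (hxy : x ≤ y) :
    growth ν ξ x ≤ growth ν ξ y := by
  unfold growth
  rw [abs_of_nonneg hx, abs_of_nonneg (hx.trans hxy)]
  have := Real.rpow_nonneg (hx.trans hxy) (ν + 1 / 2)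
  gcongr

theorem growth_of_pos {x : ℝ} (hx : 0 < x) :
    growth ν ξ x = x ^ (ν + 1 / 2) * Real.exp (ξ * x ^ 2 / 2) := by
  rw [growth, abs_of_pos hx]

theorem growthRate_nonneg (hν : 0 < ν) (hξ : 0 ≤ ξ) {x : ℝ} (hx : 0 < x) :
    0 ≤ growthRate ν ξ x := by
  unfold growthRate; positivity

theorem hasDerivAt_growth {x : ℝ} (hx : 0 < x) :
    HasDerivAt (growth ν ξ) (growthRate ν ξ x * growth ν ξ x) x := by
  have h1 : HasDerivAt (fun y : ℝ => y ^ (ν + 1 / 2) * Real.exp (ξ * y ^ 2 / 2))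
      (growthRate ν ξ x * growth ν ξ x) x := by
    have h2 := Real.hasDerivAt_rpow_const (x := x) (p := ν + 1 / 2) (Or.inl hx.ne')
    have h3 : HasDerivAt (fun y : ℝ => ξ * y ^ 2 / 2) (ξ * x) x := by
      refine (((hasDerivAt_pow 2 x).const_mul ξ).div_const 2).congr_deriv ?_
      push_cast; ring
    refine (h2.mul h3.exp).congr_deriv ?_
    rw [growth_of_pos hx, growthRate, Real.rpow_sub_one hx.ne']
    ring
  refine h1.congr_of_eventuallyEq ?_
  filter_upwards [lt_mem_nhds hx] with y hy using growth_of_pos hy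

theorem hasDerivAt_growthRate {x : ℝ} (hx : 0 < x) :
    HasDerivAt (growthRate ν ξ) (-(ν + 1 / 2) / x ^ 2 + ξ) x := by
  unfold growthRate
  refine (((hasDerivAt_inv hx.ne').const_mul (ν + 1 / 2)).add
    ((hasDerivAt_id x).const_mul ξ)).congr_deriv ?_
  ring

/-- With q = E'/E this is q' + q² = V + 2ξ(ν+1), that is E'' = (V + 2ξ(ν+1)) E: the source of the
factorisation of G_ξ + 2ξ(ν+1). -/
theorem growthRate_riccati {x : ℝ} (hx : 0 < x) :
    -(ν + 1 / 2) / x ^ 2 + ξ + growthRate ν ξ x ^ 2 =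
      grushinPotential ν ξ x + 2 * ξ * (ν + 1) := by
  unfold growthRate grushinPotential
  field_simp
  ring

/-- The kernel `E(x) / E(y)` for `x < y`, where `E = growth ν ξ`. -/
noncomputable def ratioKernel (ν ξ x y : ℝ) : ℝ :=
  if 0 < x ∧ x < y then growth ν ξ x / growth ν ξ y else 0

/-- E increases on the half-line, so the bound 1 holds for all ν and ξ. This is what keeps the
Hilbert–Schmidt constant independent of ξ. -/
theorem isBoundedKernel_ratioKernel (hν : 0 < ν) (hξ : 0 ≤ ξ) :
    IsBoundedKernel (ratioKernel ν ξ) := by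
  refine ⟨?_, fun x y => ?_⟩
  · unfold ratioKernel Function.uncurry
    have hE := (continuous_growth (ξ := ξ) hν).measurable
    refine Measurable.ite ?_ ((hE.comp measurable_fst).div (hE.comp measurable_snd))
      measurable_const
    exact (measurableSet_lt measurable_const measurable_fst).inter
      (measurableSet_lt measurable_fst measurable_snd)
  · unfold ratioKernel
    split_ifs with h
    · rw [abs_of_nonneg (div_nonneg (growth_nonneg _) (growth_nonneg _))]
      exact div_le_one_of_le₀ (growth_mono hν hξ h.1.le h.2.le) (growth_nonneg _)
    · simp

end Weight

/-! ### The resolvent B B* of G_ξ. -/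

section Resolvent

variable {L ν ξ : ℝ}

theorem memLp_growth (hν : 0 < ν) (hξ : 0 ≤ ξ) : MemLp (growth ν ξ) 2 (intervalMeasure L) :=
  memLp_of_abs_le (continuous_growth hν).aestronglyMeasurable (growth ν ξ L) fun x hx => by
    rw [abs_of_nonneg (growth_nonneg _)]
    exact growth_mono hν hξ hx.1.le hx.2.le

theorem integrableOn_growth_mul (hν : 0 < ν) (hξ : 0 ≤ ξ) (h : L2Interval L) :
    IntegrableOn (fun y => growth ν ξ y * h y) (Ioo 0 L) :=
  (memLp_growth hν hξ).integrable_mul (Lp.memLp h)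

/-- The adjoint B* integrates the flux from 0, which selects the solution regular at the singular
end; `integral_ratioKernel` shows that B integrates back from L, which builds in the Dirichlet
condition there. -/
theorem integral_ratioKernel_swap {s : ℝ} (hs : s ∈ Ioo 0 L) (h : L2Interval L) :
    ∫ y in Ioo 0 L, ratioKernel ν ξ y s * h y =
      (∫ y in Ioo 0 s, growth ν ξ y * h y) / growth ν ξ s := by
  have h1 : ∀ y ∈ Ioo 0 L, ratioKernel ν ξ y s * h y =
      (Ioo 0 s).indicator (fun y => growth ν ξ y * h y / growth ν ξ s) y := by
    intro y hy
    unfold ratioKernel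
    by_cases hys : y < s
    · rw [if_pos ⟨hy.1, hys⟩, indicator_of_mem (show y ∈ Ioo 0 s from ⟨hy.1, hys⟩)]; ring
    · rw [if_neg fun h => hys h.2, indicator_of_notMem (fun h => hys h.2), zero_mul]
  rw [setIntegral_congr_fun measurableSet_Ioo h1, setIntegral_indicator measurableSet_Ioo,
    inter_eq_right.2 (Ioo_subset_Ioo_right hs.2.le), integral_div]

theorem integral_ratioKernel {x : ℝ} (hx : x ∈ Ioo 0 L) (w : ℝ → ℝ) :
    ∫ y in Ioo 0 L, ratioKernel ν ξ x y * w y =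
      growth ν ξ x * ∫ y in Ioo x L, w y / growth ν ξ y := by
  have h1 : ∀ y ∈ Ioo 0 L, ratioKernel ν ξ x y * w y =
      (Ioo x L).indicator (fun y => growth ν ξ x * (w y / growth ν ξ y)) y := by
    intro y hy
    unfold ratioKernel
    by_cases hys : x < y
    · rw [if_pos ⟨hx.1, hys⟩, indicator_of_mem (show y ∈ Ioo x L from ⟨hys, hy.2⟩)]; ring
    · rw [if_neg fun h => hys h.2, indicator_of_notMem (fun h => hys h.1), zero_mul]
  rw [setIntegral_congr_fun measurableSet_Ioo h1, setIntegral_indicator measurableSet_Ioo,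
    inter_eq_right.2 (Ioo_subset_Ioo_left hx.1.le), integral_const_mul]

/-- The inverse of `G_ξ + 2 ξ (ν + 1)`, as `B B*` with `B` the operator with kernel
`ratioKernel ν ξ`. -/
noncomputable def grushinResolvent (hL : 0 ≤ L) (hν : 0 < ν) (hξ : 0 ≤ ξ) :
    L2Interval L →L[ℝ] L2Interval L :=
  kernelOp hL (isBoundedKernel_ratioKernel hν hξ) ∘L
    kernelOp hL (isBoundedKernel_ratioKernel hν hξ).swap

theorem grushinResolvent_coeFn (hL : 0 ≤ L) (hν : 0 < ν) (hξ : 0 ≤ ξ) (h : L2Interval L) :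
    grushinResolvent hL hν hξ h =ᵐ[intervalMeasure L] fun x => growth ν ξ x *
      ∫ s in Ioo x L, (∫ y in Ioo 0 s, growth ν ξ y * h y) / growth ν ξ s ^ 2 := by
  have h1 := kernelOp_coeFn hL (isBoundedKernel_ratioKernel hν hξ)
    (kernelOp hL (isBoundedKernel_ratioKernel hν hξ).swap h)
  have h2 := kernelOp_coeFn hL (isBoundedKernel_ratioKernel hν hξ).swap h
  filter_upwards [h1, ae_restrict_mem measurableSet_Ioo] with x hx hx0
  rw [grushinResolvent, ContinuousLinearMap.comp_apply, hx, integral_ratioKernel hx0]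
  congr 1
  have h3 := ae_mono (Measure.restrict_mono (Ioo_subset_Ioo_left (b := L) hx0.1.le) le_rfl) h2
  refine integral_congr_ae ?_
  filter_upwards [h3, ae_restrict_mem measurableSet_Ioo] with s hs hs0
  rw [hs, integral_ratioKernel_swap ⟨hx0.1.trans hs0.1, hs0.2⟩, sq, div_div]

/-- Symmetry, injectivity and positivity of the eigenvalues of B B* are all read off from this form.
-/
theorem inner_grushinResolvent (hL : 0 ≤ L) (hν : 0 < ν) (hξ : 0 ≤ ξ) (u v : L2Interval L) :
    inner ℝ (grushinResolvent hL hν hξ u) v =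
      inner ℝ (kernelOp hL (isBoundedKernel_ratioKernel hν hξ).swap u)
        (kernelOp hL (isBoundedKernel_ratioKernel hν hξ).swap v) := by
  rw [grushinResolvent, ContinuousLinearMap.comp_apply, inner_kernelOp]

theorem isSymmetric_grushinResolvent (hL : 0 ≤ L) (hν : 0 < ν) (hξ : 0 ≤ ξ) :
    (grushinResolvent hL hν hξ : L2Interval L →ₗ[ℝ] L2Interval L).IsSymmetric := by
  intro u v
  change inner ℝ (grushinResolvent hL hν hξ u) v = inner ℝ u (grushinResolvent hL hν hξ v)
  rw [inner_grushinResolvent, real_inner_comm, ← inner_grushinResolvent, real_inner_comm]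

theorem norm_kernelOp_le (hL : 0 ≤ L) {K : ℝ → ℝ → ℝ} (hK : IsBoundedKernel K)
    (v : L2Interval L) : ‖kernelOp hL hK v‖ ≤ L * ‖v‖ :=
  ContinuousLinearMap.le_of_opNorm_le _ (LinearMap.mkContinuous_norm_le _ hL _) v

/-- One factor L² is the Hilbert–Schmidt bound for B*, the other the square of the operator norm
bound for B. -/
theorem sum_norm_grushinResolvent_sq_le (hL : 0 ≤ L) (hν : 0 < ν) (hξ : 0 ≤ ξ) (ι : Type)
    [Fintype ι] (e : ι → L2Interval L) (he : Orthonormal ℝ e) :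
    ∑ i, ‖grushinResolvent hL hν hξ (e i)‖ ^ 2 ≤ L ^ 4 := by
  have h1 := sum_norm_kernelOp_sq_le hL (isBoundedKernel_ratioKernel hν hξ).swap e he
  calc ∑ i, ‖grushinResolvent hL hν hξ (e i)‖ ^ 2
      ≤ ∑ i, L ^ 2 * ‖kernelOp hL (isBoundedKernel_ratioKernel hν hξ).swap (e i)‖ ^ 2 := by
        refine Finset.sum_le_sum fun i _ => ?_
        rw [← mul_pow]
        rw [grushinResolvent, ContinuousLinearMap.comp_apply]
        exact pow_le_pow_left₀ (norm_nonneg _)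
          (norm_kernelOp_le hL (isBoundedKernel_ratioKernel hν hξ) _) 2
    _ ≤ L ^ 2 * L ^ 2 := by
        rw [← Finset.mul_sum]; exact mul_le_mul_of_nonneg_left h1 (sq_nonneg L)
    _ = L ^ 4 := by ring

theorem setIntegral_Ioo_eq_intervalIntegral {f : ℝ → ℝ} {a b : ℝ} (hab : a ≤ b) :
    ∫ x in Ioo a b, f x = ∫ x in a..b, f x := by
  rw [intervalIntegral.integral_of_le hab, integral_Ioc_eq_integral_Ioo]

theorem intervalIntegrable_growth_mul (hν : 0 < ν) (hξ : 0 ≤ ξ) (hL : 0 ≤ L) (h : L2Interval L) :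
    IntervalIntegrable (fun y => growth ν ξ y * h y) volume 0 L := by
  rw [intervalIntegrable_iff_integrableOn_Ioo_of_le hL]
  exact integrableOn_growth_mul hν hξ h

theorem continuousOn_integral_growth_mul (hν : 0 < ν) (hξ : 0 ≤ ξ) (hL : 0 ≤ L)
    (h : L2Interval L) :
    ContinuousOn (fun s => ∫ y in Ioo 0 s, growth ν ξ y * h y) (Icc 0 L) := by
  have h1 := intervalIntegral.continuousOn_primitive_interval'
    (intervalIntegrable_growth_mul hν hξ hL h) left_mem_uIcc
  rw [uIcc_of_le hL] at h1
  exact h1.congr fun s hs => setIntegral_Ioo_eq_intervalIntegral hs.1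

/-- The flux ∫₀ˢ E h vanishes for almost every s, hence for every s in (0, L) by continuity.
Lebesgue differentiation then gives E h = 0 almost everywhere, and E > 0. -/
theorem kernelOp_swap_eq_zero (hL : 0 ≤ L) (hν : 0 < ν) (hξ : 0 ≤ ξ) (h : L2Interval L)
    (h0 : kernelOp hL (isBoundedKernel_ratioKernel hν hξ).swap h = 0) : h = 0 := by
  have h1 := kernelOp_coeFn hL (isBoundedKernel_ratioKernel hν hξ).swap h
  rw [h0] at h1
  set P : ℝ → ℝ := fun s => ∫ y in Ioo 0 s, growth ν ξ y * h y with hP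
  have h2 : ∀ᵐ s ∂(intervalMeasure L), P s = 0 := by
    filter_upwards [h1, Lp.coeFn_zero ℝ 2 (intervalMeasure L),
      ae_restrict_mem measurableSet_Ioo] with s hs hs' hs0
    rw [hs', integral_ratioKernel_swap hs0] at hs
    have := (div_eq_zero_iff.1 hs.symm)
    exact this.resolve_right (growth_pos hs0.1).ne'
  have hcont := continuousOn_integral_growth_mul hν hξ hL h
  have h3 : EqOn P 0 (Ioo 0 L) := by
    refine MeasureTheory.Measure.eqOn_open_of_ae_eq (μ := volume) h2 isOpen_Ioo
      (hcont.mono Ioo_subset_Icc_self) continuousOn_const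
  have h4 := (intervalIntegrable_growth_mul hν hξ hL h).ae_hasDerivAt_integral
  rw [Lp.eq_zero_iff_ae_eq_zero]
  filter_upwards [ae_restrict_of_ae h4, ae_restrict_mem measurableSet_Ioo] with x hx hx0
  have h5 := hx (by rw [uIcc_of_le hL]; exact Ioo_subset_Icc_self hx0) 0 left_mem_uIcc
  have h6 : HasDerivAt (fun s => ∫ y in (0 : ℝ)..s, growth ν ξ y * h y) 0 x := by
    refine (hasDerivAt_const x (0 : ℝ)).congr_of_eventuallyEq ?_
    filter_upwards [isOpen_Ioo.mem_nhds hx0] with s hs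
    rw [← setIntegral_Ioo_eq_intervalIntegral hs.1.le]
    exact h3 hs
  have h7 := h5.unique h6
  simpa [(growth_pos hx0.1).ne'] using h7

theorem grushinResolvent_injective (hL : 0 ≤ L) (hν : 0 < ν) (hξ : 0 ≤ ξ) (h : L2Interval L)
    (h0 : grushinResolvent hL hν hξ h = 0) : h = 0 := by
  refine kernelOp_swap_eq_zero hL hν hξ h ?_
  have h1 := inner_grushinResolvent hL hν hξ h h
  rw [h0, inner_zero_left] at h1
  exact inner_self_eq_zero.1 h1.symm

theorem grushinResolvent_eigenvalue_pos (hL : 0 ≤ L) (hν : 0 < ν) (hξ : 0 ≤ ξ) {m : ℝ}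
    {φ : L2Interval L} (hm : m ≠ 0) (hφ : ‖φ‖ = 1) (h : grushinResolvent hL hν hξ φ = m • φ) :
    0 < m := by
  have h1 := inner_grushinResolvent hL hν hξ φ φ
  rw [h, inner_smul_left, real_inner_self_eq_norm_sq, hφ, real_inner_self_eq_norm_sq] at h1
  simp only [one_pow, mul_one, conj_trivial] at h1
  exact lt_of_le_of_ne (h1 ▸ sq_nonneg _) hm.symm

end Resolvent

/-! ### Eigenfunctions as classical solutions, bounded after division by E. -/

section Profile

variable {L ν ξ : ℝ}

theorem hasDerivAt_integral_left {g : ℝ → ℝ} (hg : ContinuousOn g (Ioc 0 L)) {x : ℝ}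
    (hx : x ∈ Ioo 0 L) : HasDerivAt (fun y => ∫ s in y..L, g s) (-g x) x := by
  have h1 : ContinuousOn g (Icc x L) := hg.mono fun y hy => ⟨hx.1.trans_le hy.1, hy.2⟩
  refine intervalIntegral.integral_hasDerivAt_left (h1.intervalIntegrable_of_Icc hx.2.le) ?_ ?_
  · exact (hg.mono Ioo_subset_Ioc_self).stronglyMeasurableAtFilter isOpen_Ioo x hx
  · exact (hg.mono Ioo_subset_Ioc_self).continuousAt (isOpen_Ioo.mem_nhds hx)

theorem tendsto_integral_left (hL : 0 < L) {g : ℝ → ℝ} (hg : ContinuousOn g (Ioc 0 L)) :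
    Tendsto (fun y => ∫ s in y..L, g s) (𝓝[<] L) (𝓝 0) := by
  have h1 : ContinuousOn g (uIcc (L / 2) L) := by
    rw [uIcc_of_le (by linarith)]
    exact hg.mono fun y hy => ⟨by linarith [hy.1], hy.2⟩
  have h2 := intervalIntegral.continuousOn_primitive_interval_left (f := g) (a := L / 2) (b := L)
    (μ := volume) (h1.integrableOn_compact isCompact_uIcc)
  have h3 := h2 L right_mem_uIcc
  rw [ContinuousWithinAt, intervalIntegral.integral_same] at h3
  refine h3.mono_left ?_
  rw [uIcc_of_le (by linarith)]
  rw [← nhdsWithin_Ioo_eq_nhdsLT (show L / 2 < L by linarith)]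
  exact nhdsWithin_mono _ Ioo_subset_Icc_self

/-- The function `growth ν ξ * ψ` is an eigenfunction of `G_ξ + 2 ξ (ν + 1)` for the eigenvalue `μ`
which is regular at `0` and vanishes at `L`; here `p = (growth ν ξ) ^ 2 * ψ'`. -/
structure IsProfile (L ν ξ μ : ℝ) (ψ p : ℝ → ℝ) : Prop where
  hasDerivAt_fst : ∀ x ∈ Ioo 0 L, HasDerivAt ψ (p x / growth ν ξ x ^ 2) x
  hasDerivAt_snd : ∀ x ∈ Ioo 0 L, HasDerivAt p (-μ * (growth ν ξ x ^ 2 * ψ x)) x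
  exists_abs_le : ∃ C, ∀ x ∈ Ioo 0 L, |ψ x| ≤ C
  tendsto_snd_zero : Tendsto p (𝓝[>] 0) (𝓝 0)
  tendsto_fst_right : Tendsto ψ (𝓝[<] L) (𝓝 0)
  tendsto_snd_right : Tendsto p (𝓝[<] L) (𝓝 (-(μ * ∫ x in Ioo 0 L, growth ν ξ x ^ 2 * ψ x)))

/-- E² r^γ is r^(2ν+1+γ) times an increasing exponential; the hypothesis on γ says that this power
is nonnegative. -/
theorem sq_growth_mul_rpow_mono (hξ : 0 ≤ ξ) {γ r s : ℝ} (hγ : 0 ≤ 2 * (ν + 1 / 2) + γ)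
    (hr : 0 < r) (hrs : r ≤ s) : growth ν ξ r ^ 2 * r ^ γ ≤ growth ν ξ s ^ 2 * s ^ γ := by
  have h1 : ∀ t : ℝ, 0 < t → growth ν ξ t ^ 2 * t ^ γ =
      t ^ (2 * (ν + 1 / 2) + γ) * Real.exp (ξ * t ^ 2 / 2) ^ 2 := fun t ht => by
    rw [growth_of_pos ht, mul_pow, Real.rpow_add ht (2 * (ν + 1 / 2)) γ, two_mul (ν + 1 / 2),
      Real.rpow_add ht (ν + 1 / 2) (ν + 1 / 2), sq (t ^ (ν + 1 / 2))]
    ring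
  rw [h1 r hr, h1 s (hr.trans_le hrs)]
  have := Real.rpow_nonneg (hr.le.trans hrs) (2 * (ν + 1 / 2) + γ)
  gcongr

theorem norm_setIntegral_Ioo_le {f : ℝ → ℝ} {a b C : ℝ} (hab : a ≤ b)
    (h : ∀ x ∈ Ioo a b, |f x| ≤ C) : |∫ x in Ioo a b, f x| ≤ C * (b - a) := by
  have h1 := norm_setIntegral_le_of_norm_le_const (μ := volume) (s := Ioo a b) (f := f) (C := C)
    (by simp) fun x hx => h x hx
  rwa [Real.norm_eq_abs, Measure.real, Real.volume_Ioo,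
      ENNReal.toReal_ofReal (sub_nonneg.2 hab)] at h1

/-- One step of the improvement of the behaviour of an eigenfunction at `0`. -/
theorem abs_le_rpow_step (hL : 0 < L) (hξ : 0 ≤ ξ) {μ γ C : ℝ} (hμ : 0 < μ) {ψ P : ℝ → ℝ}
    (hγ : -(ν + 1 / 2) ≤ γ) (hν : 0 < ν) (hC : 0 ≤ C)
    (hP : ∀ s ∈ Ioo 0 L, P s = ∫ y in Ioo 0 s, growth ν ξ y ^ 2 * ψ y)
    (hψ : ∀ x ∈ Ioo 0 L, ψ x = μ * ∫ s in Ioo x L, P s / growth ν ξ s ^ 2)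
    (hb : ∀ x ∈ Ioo 0 L, |ψ x| ≤ C * x ^ γ) :
    ∃ C', 0 ≤ C' ∧ ∀ x ∈ Ioo 0 L, |ψ x| ≤ C' * x ^ (min (γ + 1) 0) := by
  -- By monotonicity of E² r^γ, the integral over (0, s) is at most s times the value of the bound
  -- at s, so dividing by E² gains one power of s.
  have hPb : ∀ s ∈ Ioo 0 L, |P s / growth ν ξ s ^ 2| ≤ C * s ^ (γ + 1) := by
    intro s hs
    have hE : 0 < growth ν ξ s ^ 2 := pow_pos (growth_pos hs.1) 2
    rw [hP s hs, abs_div, abs_of_pos hE, div_le_iff₀ hE]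
    have h1 : |∫ y in Ioo 0 s, growth ν ξ y ^ 2 * ψ y| ≤
        (C * (growth ν ξ s ^ 2 * s ^ γ)) * (s - 0) := by
      refine norm_setIntegral_Ioo_le hs.1.le fun y hy => ?_
      rw [abs_mul, abs_of_nonneg (sq_nonneg _)]
      calc growth ν ξ y ^ 2 * |ψ y| ≤ growth ν ξ y ^ 2 * (C * y ^ γ) :=
            mul_le_mul_of_nonneg_left (hb y ⟨hy.1, hy.2.trans hs.2⟩) (sq_nonneg _)
        _ = C * (growth ν ξ y ^ 2 * y ^ γ) := by ring
        _ ≤ _ := mul_le_mul_of_nonneg_left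
            (sq_growth_mul_rpow_mono hξ (by linarith) hy.1 hy.2.le) hC
    rw [Real.rpow_add_one hs.1.ne']
    linarith
  have hp := Real.rpow_nonneg hL.le (γ + 1 - min (γ + 1) 0)
  refine ⟨μ * (C * L ^ (γ + 1 - min (γ + 1) 0) * L), by positivity, fun x hx => ?_⟩
  have hxp := Real.rpow_nonneg hx.1.le (min (γ + 1) 0)
  rw [hψ x hx, abs_mul, abs_of_pos hμ, mul_assoc]
  refine mul_le_mul_of_nonneg_left ?_ hμ.le
  have h3 := norm_setIntegral_Ioo_le (f := fun s => P s / growth ν ξ s ^ 2)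
    (C := C * L ^ (γ + 1 - min (γ + 1) 0) * x ^ (min (γ + 1) 0)) hx.2.le fun s hs => by
      have hs0 : 0 < s := hx.1.trans hs.1
      refine (hPb s ⟨hs0, hs.2⟩).trans ?_
      rw [mul_assoc]
      refine mul_le_mul_of_nonneg_left ?_ hC
      -- The nonpositive part of the exponent is split off: its power of s is decreasing, hence
      -- largest at x, and what remains is at most a power of L.
      have e1 : γ + 1 = (γ + 1 - min (γ + 1) 0) + min (γ + 1) 0 := by ring
      conv_lhs => rw [e1, Real.rpow_add hs0]
      refine mul_le_mul ?_ ?_ (Real.rpow_nonneg hs0.le _) hp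
      · exact Real.rpow_le_rpow hs0.le hs.2.le (sub_nonneg.2 (min_le_left _ _))
      · exact Real.rpow_le_rpow_of_nonpos hx.1 hs.1.le (min_le_right _ _)
  refine h3.trans ?_
  rw [mul_assoc, mul_assoc, mul_assoc, mul_assoc, mul_comm (x ^ _)]
  gcongr
  linarith [hx.1]

/-- Iteration of the gain of one power: after j steps the exponent is min(j - (ν+1/2), 0), which is
0 as soon as j ≥ ν + 1/2. -/
theorem exists_abs_le_of_rpow (hL : 0 < L) (hξ : 0 ≤ ξ) {μ C : ℝ} (hμ : 0 < μ) {ψ P : ℝ → ℝ}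
    (hν : 0 < ν) (hC : 0 ≤ C)
    (hP : ∀ s ∈ Ioo 0 L, P s = ∫ y in Ioo 0 s, growth ν ξ y ^ 2 * ψ y)
    (hψ : ∀ x ∈ Ioo 0 L, ψ x = μ * ∫ s in Ioo x L, P s / growth ν ξ s ^ 2)
    (hb : ∀ x ∈ Ioo 0 L, |ψ x| ≤ C * x ^ (-(ν + 1 / 2))) :
    ∃ C, ∀ x ∈ Ioo 0 L, |ψ x| ≤ C := by
  have key : ∀ j : ℕ, ∃ C', 0 ≤ C' ∧
      ∀ x ∈ Ioo 0 L, |ψ x| ≤ C' * x ^ (min ((j : ℝ) - (ν + 1 / 2)) 0) := by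
    intro j
    induction j with
    | zero =>
      refine ⟨C, hC, fun x hx => ?_⟩
      rw [min_eq_left (by push_cast; linarith)]
      simpa using hb x hx
    | succ j ih =>
      obtain ⟨C', hC', h⟩ := ih
      obtain ⟨C'', hC'', h'⟩ := abs_le_rpow_step hL hξ hμ (le_min (by
        have : (0 : ℝ) ≤ j := Nat.cast_nonneg j
        linarith) (by linarith)) hν hC' hP hψ h
      have e : min (min ((j : ℝ) - (ν + 1 / 2)) 0 + 1) 0 =
          min (((j + 1 : ℕ) : ℝ) - (ν + 1 / 2)) 0 := by
        push_cast
        rcases le_total ((j : ℝ) - (ν + 1 / 2)) 0 with h0 | h0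
        · rw [min_eq_left h0]; congr 1; ring
        · rw [min_eq_right h0, min_eq_right (by linarith), min_eq_right (by linarith)]
      exact ⟨C'', hC'', fun x hx => e ▸ h' x hx⟩
  obtain ⟨j, hj⟩ := exists_nat_ge (ν + 1 / 2)
  obtain ⟨C', -, h⟩ := key j
  refine ⟨C', fun x hx => ?_⟩
  have := h x hx
  rwa [min_eq_right (by linarith), Real.rpow_zero, mul_one] at this

/-- Every eigenvector of the resolvent has a profile. -/
theorem exists_isProfile (hL : 0 < L) (hν : 0 < ν) (hξ : 0 ≤ ξ) {m : ℝ} {φ : L2Interval L}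
    (hm : 0 < m) (h : grushinResolvent hL.le hν hξ φ = m • φ) :
    ∃ ψ p : ℝ → ℝ, IsProfile L ν ξ m⁻¹ ψ p ∧
      φ =ᵐ[intervalMeasure L] fun x => growth ν ξ x * ψ x := by
  set μ := m⁻¹ with hμdef
  have hμ : 0 < μ := inv_pos.2 hm
  set P : ℝ → ℝ := fun s => ∫ y in Ioo 0 s, growth ν ξ y * φ y with hPdef
  set ψ : ℝ → ℝ := fun x => μ * ∫ s in x..L, P s / growth ν ξ s ^ 2 with hψdef
  have hψ : ∀ x ∈ Ioo 0 L, ψ x = μ * ∫ s in Ioo x L, P s / growth ν ξ s ^ 2 := fun x hx => by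
    rw [hψdef, setIntegral_Ioo_eq_intervalIntegral hx.2.le]
  have hφ : φ =ᵐ[intervalMeasure L] fun x => growth ν ξ x * ψ x := by
    have h1 := grushinResolvent_coeFn hL.le hν hξ φ
    rw [h] at h1
    filter_upwards [h1, Lp.coeFn_smul m φ, ae_restrict_mem measurableSet_Ioo] with x h2 h3 hx
    rw [h3, Pi.smul_apply, smul_eq_mul] at h2
    rw [hψ x hx, mul_left_comm, ← h2, hμdef, inv_mul_cancel_left₀ hm.ne']
  have hPcont : ContinuousOn P (Icc 0 L) := continuousOn_integral_growth_mul hν hξ hL.le φ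
  have hgcont : ContinuousOn (fun s => P s / growth ν ξ s ^ 2) (Ioc 0 L) :=
    (hPcont.mono Ioc_subset_Icc_self).div ((continuous_growth hν).pow 2).continuousOn
      fun x hx => (pow_pos (growth_pos hx.1) 2).ne'
  have hdψ : ∀ x ∈ Ioo 0 L, HasDerivAt ψ (-μ * P x / growth ν ξ x ^ 2) x := fun x hx =>
    ((hasDerivAt_integral_left hgcont hx).const_mul μ).congr_deriv (by ring)
  have hPψ : ∀ s ∈ Icc 0 L, P s = ∫ y in Ioo 0 s, growth ν ξ y ^ 2 * ψ y := fun s hs => by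
    have h1 := ae_mono (Measure.restrict_mono (μ := volume) (Ioo_subset_Ioo_right hs.2) le_rfl) hφ
    refine integral_congr_ae ?_
    filter_upwards [h1] with y hy
    rw [hy]; ring
  have hψc : ContinuousOn ψ (Ioo 0 L) := fun x hx => (hdψ x hx).continuousAt.continuousWithinAt
  have hint : IntervalIntegrable (fun y => growth ν ξ y ^ 2 * ψ y) volume 0 L := by
    rw [intervalIntegrable_iff_integrableOn_Ioo_of_le hL.le]
    refine (integrableOn_growth_mul hν hξ φ).congr ?_
    filter_upwards [hφ] with y hy
    rw [hy]; ring
  have hcont2 : ContinuousOn (fun y => growth ν ξ y ^ 2 * ψ y) (Ioo 0 L) :=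
    ((continuous_growth hν).pow 2).continuousOn.mul hψc
  have hdP : ∀ x ∈ Ioo 0 L, HasDerivAt P (growth ν ξ x ^ 2 * ψ x) x := by
    intro x hx
    have h1 : HasDerivAt (fun s => ∫ y in (0 : ℝ)..s, growth ν ξ y ^ 2 * ψ y)
        (growth ν ξ x ^ 2 * ψ x) x := by
      refine intervalIntegral.integral_hasDerivAt_right ?_
        (hcont2.stronglyMeasurableAtFilter isOpen_Ioo x hx)
        (hcont2.continuousAt (isOpen_Ioo.mem_nhds hx))
      exact hint.mono_set (by
        rw [uIcc_of_le hx.1.le, uIcc_of_le hL.le]; exact Icc_subset_Icc_right hx.2.le)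
    refine h1.congr_of_eventuallyEq ?_
    filter_upwards [isOpen_Ioo.mem_nhds hx] with s hs
    rw [hPψ s (Ioo_subset_Icc_self hs), setIntegral_Ioo_eq_intervalIntegral hs.1.le]
  -- Starting exponent of the bootstrap: Eψ is bounded, being μ times B applied to an L² function,
  -- and E(x) ≥ x^(ν+1/2).
  have hφb : ∃ C, 0 ≤ C ∧ ∀ x ∈ Ioo 0 L, |ψ x| ≤ C * x ^ (-(ν + 1 / 2)) := by
    set K := μ * (Real.sqrt L *
      ‖kernelOp hL.le (isBoundedKernel_ratioKernel hν hξ).swap φ‖) with hK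
    refine ⟨K, by positivity, fun x hx => ?_⟩
    have h1 := (isBoundedKernel_ratioKernel hν hξ).abs_integral_le hL.le
      (kernelOp hL.le (isBoundedKernel_ratioKernel hν hξ).swap φ) x
    rw [integral_ratioKernel hx] at h1
    have h2 : ∫ y in Ioo x L,
        kernelOp hL.le (isBoundedKernel_ratioKernel hν hξ).swap φ y / growth ν ξ y =
        ∫ s in Ioo x L, P s / growth ν ξ s ^ 2 := by
      have h3 := ae_mono (Measure.restrict_mono (Ioo_subset_Ioo_left (b := L) hx.1.le) le_rfl)
        (kernelOp_coeFn hL.le (isBoundedKernel_ratioKernel hν hξ).swap φ)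
      refine integral_congr_ae ?_
      filter_upwards [h3, ae_restrict_mem measurableSet_Ioo] with s hs hs0
      rw [hs, integral_ratioKernel_swap ⟨hx.1.trans hs0.1, hs0.2⟩, sq, div_div]
    rw [h2, abs_mul, abs_of_pos (growth_pos hx.1)] at h1
    rw [hψ x hx, abs_mul, abs_of_pos hμ, hK, mul_assoc]
    refine mul_le_mul_of_nonneg_left ?_ hμ.le
    rw [Real.rpow_neg hx.1.le, ← div_eq_mul_inv, le_div_iff₀ (Real.rpow_pos_of_pos hx.1 _)]
    refine le_trans ?_ h1
    rw [mul_comm]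
    refine mul_le_mul_of_nonneg_right ?_ (abs_nonneg _)
    rw [growth_of_pos hx.1]
    refine le_mul_of_one_le_right (Real.rpow_nonneg hx.1.le _) (Real.one_le_exp ?_)
    positivity
  obtain ⟨C, hC, hb⟩ := hφb
  refine ⟨ψ, fun s => -μ * P s, ⟨hdψ, fun x hx => (hdP x hx).const_mul _, ?_, ?_, ?_, ?_⟩, hφ⟩
  · exact exists_abs_le_of_rpow hL hξ hμ hν hC (fun s hs => hPψ s (Ioo_subset_Icc_self hs)) hψ hb
  · have h1 : Tendsto P (𝓝[>] 0) (𝓝 (P 0)) :=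
      (hPcont 0 (left_mem_Icc.2 hL.le)).mono_left
        (by rw [← nhdsWithin_Ioo_eq_nhdsGT hL]; exact nhdsWithin_mono _ Ioo_subset_Icc_self)
    have h2 : P 0 = 0 := by simp [hPdef]
    simpa [h2] using h1.const_mul (-μ)
  · simpa using (tendsto_integral_left hL hgcont).const_mul μ
  · have h1 : Tendsto P (𝓝[<] L) (𝓝 (P L)) :=
      (hPcont L (right_mem_Icc.2 hL.le)).mono_left
        (by rw [← nhdsWithin_Ioo_eq_nhdsLT hL]; exact nhdsWithin_mono _ Ioo_subset_Icc_self)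
    rw [← hPψ L (right_mem_Icc.2 hL.le)]
    simpa using h1.const_mul (-μ)

end Profile

/-! ### Comparison estimates for (E²G')' = k. -/

section Comparison

variable {L ν ξ : ℝ}

theorem monotoneOn_Ioo_of_hasDerivAt {a b : ℝ} {G g : ℝ → ℝ}
    (hG : ∀ x ∈ Ioo a b, HasDerivAt G (g x) x) (hg : ∀ x ∈ Ioo a b, 0 ≤ g x) :
    MonotoneOn G (Ioo a b) :=
  monotoneOn_of_hasDerivWithinAt_nonneg (f' := g) (convex_Ioo a b)
    (fun x hx => (hG x hx).continuousAt.continuousWithinAt)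
    (fun x hx => (hG x (interior_subset hx)).hasDerivWithinAt)
    (fun x hx => hg x (interior_subset hx))

/-- H - G is nondecreasing, and the comparison point is sent to 0. Only the sign of H is needed
there, not a limit. -/
theorem le_of_hasDerivAt_left {G g H h : ℝ → ℝ} (hG : ∀ x ∈ Ioo 0 L, HasDerivAt G (g x) x)
    (hH : ∀ x ∈ Ioo 0 L, HasDerivAt H (h x) x) (hgh : ∀ x ∈ Ioo 0 L, g x ≤ h x)
    (hG0 : Tendsto G (𝓝[>] 0) (𝓝 0)) (hH0 : ∀ x ∈ Ioo 0 L, 0 ≤ H x) {x : ℝ} (hx : x ∈ Ioo 0 L) :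
    G x ≤ H x := by
  have hmono := monotoneOn_Ioo_of_hasDerivAt (fun x hx => (hH x hx).sub (hG x hx))
    fun x hx => sub_nonneg.2 (hgh x hx)
  have h1 : Tendsto (fun y => G y + H x) (𝓝[>] 0) (𝓝 (0 + H x)) := hG0.add_const _
  rw [zero_add] at h1
  refine ge_of_tendsto h1 ?_
  filter_upwards [Ioo_mem_nhdsGT hx.1] with y hy
  have hy' : y ∈ Ioo 0 L := ⟨hy.1, hy.2.trans hx.2⟩
  have h2 : H y - G y ≤ H x - G x := hmono hy' hx hy.2.le
  linarith [hH0 y hy']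

theorem abs_le_of_hasDerivAt_left {G g H h : ℝ → ℝ} (hG : ∀ x ∈ Ioo 0 L, HasDerivAt G (g x) x)
    (hH : ∀ x ∈ Ioo 0 L, HasDerivAt H (h x) x) (hgh : ∀ x ∈ Ioo 0 L, |g x| ≤ h x)
    (hG0 : Tendsto G (𝓝[>] 0) (𝓝 0)) (hH0 : ∀ x ∈ Ioo 0 L, 0 ≤ H x) {x : ℝ} (hx : x ∈ Ioo 0 L) :
    |G x| ≤ H x := by
  refine abs_le'.2 ⟨le_of_hasDerivAt_left hG hH (fun x hx => (le_abs_self _).trans (hgh x hx))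
    hG0 hH0 hx, ?_⟩
  exact le_of_hasDerivAt_left (G := fun x => -G x) (fun x hx => (hG x hx).fun_neg) hH
    (fun x hx => (neg_le_abs _).trans (hgh x hx)) (by simpa using hG0.neg) hH0 hx

theorem le_of_hasDerivAt_right {G g H h : ℝ → ℝ} (hG : ∀ x ∈ Ioo 0 L, HasDerivAt G (g x) x)
    (hH : ∀ x ∈ Ioo 0 L, HasDerivAt H (h x) x) (hgh : ∀ x ∈ Ioo 0 L, h x ≤ g x)
    (hG0 : Tendsto G (𝓝[<] L) (𝓝 0)) (hH0 : ∀ x ∈ Ioo 0 L, 0 ≤ H x) {x : ℝ} (hx : x ∈ Ioo 0 L) :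
    G x ≤ H x := by
  have hmono := monotoneOn_Ioo_of_hasDerivAt (fun x hx => (hG x hx).sub (hH x hx))
    fun x hx => sub_nonneg.2 (hgh x hx)
  have h1 : Tendsto (fun y => G y + H x) (𝓝[<] L) (𝓝 (0 + H x)) := hG0.add_const _
  rw [zero_add] at h1
  refine ge_of_tendsto h1 ?_
  filter_upwards [Ioo_mem_nhdsLT hx.2] with y hy
  have hy' : y ∈ Ioo 0 L := ⟨hx.1.trans hy.1, hy.2⟩
  have h2 : G x - H x ≤ G y - H y := hmono hx hy' hy.1.le
  linarith [hH0 y hy']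

theorem abs_le_of_hasDerivAt_right {G g H h : ℝ → ℝ} (hG : ∀ x ∈ Ioo 0 L, HasDerivAt G (g x) x)
    (hH : ∀ x ∈ Ioo 0 L, HasDerivAt H (h x) x) (hgh : ∀ x ∈ Ioo 0 L, |g x| ≤ -h x)
    (hG0 : Tendsto G (𝓝[<] L) (𝓝 0)) (hH0 : ∀ x ∈ Ioo 0 L, 0 ≤ H x) {x : ℝ} (hx : x ∈ Ioo 0 L) :
    |G x| ≤ H x := by
  refine abs_le'.2 ⟨le_of_hasDerivAt_right hG hH (fun x hx => ?_) hG0 hH0 hx, ?_⟩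
  · linarith [neg_abs_le (g x), hgh x hx]
  · refine le_of_hasDerivAt_right (G := fun x => -G x) (fun x hx => (hG x hx).fun_neg) hH
      (fun x hx => ?_) (by simpa using hG0.neg) hH0 hx
    linarith [le_abs_self (g x), hgh x hx]

theorem hasDerivAt_pow_div (j : ℕ) (x : ℝ) :
    HasDerivAt (fun y : ℝ => y ^ (j + 1) / ((j : ℝ) + 1)) (x ^ j) x := by
  refine ((hasDerivAt_pow (j + 1) x).div_const _).congr_deriv ?_
  push_cast
  field_simp

/-- Since (2i+1)(2i+2) ≥ (i+1)², the two integrations of each iteration produce the factor (i!)⁻² on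
which all later series rest. -/
theorem div_mul_div_le {c y : ℝ} (hc : 0 ≤ c) (hy : 0 ≤ y) (i : ℕ) :
    c / (((2 * i : ℕ) : ℝ) + 1) * (y / (((2 * i + 1 : ℕ) : ℝ) + 1)) ≤
      c * y / ((i : ℝ) + 1) ^ 2 := by
  rw [div_mul_div_comm]
  have : (0 : ℝ) ≤ i := Nat.cast_nonneg i
  refine div_le_div_of_nonneg_left (by positivity) (by positivity) ?_
  push_cast
  nlinarith

/-- When the majorant is differentiated, the term where the derivative falls on E² is nonnegative
because E increases; the other term is exactly the bound for k. No constant depending on ξ appears.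
-/
theorem abs_flux_le_left (hν : 0 < ν) (hξ : 0 ≤ ξ) {P k : ℝ → ℝ} {c : ℝ} (hc : 0 ≤ c) (i : ℕ)
    (hP : ∀ x ∈ Ioo 0 L, HasDerivAt P (k x) x)
    (hk : ∀ x ∈ Ioo 0 L, |k x| ≤ growth ν ξ x ^ 2 * (c * x ^ (2 * i)))
    (hP0 : Tendsto P (𝓝[>] 0) (𝓝 0)) {x : ℝ} (hx : x ∈ Ioo 0 L) :
    |P x| ≤ growth ν ξ x ^ 2 * (c * (x ^ (2 * i + 1) / (((2 * i : ℕ) : ℝ) + 1))) := by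
  refine abs_le_of_hasDerivAt_left hP (H := fun y => growth ν ξ y ^ 2 *
    (c * (y ^ (2 * i + 1) / (((2 * i : ℕ) : ℝ) + 1))))
    (fun y hy => ((hasDerivAt_growth hy.1).fun_pow 2).mul
      ((hasDerivAt_pow_div (2 * i) y).const_mul c))
    (fun y hy => (hk y hy).trans ?_) hP0 (fun y hy => ?_) hx
  · have h2 := growthRate_nonneg hν hξ hy.1
    have h3 := growth_pos (ν := ν) (ξ := ξ) hy.1
    have h4 := hy.1
    refine le_add_of_nonneg_left ?_
    positivity
  · have h4 := hy.1
    positivity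

/-- Bounds for the solution of `(E² G')' = k` with vanishing Cauchy data at `0`. -/
theorem abs_le_of_flux_left (hν : 0 < ν) (hξ : 0 ≤ ξ) {G P k : ℝ → ℝ} {c : ℝ} (hc : 0 ≤ c) (i : ℕ)
    (hG : ∀ x ∈ Ioo 0 L, HasDerivAt G (P x / growth ν ξ x ^ 2) x)
    (hP : ∀ x ∈ Ioo 0 L, HasDerivAt P (k x) x)
    (hk : ∀ x ∈ Ioo 0 L, |k x| ≤ growth ν ξ x ^ 2 * (c * x ^ (2 * i)))
    (hG0 : Tendsto G (𝓝[>] 0) (𝓝 0)) (hP0 : Tendsto P (𝓝[>] 0) (𝓝 0)) {x : ℝ}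
    (hx : x ∈ Ioo 0 L) :
    |P x| ≤ growth ν ξ x ^ 2 * (c * x ^ (2 * i + 1)) ∧
      |G x| ≤ c * x ^ (2 * (i + 1)) / ((i : ℝ) + 1) ^ 2 := by
  have h1 : ∀ x ∈ Ioo 0 L, |P x| ≤ growth ν ξ x ^ 2 *
      (c * (x ^ (2 * i + 1) / (((2 * i : ℕ) : ℝ) + 1))) := fun x hx =>
    abs_flux_le_left hν hξ hc i hP hk hP0 hx
  refine ⟨(h1 x hx).trans ?_, ?_⟩
  · have h4 := hx.1
    refine mul_le_mul_of_nonneg_left (mul_le_mul_of_nonneg_left ?_ hc) (sq_nonneg _)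
    exact div_le_self (by positivity) (by push_cast; linarith [Nat.cast_nonneg (α := ℝ) i])
  · have h5 : |G x| ≤ c / (((2 * i : ℕ) : ℝ) + 1) *
        (x ^ (2 * i + 1 + 1) / (((2 * i + 1 : ℕ) : ℝ) + 1)) := by
      refine abs_le_of_hasDerivAt_left hG
        (fun y _ => (hasDerivAt_pow_div (2 * i + 1) y).const_mul (c / (((2 * i : ℕ) : ℝ) + 1)))
        (fun y hy => ?_) hG0 (fun y hy => ?_) hx
      · have hE : 0 < growth ν ξ y ^ 2 := pow_pos (growth_pos hy.1) 2
        rw [abs_div, abs_of_pos hE, div_le_iff₀ hE]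
        refine (h1 y hy).trans (le_of_eq ?_)
        ring
      · have h4 := hy.1
        positivity
    exact h5.trans (div_mul_div_le hc (pow_nonneg hx.1.le _) i)

/-- Bounds for the solution of `(E² G')' = k` with vanishing Cauchy data at `L`. -/
theorem abs_le_of_flux_right (hν : 0 < ν) (hξ : 0 ≤ ξ) {G P k : ℝ → ℝ} {c : ℝ} (hc : 0 ≤ c)
    (i : ℕ) (hG : ∀ x ∈ Ioo 0 L, HasDerivAt G (P x / growth ν ξ x ^ 2) x)
    (hP : ∀ x ∈ Ioo 0 L, HasDerivAt P (k x) x)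
    (hk : ∀ x ∈ Ioo 0 L, |k x| ≤ c * (L - x) ^ (2 * i))
    (hG0 : Tendsto G (𝓝[<] L) (𝓝 0)) (hP0 : Tendsto P (𝓝[<] L) (𝓝 0)) {x : ℝ}
    (hx : x ∈ Ioo 0 L) :
    |P x| ≤ c * (L - x) ^ (2 * i + 1) ∧
      growth ν ξ x ^ 2 * |G x| ≤ c * (L - x) ^ (2 * (i + 1)) / ((i : ℝ) + 1) ^ 2 := by
  have hpow : ∀ (j : ℕ) (x : ℝ), HasDerivAt (fun y : ℝ => (L - y) ^ (j + 1) / ((j : ℝ) + 1))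
      (-(L - x) ^ j) x := fun j x => by
    refine ((hasDerivAt_pow_div j (L - x)).comp x ((hasDerivAt_id x).const_sub L)).congr_deriv ?_
    ring
  have h1 : ∀ x ∈ Ioo 0 L, |P x| ≤ c * ((L - x) ^ (2 * i + 1) / (((2 * i : ℕ) : ℝ) + 1)) := by
    intro x hx
    refine abs_le_of_hasDerivAt_right hP (fun y _ => (hpow (2 * i) y).const_mul c)
      (fun y hy => (hk y hy).trans (le_of_eq (by ring))) hP0 (fun y hy => ?_) hx
    have h4 := sub_pos.2 hy.2
    positivity
  refine ⟨(h1 x hx).trans ?_, ?_⟩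
  · have h4 := sub_pos.2 hx.2
    refine mul_le_mul_of_nonneg_left ?_ hc
    exact div_le_self (by positivity) (by push_cast; linarith [Nat.cast_nonneg (α := ℝ) i])
  · have h5 : |G x| ≤ c / (((2 * i : ℕ) : ℝ) + 1) *
        ((L - x) ^ (2 * i + 1 + 1) / (((2 * i + 1 : ℕ) : ℝ) + 1)) * (growth ν ξ x ^ 2)⁻¹ := by
      -- The majorant carries the factor E⁻², whose derivative is nonpositive and thus has the
      -- favourable sign when integrating from L.
      refine abs_le_of_hasDerivAt_right hG
        (H := fun y => c / (((2 * i : ℕ) : ℝ) + 1) *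
          ((L - y) ^ (2 * i + 1 + 1) / (((2 * i + 1 : ℕ) : ℝ) + 1)) * (growth ν ξ y ^ 2)⁻¹)
        (fun y hy => ((hpow (2 * i + 1) y).const_mul (c / (((2 * i : ℕ) : ℝ) + 1))).mul
          (((hasDerivAt_growth hy.1).fun_pow 2).fun_inv (pow_pos (growth_pos hy.1) 2).ne'))
        (fun y hy => ?_) hG0 (fun y hy => ?_) hx
      · have hE0 : 0 < growth ν ξ y := growth_pos hy.1
        have hE : 0 < growth ν ξ y ^ 2 := pow_pos hE0 2
        have h4 := sub_pos.2 hy.2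
        have h6 := growthRate_nonneg hν hξ hy.1
        rw [abs_div, abs_of_pos hE, neg_add, div_eq_mul_inv]
        refine le_add_of_le_of_nonneg ?_ ?_
        · rw [← neg_mul]
          refine mul_le_mul_of_nonneg_right ((h1 y hy).trans (le_of_eq ?_)) (by positivity)
          ring
        · rw [← mul_neg, ← neg_div, neg_neg]
          positivity
      · have h4 := sub_pos.2 hy.2
        positivity
    have hE : 0 < growth ν ξ x ^ 2 := pow_pos (growth_pos hx.1) 2
    rw [← div_eq_mul_inv, le_div_iff₀ hE] at h5
    rw [mul_comm]
    exact h5.trans (div_mul_div_le hc (pow_nonneg (sub_pos.2 hx.2).le _) i)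

end Comparison

/-! ### The iterates of the two power series in μ. -/

section Iterates

variable {L ν ξ : ℝ}

theorem growth_le_of_abs_le (hν : 0 < ν) (hξ : 0 ≤ ξ) {x y : ℝ} (h : |x| ≤ |y|) :
    growth ν ξ x ≤ growth ν ξ y := by
  have h1 : ∀ z, growth ν ξ z = growth ν ξ |z| := fun z => by simp [growth]
  rw [h1 x, h1 y]
  exact growth_mono hν hξ (abs_nonneg _) h

/-- The flux `∫₀ˣ E² g`. -/
noncomputable def fluxLeft (ν ξ : ℝ) (g : ℝ → ℝ) (x : ℝ) : ℝ :=
  ∫ r in (0 : ℝ)..x, growth ν ξ r ^ 2 * g r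

theorem hasDerivAt_fluxLeft (hν : 0 < ν) {g : ℝ → ℝ} (hg : Continuous g) (x : ℝ) :
    HasDerivAt (fluxLeft ν ξ g) (growth ν ξ x ^ 2 * g x) x :=
  ((((continuous_growth hν).pow 2).mul hg).integral_hasStrictDerivAt 0 x).hasDerivAt

theorem fluxLeft_zero (g : ℝ → ℝ) : fluxLeft ν ξ g 0 = 0 := by simp [fluxLeft]

theorem continuous_fluxLeft (hν : 0 < ν) {g : ℝ → ℝ} (hg : Continuous g) :
    Continuous (fluxLeft ν ξ g) :=
  continuous_iff_continuousAt.2 fun x => (hasDerivAt_fluxLeft hν hg x).continuousAt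

/-- Only 0 is delicate. There E, extended evenly, increases with |r|, so the flux is at most |y|
sup|g| E(y)² and the quotient tends to 0, which is also the value of 0/0. -/
theorem continuous_fluxLeft_div (hν : 0 < ν) (hξ : 0 ≤ ξ) {g : ℝ → ℝ} (hg : Continuous g) :
    Continuous fun x => fluxLeft ν ξ g x / growth ν ξ x ^ 2 := by
  have hE0 : ∀ x, x ≠ 0 → 0 < growth ν ξ x := fun x hx =>
    mul_pos (Real.rpow_pos_of_pos (abs_pos.2 hx) _) (Real.exp_pos _)
  rw [continuous_iff_continuousAt]
  intro x
  by_cases hx : x = 0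
  · subst hx
    obtain ⟨C, hC⟩ := (isCompact_Icc (a := (-1 : ℝ)) (b := 1)).exists_bound_of_continuousOn
      hg.continuousOn
    rw [ContinuousAt, fluxLeft_zero, zero_div]
    refine squeeze_zero_norm' (a := fun x => C * |x|) ?_ ?_
    · filter_upwards [Icc_mem_nhds (show (-1 : ℝ) < 0 by norm_num) one_pos] with y hy
      by_cases hy0 : y = 0
      · subst hy0; simp [fluxLeft_zero]
      have hE := pow_pos (hE0 y hy0) 2
      rw [norm_div, Real.norm_eq_abs (growth ν ξ y ^ 2), abs_of_pos hE, div_le_iff₀ hE, fluxLeft]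
      have h1 := intervalIntegral.norm_integral_le_of_norm_le_const (a := 0) (b := y)
        (f := fun r => growth ν ξ r ^ 2 * g r) (C := growth ν ξ y ^ 2 * C) fun r hr => ?_
      · rw [sub_zero] at h1
        linarith
      · have hr' : |r| ≤ |y| := by
          rcases le_total 0 y with h | h
          · rw [uIoc_of_le h] at hr
            rw [abs_of_pos hr.1, abs_of_nonneg h]; exact hr.2
          · rw [uIoc_of_ge h] at hr
            rw [abs_of_nonpos hr.2, abs_of_nonpos h]; linarith [hr.1]
        rw [norm_mul, Real.norm_eq_abs, abs_of_nonneg (sq_nonneg _)]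
        refine mul_le_mul (pow_le_pow_left₀ (growth_nonneg _) (growth_le_of_abs_le hν hξ hr') 2)
          (hC r (abs_le.1 (hr'.trans (abs_le.2 hy)))) (norm_nonneg _) (sq_nonneg _)
    · have : Continuous fun x : ℝ => C * |x| := by fun_prop
      simpa using this.tendsto 0
  · exact ((continuous_fluxLeft hν hg).continuousAt).div
      ((continuous_growth hν).pow 2).continuousAt (pow_pos (hE0 x hx) 2).ne'

/-- The iterates `ψ_i` with `ψ_0 = 1` and `(E² ψ_{i+1}')' = E² ψ_i` vanishing at `0`, where
`E = growth ν ξ`. -/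
noncomputable def leftIterate (ν ξ : ℝ) : ℕ → ℝ → ℝ
  | 0 => fun _ => 1
  | i + 1 => fun x => ∫ s in (0 : ℝ)..x, fluxLeft ν ξ (leftIterate ν ξ i) s / growth ν ξ s ^ 2

/-- The fluxes `E² ψ_i'` of the iterates `ψ_i`. -/
noncomputable def leftIterateFlux (ν ξ : ℝ) : ℕ → ℝ → ℝ
  | 0 => fun _ => 0
  | i + 1 => fluxLeft ν ξ (leftIterate ν ξ i)

theorem continuous_leftIterate (hν : 0 < ν) (hξ : 0 ≤ ξ) (i : ℕ) :
    Continuous (leftIterate ν ξ i) := by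
  induction i with
  | zero => exact continuous_const
  | succ i ih =>
    exact intervalIntegral.continuous_primitive
      (fun a b => (continuous_fluxLeft_div hν hξ ih).intervalIntegrable a b) 0

theorem hasDerivAt_leftIterate (hν : 0 < ν) (hξ : 0 ≤ ξ) (i : ℕ) (x : ℝ) :
    HasDerivAt (leftIterate ν ξ i) (leftIterateFlux ν ξ i x / growth ν ξ x ^ 2) x := by
  cases i with
  | zero => simpa [leftIterate, leftIterateFlux] using hasDerivAt_const x (1 : ℝ)
  | succ i =>
    exact ((continuous_fluxLeft_div hν hξ
      (continuous_leftIterate hν hξ i)).integral_hasStrictDerivAt 0 x).hasDerivAt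

theorem hasDerivAt_leftIterateFlux (hν : 0 < ν) (hξ : 0 ≤ ξ) (i : ℕ) (x : ℝ) :
    HasDerivAt (leftIterateFlux ν ξ (i + 1)) (growth ν ξ x ^ 2 * leftIterate ν ξ i x) x :=
  hasDerivAt_fluxLeft hν (continuous_leftIterate hν hξ i) x

theorem continuous_leftIterateFlux (hν : 0 < ν) (hξ : 0 ≤ ξ) (i : ℕ) :
    Continuous (leftIterateFlux ν ξ i) := by
  cases i with
  | zero => exact continuous_const
  | succ i => exact continuous_fluxLeft hν (continuous_leftIterate hν hξ i)

theorem leftIterate_succ_zero (i : ℕ) : leftIterate ν ξ (i + 1) 0 = 0 := by simp [leftIterate]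

theorem leftIterateFlux_zero (i : ℕ) : leftIterateFlux ν ξ i 0 = 0 := by
  cases i with
  | zero => rfl
  | succ i => exact fluxLeft_zero _

theorem Continuous.tendsto_nhdsGT {f : ℝ → ℝ} (hf : Continuous f) {a b : ℝ} (h : f a = b) :
    Tendsto f (𝓝[>] a) (𝓝 b) := h ▸ (hf.tendsto a).mono_left nhdsWithin_le_nhds

/-- Induction on i with `abs_le_of_flux_left` and c = 1/(i!)²: each step gains x²/(i+1)². -/
theorem abs_leftIterate_le (hν : 0 < ν) (hξ : 0 ≤ ξ) (i : ℕ) {x : ℝ} (hx : x ∈ Ioo 0 L) :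
    |leftIterate ν ξ i x| ≤ x ^ (2 * i) / (i.factorial : ℝ) ^ 2 ∧
      |leftIterateFlux ν ξ (i + 1) x| ≤
        growth ν ξ x ^ 2 * (x ^ (2 * i + 1) / (i.factorial : ℝ) ^ 2) := by
  have step : ∀ i, (∀ x ∈ Ioo 0 L, |leftIterate ν ξ i x| ≤ x ^ (2 * i) / (i.factorial : ℝ) ^ 2) →
      ∀ x ∈ Ioo 0 L, |leftIterateFlux ν ξ (i + 1) x| ≤
        growth ν ξ x ^ 2 * (x ^ (2 * i + 1) / (i.factorial : ℝ) ^ 2) ∧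
        |leftIterate ν ξ (i + 1) x| ≤ x ^ (2 * (i + 1)) / ((i + 1).factorial : ℝ) ^ 2 := by
    intro i ih x hx
    have h1 := abs_le_of_flux_left (L := L) hν hξ (G := leftIterate ν ξ (i + 1))
      (P := leftIterateFlux ν ξ (i + 1)) (k := fun x => growth ν ξ x ^ 2 * leftIterate ν ξ i x)
      (c := 1 / (i.factorial : ℝ) ^ 2) (by positivity) i
      (fun x _ => hasDerivAt_leftIterate hν hξ (i + 1) x)
      (fun x _ => hasDerivAt_leftIterateFlux hν hξ i x) (fun x hx => by
        rw [abs_mul, abs_of_nonneg (sq_nonneg _)]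
        refine mul_le_mul_of_nonneg_left ((ih x hx).trans (le_of_eq (by ring))) (sq_nonneg _))
      ((continuous_leftIterate hν hξ _).tendsto_nhdsGT (leftIterate_succ_zero i))
      ((continuous_leftIterateFlux hν hξ _).tendsto_nhdsGT (leftIterateFlux_zero _)) hx
    refine ⟨h1.1.trans (le_of_eq (by ring)), h1.2.trans (le_of_eq ?_)⟩
    rw [Nat.factorial_succ]
    push_cast
    field_simp
  have main : ∀ i, ∀ x ∈ Ioo 0 L, |leftIterate ν ξ i x| ≤ x ^ (2 * i) / (i.factorial : ℝ) ^ 2 := by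
    intro i
    induction i with
    | zero => intro x _; simp [leftIterate]
    | succ i ih => exact fun x hx => (step i ih x hx).2
  exact ⟨main i x hx, (step i (main i) x hx).1⟩

theorem continuousOn_integral_left {g : ℝ → ℝ} (hg : ContinuousOn g (Ioc 0 L)) :
    ContinuousOn (fun y => ∫ s in y..L, g s) (Ioc 0 L) := by
  intro x hx
  rcases hx.2.lt_or_eq with h | rfl
  · exact (hasDerivAt_integral_left hg ⟨hx.1, h⟩).continuousAt.continuousWithinAt
  · have h1 : ContinuousWithinAt (fun y => ∫ s in y..x, g s) (Iio x) x := by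
      rw [ContinuousWithinAt, intervalIntegral.integral_same]
      exact tendsto_integral_left hx.1 hg
    exact (continuousWithinAt_Iio_iff_Iic.1 h1).mono fun y hy => hy.2

/-- The fluxes `E² ρ_i'` of the iterates `ρ_i` with `(E² ρ_0')' = 0`, `(E² ρ_{i+1}')' = E² ρ_i`
vanishing at `L`, where `E = growth ν ξ`. -/
noncomputable def rightIterateFlux (L ν ξ : ℝ) : ℕ → ℝ → ℝ
  | 0 => fun _ => -1
  | i + 1 => fun x => ∫ s in x..L, growth ν ξ s ^ 2 *
      ∫ r in s..L, rightIterateFlux L ν ξ i r / growth ν ξ r ^ 2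

/-- The iterates `ρ_i` with `(E² ρ_0')' = 0`, `(E² ρ_{i+1}')' = E² ρ_i` vanishing at `L`, where
`E = growth ν ξ`. -/
noncomputable def rightIterate (L ν ξ : ℝ) (i : ℕ) (x : ℝ) : ℝ :=
  -∫ r in x..L, rightIterateFlux L ν ξ i r / growth ν ξ r ^ 2

theorem continuousOn_div_growth (hν : 0 < ν) {f : ℝ → ℝ} (hf : ContinuousOn f (Ioc 0 L)) :
    ContinuousOn (fun x => f x / growth ν ξ x ^ 2) (Ioc 0 L) :=
  hf.div ((continuous_growth hν).pow 2).continuousOn fun _ hx => (pow_pos (growth_pos hx.1) 2).ne'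

theorem continuousOn_rightIterateFlux (hν : 0 < ν) (i : ℕ) :
    ContinuousOn (rightIterateFlux L ν ξ i) (Ioc 0 L) := by
  induction i with
  | zero => exact continuousOn_const
  | succ i ih =>
    exact continuousOn_integral_left (((continuous_growth hν).pow 2).continuousOn.mul
      (continuousOn_integral_left (continuousOn_div_growth hν ih)))

theorem hasDerivAt_rightIterate (hν : 0 < ν) (i : ℕ) {x : ℝ} (hx : x ∈ Ioo 0 L) :
    HasDerivAt (rightIterate L ν ξ i) (rightIterateFlux L ν ξ i x / growth ν ξ x ^ 2) x :=
  (hasDerivAt_integral_left (continuousOn_div_growth hν (continuousOn_rightIterateFlux hν i))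
    hx).fun_neg.congr_deriv (neg_neg _)

theorem hasDerivAt_rightIterateFlux (hν : 0 < ν) (i : ℕ) {x : ℝ} (hx : x ∈ Ioo 0 L) :
    HasDerivAt (rightIterateFlux L ν ξ (i + 1)) (growth ν ξ x ^ 2 * rightIterate L ν ξ i x) x :=
  (hasDerivAt_integral_left (((continuous_growth hν).pow 2).continuousOn.mul
    (continuousOn_integral_left (continuousOn_div_growth hν
      (continuousOn_rightIterateFlux hν i)))) hx).congr_deriv
      (by simp only [Pi.mul_apply, Pi.pow_apply, rightIterate]; ring)

theorem tendsto_rightIterate (hL : 0 < L) (hν : 0 < ν) (i : ℕ) :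
    Tendsto (rightIterate L ν ξ i) (𝓝[<] L) (𝓝 0) := by
  have h := (tendsto_integral_left hL (continuousOn_div_growth (ξ := ξ) hν
    (continuousOn_rightIterateFlux (ξ := ξ) hν i))).neg
  rwa [neg_zero] at h

theorem tendsto_rightIterateFlux (hL : 0 < L) (hν : 0 < ν) (i : ℕ) :
    Tendsto (rightIterateFlux L ν ξ (i + 1)) (𝓝[<] L) (𝓝 0) :=
  tendsto_integral_left hL (((continuous_growth hν).pow 2).continuousOn.mul
    (continuousOn_integral_left (continuousOn_div_growth hν
      (continuousOn_rightIterateFlux hν i))))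

/-- The same induction from L, for the weighted quantity E²|ρ_i|. It starts from ρ_0 = ∫ₓᴸ E⁻² ≤ (L
- x) E(x)⁻²; the iterates themselves may blow up at 0. -/
theorem abs_rightIterate_le (hL : 0 < L) (hν : 0 < ν) (hξ : 0 ≤ ξ) (i : ℕ) {x : ℝ}
    (hx : x ∈ Ioo 0 L) :
    growth ν ξ x ^ 2 * |rightIterate L ν ξ i x| ≤
        L * (L - x) ^ (2 * i) / (i.factorial : ℝ) ^ 2 ∧
      |rightIterateFlux L ν ξ (i + 1) x| ≤ L * (L - x) ^ (2 * i + 1) / (i.factorial : ℝ) ^ 2 := by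
  have step : ∀ i, (∀ x ∈ Ioo 0 L, growth ν ξ x ^ 2 * |rightIterate L ν ξ i x| ≤
        L * (L - x) ^ (2 * i) / (i.factorial : ℝ) ^ 2) →
      ∀ x ∈ Ioo 0 L, |rightIterateFlux L ν ξ (i + 1) x| ≤
        L * (L - x) ^ (2 * i + 1) / (i.factorial : ℝ) ^ 2 ∧
        growth ν ξ x ^ 2 * |rightIterate L ν ξ (i + 1) x| ≤
          L * (L - x) ^ (2 * (i + 1)) / ((i + 1).factorial : ℝ) ^ 2 := by
    intro i ih x hx
    have h1 := abs_le_of_flux_right (L := L) hν hξ (G := rightIterate L ν ξ (i + 1))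
      (P := rightIterateFlux L ν ξ (i + 1))
      (k := fun x => growth ν ξ x ^ 2 * rightIterate L ν ξ i x)
      (c := L / (i.factorial : ℝ) ^ 2) (by positivity) i
      (fun x hx => hasDerivAt_rightIterate hν (i + 1) hx)
      (fun x hx => hasDerivAt_rightIterateFlux hν i hx) (fun x hx => by
        rw [abs_mul, abs_of_nonneg (sq_nonneg _)]
        exact (ih x hx).trans (le_of_eq (by ring)))
      (tendsto_rightIterate hL hν _) (tendsto_rightIterateFlux hL hν _) hx
    refine ⟨h1.1.trans (le_of_eq (by ring)), h1.2.trans (le_of_eq ?_)⟩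
    rw [Nat.factorial_succ]
    push_cast
    field_simp
  have main : ∀ i, ∀ x ∈ Ioo 0 L, growth ν ξ x ^ 2 * |rightIterate L ν ξ i x| ≤
      L * (L - x) ^ (2 * i) / (i.factorial : ℝ) ^ 2 := by
    intro i
    induction i with
    | zero =>
      intro x hx
      have hE : 0 < growth ν ξ x ^ 2 := pow_pos (growth_pos hx.1) 2
      rw [rightIterate, ← setIntegral_Ioo_eq_intervalIntegral hx.2.le, abs_neg]
      have h1 := norm_setIntegral_Ioo_le
        (f := fun r => rightIterateFlux L ν ξ 0 r / growth ν ξ r ^ 2)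
        (C := 1 / growth ν ξ x ^ 2) hx.2.le fun y hy => by
          rw [rightIterateFlux, abs_div, abs_neg, abs_one, abs_of_nonneg (sq_nonneg _)]
          exact div_le_div_of_nonneg_left zero_le_one hE
            (pow_le_pow_left₀ (growth_nonneg _) (growth_mono hν hξ hx.1.le hy.1.le) 2)
      calc _ ≤ growth ν ξ x ^ 2 * (1 / growth ν ξ x ^ 2 * (L - x)) :=
            mul_le_mul_of_nonneg_left h1 hE.le
        _ = L - x := by rw [← mul_assoc, mul_one_div_cancel hE.ne', one_mul]
        _ ≤ _ := by simp [hx.1.le]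
    | succ i ih => exact fun x hx => (step i ih x hx).2
  exact ⟨main i x hx, (step i (main i) x hx).1⟩

end Iterates

/-! ### Expansion of an eigenfunction from either end. -/

namespace IsProfile

variable {L ν ξ μ : ℝ} {ψ p : ℝ → ℝ}

theorem continuousOn_fst (h : IsProfile L ν ξ μ ψ p) : ContinuousOn ψ (Ioo 0 L) := fun x hx =>
  (h.hasDerivAt_fst x hx).continuousAt.continuousWithinAt

theorem abs_snd_le (h : IsProfile L ν ξ μ ψ p) (hν : 0 < ν) (hξ : 0 ≤ ξ) (hμ : 0 ≤ μ) {C : ℝ}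
    (hC0 : 0 ≤ C) {l : ℝ} (hl : l ≤ L) (hC : ∀ x ∈ Ioo 0 l, |ψ x| ≤ C) {x : ℝ} (hx : x ∈ Ioo 0 l) :
    |p x| ≤ growth ν ξ x ^ 2 * (μ * C * x) := by
  have hsub : Ioo 0 l ⊆ Ioo 0 L := Ioo_subset_Ioo_right hl
  have h1 := abs_flux_le_left (L := l) hν hξ (c := μ * C) (by positivity) 0
    (fun y hy => h.hasDerivAt_snd y (hsub hy)) (fun y hy => ?_) h.tendsto_snd_zero hx
  · simpa using h1
  · rw [abs_mul, abs_neg, abs_of_nonneg hμ, abs_mul, abs_of_nonneg (sq_nonneg _)]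
    have := mul_le_mul_of_nonneg_left (hC y hy) (mul_nonneg hμ (sq_nonneg (growth ν ξ y)))
    simpa using by linarith

/-- The derivative p/E² of ψ is bounded by μCx, so ψ plus a linear function is monotone and bounded
below near 0. -/
theorem exists_tendsto_fst_zero (h : IsProfile L ν ξ μ ψ p) (hL : 0 < L) (hν : 0 < ν)
    (hξ : 0 ≤ ξ) (hμ : 0 ≤ μ) : ∃ n, Tendsto ψ (𝓝[>] 0) (𝓝 n) := by
  obtain ⟨C, hC⟩ := h.exists_abs_le
  have hC0 : 0 ≤ C := (abs_nonneg _).trans (hC (L / 2) ⟨by linarith, by linarith⟩)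
  have hmono : MonotoneOn (fun x => ψ x + μ * C * L * x) (Ioo 0 L) := by
    refine monotoneOn_Ioo_of_hasDerivAt
      (fun x hx => (h.hasDerivAt_fst x hx).add ((hasDerivAt_id x).const_mul (μ * C * L)))
      fun x hx => ?_
    have hE : 0 < growth ν ξ x ^ 2 := pow_pos (growth_pos hx.1) 2
    have h1 := h.abs_snd_le hν hξ hμ hC0 le_rfl hC hx
    have h2 : |p x / growth ν ξ x ^ 2| ≤ μ * C * x := by
      rw [abs_div, abs_of_pos hE, div_le_iff₀ hE]; linarith
    have h3 : μ * C * x ≤ μ * C * L := mul_le_mul_of_nonneg_left hx.2.le (by positivity)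
    linarith [neg_abs_le (p x / growth ν ξ x ^ 2)]
  have hlim := hmono.tendsto_nhdsWithin_Ioo_right ⟨L / 2, by constructor <;> linarith⟩
    ⟨-C, by
      rintro _ ⟨x, hx, rfl⟩
      have := hx.1
      have h4 : 0 ≤ μ * C * L * x := by positivity
      simp only
      linarith [neg_abs_le (ψ x), hC x hx]⟩
  have h5 : Tendsto (fun x : ℝ => μ * C * L * x) (𝓝[>] 0) (𝓝 0) :=
    Continuous.tendsto_nhdsGT (by fun_prop) (by simp)
  refine ⟨_, (hlim.sub h5).congr fun x => ?_⟩
  ring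

/-- The remainder after N + 1 terms satisfies (E²R')' = -μE² times the previous remainder, with zero
data at 0, so one comparison gains μx²/(N+1)². The interval (0, l) is kept free so that C may be a
supremum of |ψ| near 0 only. -/
theorem abs_sub_sum_left_le (h : IsProfile L ν ξ μ ψ p) (hν : 0 < ν) (hξ : 0 ≤ ξ) (hμ : 0 ≤ μ)
    {n C : ℝ} (hn : Tendsto ψ (𝓝[>] 0) (𝓝 n)) {l : ℝ} (hl : l ≤ L)
    (hC : ∀ x ∈ Ioo 0 l, |ψ x| ≤ C) (N : ℕ) :
    ∀ x ∈ Ioo 0 l, |ψ x - n * ∑ i ∈ Finset.range N, (-μ) ^ i * leftIterate ν ξ i x| ≤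
      C * μ ^ N * x ^ (2 * N) / (N.factorial : ℝ) ^ 2 := by
  have hsub : Ioo 0 l ⊆ Ioo 0 L := Ioo_subset_Ioo_right hl
  induction N with
  | zero => intro x hx; simpa using hC x hx
  | succ N ih =>
    intro x hx
    have hC0 : 0 ≤ C := (abs_nonneg _).trans (hC x hx)
    have key := abs_le_of_flux_left (L := l) hν hξ
      (G := fun x => ψ x - n * ∑ i ∈ Finset.range (N + 1), (-μ) ^ i * leftIterate ν ξ i x)
      (P := fun x => p x - n * ∑ i ∈ Finset.range (N + 1), (-μ) ^ i * leftIterateFlux ν ξ i x)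
      (k := fun x => -μ * (growth ν ξ x ^ 2 *
        (ψ x - n * ∑ i ∈ Finset.range N, (-μ) ^ i * leftIterate ν ξ i x)))
      (c := μ * (C * μ ^ N / (N.factorial : ℝ) ^ 2)) (by positivity) N
      (fun y hy => ?_) (fun y hy => ?_) (fun y hy => ?_) ?_ ?_ hx
    · refine key.2.trans (le_of_eq ?_)
      rw [Nat.factorial_succ]
      push_cast
      field_simp
      ring
    · refine ((h.hasDerivAt_fst y (hsub hy)).sub ((HasDerivAt.fun_sum fun i _ =>
        (hasDerivAt_leftIterate hν hξ i y).const_mul ((-μ) ^ i)).const_mul n)).congr_deriv ?_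
      rw [sub_div, mul_div_assoc, Finset.sum_div]
      simp only [mul_div_assoc]
    · have h1 : (fun x => p x - n * ∑ i ∈ Finset.range (N + 1), (-μ) ^ i * leftIterateFlux ν ξ i x) =
          fun x => p x - n * ∑ i ∈ Finset.range N, (-μ) ^ (i + 1) *
            leftIterateFlux ν ξ (i + 1) x := by
        funext z
        rw [Finset.sum_range_succ']
        simp [leftIterateFlux]
      rw [h1]
      refine ((h.hasDerivAt_snd y (hsub hy)).sub ((HasDerivAt.fun_sum fun i _ =>
        (hasDerivAt_leftIterateFlux hν hξ i y).const_mul ((-μ) ^ (i + 1))).const_mul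
          n)).congr_deriv ?_
      have h2 : ∑ i ∈ Finset.range N, (-μ) ^ (i + 1) * (growth ν ξ y ^ 2 * leftIterate ν ξ i y) =
          -μ * growth ν ξ y ^ 2 * ∑ i ∈ Finset.range N, (-μ) ^ i * leftIterate ν ξ i y := by
        rw [Finset.mul_sum]
        exact Finset.sum_congr rfl fun i _ => by ring
      rw [h2]
      ring
    · rw [abs_mul, abs_neg, abs_of_nonneg hμ, abs_mul, abs_of_nonneg (sq_nonneg _)]
      have := mul_le_mul_of_nonneg_left (ih y hy) (mul_nonneg hμ (sq_nonneg (growth ν ξ y)))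
      calc _ = μ * growth ν ξ y ^ 2 *
            |ψ y - n * ∑ i ∈ Finset.range N, (-μ) ^ i * leftIterate ν ξ i y| := by ring
        _ ≤ _ := this
        _ = _ := by ring
    · have h1 : Tendsto (fun x => ∑ i ∈ Finset.range (N + 1), (-μ) ^ i * leftIterate ν ξ i x)
          (𝓝[>] 0) (𝓝 1) := by
        refine Continuous.tendsto_nhdsGT (continuous_finsetSum _ fun i _ =>
          continuous_const.mul (continuous_leftIterate hν hξ i)) ?_
        rw [Finset.sum_range_succ']
        simp [leftIterate]
      simpa using hn.sub (h1.const_mul n)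
    · have h1 : Tendsto (fun x => ∑ i ∈ Finset.range (N + 1), (-μ) ^ i * leftIterateFlux ν ξ i x)
          (𝓝[>] 0) (𝓝 0) := by
        refine Continuous.tendsto_nhdsGT (continuous_finsetSum _ fun i _ =>
          continuous_const.mul (continuous_leftIterateFlux hν hξ i)) ?_
        simp [leftIterateFlux_zero]
      simpa using h.tendsto_snd_zero.sub (h1.const_mul n)

/-- As ψ vanishes at L, the expansion is normalised by the limit -n of p = E²ψ' there. Since ρ_0 has
flux -1, the flux of the remainder starts with p + n, which tends to 0 at L, and the induction runs
as from the left. -/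
theorem abs_sub_sum_right_le (h : IsProfile L ν ξ μ ψ p) (hL : 0 < L) (hν : 0 < ν) (hξ : 0 ≤ ξ)
    (hμ : 0 ≤ μ) {C : ℝ} (hC : ∀ x ∈ Ioo 0 L, growth ν ξ x ^ 2 * |ψ x| ≤ C) (N : ℕ) :
    ∀ x ∈ Ioo 0 L, growth ν ξ x ^ 2 *
      |ψ x - (μ * ∫ x in Ioo 0 L, growth ν ξ x ^ 2 * ψ x) *
        ∑ i ∈ Finset.range N, (-μ) ^ i * rightIterate L ν ξ i x| ≤
      C * μ ^ N * (L - x) ^ (2 * N) / (N.factorial : ℝ) ^ 2 := by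
  set n := μ * ∫ x in Ioo 0 L, growth ν ξ x ^ 2 * ψ x with hn
  induction N with
  | zero => intro x hx; simpa using hC x hx
  | succ N ih =>
    intro x hx
    have hC0 : 0 ≤ C := le_trans (by positivity) (hC x hx)
    have h1 : (fun x => p x - n * ∑ i ∈ Finset.range (N + 1),
          (-μ) ^ i * rightIterateFlux L ν ξ i x) =
        fun x => (p x + n) - n * ∑ i ∈ Finset.range N, (-μ) ^ (i + 1) *
          rightIterateFlux L ν ξ (i + 1) x := by
      funext z
      rw [Finset.sum_range_succ']
      simp [rightIterateFlux]
      ring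
    have key := abs_le_of_flux_right (L := L) hν hξ
      (G := fun x => ψ x - n * ∑ i ∈ Finset.range (N + 1), (-μ) ^ i * rightIterate L ν ξ i x)
      (P := fun x => p x - n * ∑ i ∈ Finset.range (N + 1), (-μ) ^ i * rightIterateFlux L ν ξ i x)
      (k := fun x => -μ * (growth ν ξ x ^ 2 *
        (ψ x - n * ∑ i ∈ Finset.range N, (-μ) ^ i * rightIterate L ν ξ i x)))
      (c := μ * (C * μ ^ N / (N.factorial : ℝ) ^ 2)) (by positivity) N
      (fun y hy => ?_) (fun y hy => ?_) (fun y hy => ?_) ?_ ?_ hx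
    · refine key.2.trans (le_of_eq ?_)
      rw [Nat.factorial_succ]
      push_cast
      field_simp
      ring
    · refine ((h.hasDerivAt_fst y hy).sub ((HasDerivAt.fun_sum fun i _ =>
        (hasDerivAt_rightIterate hν i hy).const_mul ((-μ) ^ i)).const_mul n)).congr_deriv ?_
      rw [sub_div, mul_div_assoc, Finset.sum_div]
      simp only [mul_div_assoc]
    · rw [h1]
      refine (((h.hasDerivAt_snd y hy).add_const n).sub ((HasDerivAt.fun_sum fun i _ =>
        (hasDerivAt_rightIterateFlux hν i hy).const_mul ((-μ) ^ (i + 1))).const_mul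
          n)).congr_deriv ?_
      have h2 : ∑ i ∈ Finset.range N, (-μ) ^ (i + 1) *
            (growth ν ξ y ^ 2 * rightIterate L ν ξ i y) =
          -μ * growth ν ξ y ^ 2 * ∑ i ∈ Finset.range N, (-μ) ^ i * rightIterate L ν ξ i y := by
        rw [Finset.mul_sum]
        exact Finset.sum_congr rfl fun i _ => by ring
      rw [h2]
      ring
    · rw [abs_mul, abs_neg, abs_of_nonneg hμ, abs_mul, abs_of_nonneg (sq_nonneg _)]
      exact (mul_le_mul_of_nonneg_left (ih y hy) hμ).trans (le_of_eq (by ring))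
    · have h2 : Tendsto (fun x => ∑ i ∈ Finset.range (N + 1), (-μ) ^ i * rightIterate L ν ξ i x)
          (𝓝[<] L) (𝓝 (∑ i ∈ Finset.range (N + 1), (-μ) ^ i * 0)) :=
        tendsto_finsetSum _ fun i _ => (tendsto_rightIterate hL hν i).const_mul _
      simpa using h.tendsto_fst_right.sub (h2.const_mul n)
    · rw [h1]
      have h2 : Tendsto (fun x => ∑ i ∈ Finset.range N, (-μ) ^ (i + 1) *
            rightIterateFlux L ν ξ (i + 1) x)
          (𝓝[<] L) (𝓝 (∑ i ∈ Finset.range N, (-μ) ^ (i + 1) * 0)) :=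
        tendsto_finsetSum _ fun i _ => (tendsto_rightIterateFlux hL hν i).const_mul _
      simpa [hn] using (h.tendsto_snd_right.add_const n).sub (h2.const_mul n)

end IsProfile

/-- A function which vanishes at both ends of an interval and whose derivative is at least `J`
forces `J` to have nonpositive integral. -/
theorem integral_nonpos_of_hasDerivAt {a b : ℝ} (hab : a < b) {F F' J : ℝ → ℝ}
    (hF : ∀ x ∈ Ioo a b, HasDerivAt F (F' x) x) (hJ : ∀ x ∈ Ioo a b, J x ≤ F' x)
    (ha : Tendsto F (𝓝[>] a) (𝓝 0)) (hb : Tendsto F (𝓝[<] b) (𝓝 0))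
    (hint : Integrable J (volume.restrict (Ioo a b))) : ∫ x in Ioo a b, J x ≤ 0 := by
  have hFc : ContinuousOn F (Ioo a b) := fun x hx => (hF x hx).continuousAt.continuousWithinAt
  have hext : ∀ x ∈ Ioo a b, extendFrom (Ioo a b) F x = F x := fun x hx =>
    extendFrom_extends hFc x hx
  have h1 := intervalIntegral.integral_le_sub_of_hasDeriv_right_of_le hab.le
    (continuousOn_Icc_extendFrom_Ioo hFc ha hb) (g' := F') (φ := J) (fun x hx => by
      refine HasDerivAt.hasDerivWithinAt ((hF x hx).congr_of_eventuallyEq ?_)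
      filter_upwards [isOpen_Ioo.mem_nhds hx] with y hy using hext y hy)
    (by rw [integrableOn_Icc_iff_integrableOn_Ioo]; exact hint) hJ
  rwa [eq_lim_at_right_extendFrom_Ioo hab hb, eq_lim_at_left_extendFrom_Ioo hab ha, sub_zero,
    ← setIntegral_Ioo_eq_intervalIntegral hab.le] at h1

theorem integrableOn_Ioo_of_abs_le {a b C : ℝ} {f : ℝ → ℝ} (hf : ContinuousOn f (Ioo a b))
    (h : ∀ x ∈ Ioo a b, |f x| ≤ C) : IntegrableOn f (Ioo a b) :=
  Integrable.of_bound (hf.aestronglyMeasurable measurableSet_Ioo) C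
    ((ae_restrict_iff' measurableSet_Ioo).2 (Eventually.of_forall h))

/-! ### Agmon estimates and the two normalising constants. -/

namespace IsProfile

variable {L ν ξ μ : ℝ} {ψ p : ℝ → ℝ}

theorem integrableOn_mul (h : IsProfile L ν ξ μ ψ p) (hν : 0 < ν) {g : ℝ → ℝ}
    (hg : Continuous g) :
    IntegrableOn (fun x => g x * (growth ν ξ x * ψ x) ^ 2) (Ioo 0 L) := by
  obtain ⟨C, hC⟩ := h.exists_abs_le
  have hc : Continuous fun x => |g x| * growth ν ξ x ^ 2 :=
    hg.abs.mul ((continuous_growth hν).pow 2)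
  obtain ⟨D, hD⟩ := (isCompact_Icc (a := (0 : ℝ)) (b := L)).exists_bound_of_continuousOn
    hc.continuousOn
  refine integrableOn_Ioo_of_abs_le (C := D * C ^ 2)
    (hg.continuousOn.mul (((continuous_growth hν).continuousOn.mul h.continuousOn_fst).pow 2))
    fun x hx => ?_
  have h1 := hD x (Ioo_subset_Icc_self hx)
  rw [Real.norm_eq_abs, abs_of_nonneg (by positivity)] at h1
  have h2 : |g x * (growth ν ξ x * ψ x) ^ 2| = |g x| * growth ν ξ x ^ 2 * |ψ x| ^ 2 := by
    rw [abs_mul, abs_of_nonneg (sq_nonneg (growth ν ξ x * ψ x)), mul_pow, sq_abs, mul_assoc]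
  rw [h2]
  exact mul_le_mul h1 (pow_le_pow_left₀ (abs_nonneg _) (hC x hx) 2) (by positivity)
    (le_trans (by positivity) h1)

/-- The Agmon identity, as an inequality. -/
theorem agmon (h : IsProfile L ν ξ μ ψ p) (hL : 0 < L) (hν : 0 < ν) (κ : ℝ) :
    ((1 - κ ^ 2) * ξ ^ 2) *
        ∫ x in Ioo 0 L, (x ^ 2 * Real.exp (κ * ξ * x ^ 2)) * (growth ν ξ x * ψ x) ^ 2 ≤
      (μ - 2 * ξ * (ν + 1)) *
        ∫ x in Ioo 0 L, Real.exp (κ * ξ * x ^ 2) * (growth ν ξ x * ψ x) ^ 2 := by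
  have hi1 := h.integrableOn_mul hν (g := fun x => x ^ 2 * Real.exp (κ * ξ * x ^ 2)) (by fun_prop)
  have hi2 := h.integrableOn_mul hν (g := fun x => Real.exp (κ * ξ * x ^ 2)) (by fun_prop)
  have hexp : ∀ x, HasDerivAt (fun x : ℝ => Real.exp (κ * ξ * x ^ 2))
      (2 * κ * ξ * x * Real.exp (κ * ξ * x ^ 2)) x := fun x => by
    refine ((hasDerivAt_pow 2 x).const_mul (κ * ξ)).exp.congr_deriv ?_
    push_cast; ring
  have hE0 : Tendsto (growth ν ξ) (𝓝[>] 0) (𝓝 0) :=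
    Continuous.tendsto_nhdsGT (continuous_growth hν) (growth_zero hν)
  obtain ⟨C, hC⟩ := h.exists_abs_le
  have hψbd : ∀ᶠ x in 𝓝[>] (0 : ℝ), ‖ψ x‖ ≤ C := by
    filter_upwards [Ioo_mem_nhdsGT hL] with x hx using hC x hx
  have hbdd : IsBoundedUnder (· ≤ ·) (𝓝[>] (0 : ℝ)) (norm ∘ ψ) := ⟨C, by simpa using hψbd⟩
  -- For φ = Eψ this F is e^(κξx²)(φφ' - (ν+1/2)φ²/x), which absorbs the inverse square potential;
  -- F' - J is the exact square e^(κξx²)(φ' - (ν+1/2)φ/x + κξxφ)².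
  have hJ := integral_nonpos_of_hasDerivAt hL
    (F := fun x => Real.exp (κ * ξ * x ^ 2) * (p x * ψ x + ξ * x * (growth ν ξ x * ψ x) ^ 2))
    (J := fun x => ((1 - κ ^ 2) * ξ ^ 2) *
      ((x ^ 2 * Real.exp (κ * ξ * x ^ 2)) * (growth ν ξ x * ψ x) ^ 2) -
      (μ - 2 * ξ * (ν + 1)) * (Real.exp (κ * ξ * x ^ 2) * (growth ν ξ x * ψ x) ^ 2))
    (F' := fun x => 2 * κ * ξ * x * Real.exp (κ * ξ * x ^ 2) *
        (p x * ψ x + ξ * x * (growth ν ξ x * ψ x) ^ 2) +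
      Real.exp (κ * ξ * x ^ 2) * (-μ * (growth ν ξ x ^ 2 * ψ x) * ψ x +
        p x * (p x / growth ν ξ x ^ 2) + (ξ * (growth ν ξ x * ψ x) ^ 2 +
          ξ * x * (2 * (growth ν ξ x * ψ x) * (growthRate ν ξ x * growth ν ξ x * ψ x +
            growth ν ξ x * (p x / growth ν ξ x ^ 2))))))
    (fun x hx => ((hexp x).mul (((h.hasDerivAt_snd x hx).fun_mul (h.hasDerivAt_fst x hx)).fun_add
      (((hasDerivAt_id x).const_mul ξ).fun_mul (((hasDerivAt_growth hx.1).fun_mul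
        (h.hasDerivAt_fst x hx)).fun_pow 2)))).congr_deriv (by
          simp only [id]; push_cast; ring)) (fun x hx => ?_)
    ?_ ?_ ((hi1.const_mul ((1 - κ ^ 2) * ξ ^ 2)).sub (hi2.const_mul (μ - 2 * ξ * (ν + 1))))
  · rw [integral_sub (hi1.const_mul _) (hi2.const_mul _), integral_const_mul,
      integral_const_mul] at hJ
    linarith
  · have hE := growth_pos (ν := ν) (ξ := ξ) hx.1
    obtain ⟨d, hd⟩ : ∃ d, d = p x / growth ν ξ x ^ 2 := ⟨_, rfl⟩
    have hp : p x = d * growth ν ξ x ^ 2 := by rw [hd]; field_simp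
    have hQ : growthRate ν ξ x * x = ν + 1 / 2 + ξ * x ^ 2 := by
      have := hx.1.ne'
      rw [growthRate]; field_simp
    simp only [← hd]
    rw [hp]
    have key : 0 ≤ Real.exp (κ * ξ * x ^ 2) * growth ν ξ x ^ 2 *
      (d + ξ * (1 + κ) * x * ψ x) ^ 2 := by positivity
    rw [← sub_nonneg]
    refine key.trans (le_of_eq ?_)
    linear_combination (-2 * ξ * Real.exp (κ * ξ * x ^ 2) * growth ν ξ x ^ 2 * ψ x ^ 2) * hQ
  · have h1 : Tendsto (fun x : ℝ => Real.exp (κ * ξ * x ^ 2)) (𝓝[>] 0) (𝓝 1) :=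
      Continuous.tendsto_nhdsGT (by fun_prop) (by simp)
    have h2 : Tendsto (fun x => p x * ψ x) (𝓝[>] 0) (𝓝 0) :=
      h.tendsto_snd_zero.zero_mul_isBoundedUnder_le hbdd
    have h3 : Tendsto (fun x => growth ν ξ x * ψ x) (𝓝[>] 0) (𝓝 0) :=
      hE0.zero_mul_isBoundedUnder_le hbdd
    have h4 : Tendsto (fun x : ℝ => ξ * x) (𝓝[>] 0) (𝓝 0) :=
      Continuous.tendsto_nhdsGT (by fun_prop) (by simp)
    simpa using h1.mul (h2.add (h4.mul (h3.pow 2)))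
  · have hid : ∀ f : ℝ → ℝ, Continuous f → Tendsto f (𝓝[<] L) (𝓝 (f L)) := fun f hf =>
      (hf.tendsto L).mono_left nhdsWithin_le_nhds
    have h1 := hid (fun x : ℝ => Real.exp (κ * ξ * x ^ 2)) (by fun_prop)
    have h2 := h.tendsto_snd_right.mul h.tendsto_fst_right
    have h3 := (hid _ (continuous_growth (ξ := ξ) hν)).mul h.tendsto_fst_right
    have h4 := hid (fun x : ℝ => ξ * x) (by fun_prop)
    simpa using h1.mul (h2.add (h4.mul (h3.pow 2)))

/-- The unweighted case κ = 0 of the Agmon inequality: ξ²∫x²φ² ≤ μ - 2ξ(ν+1). -/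
theorem eigenvalue_nonneg (h : IsProfile L ν ξ μ ψ p) (hL : 0 < L) (hν : 0 < ν)
    (h1 : ∫ x in Ioo 0 L, (growth ν ξ x * ψ x) ^ 2 = 1) : 0 ≤ μ - 2 * ξ * (ν + 1) := by
  have h2 := h.agmon hL hν 0
  simp only [zero_mul, Real.exp_zero, one_mul, h1, mul_one] at h2
  refine le_trans (mul_nonneg (by positivity) (integral_nonneg fun x => ?_)) h2
  simp only [Pi.zero_apply]; positivity

/-- Where x² ≤ R the weight is at most e^(ξR). Where x² ≥ R the weighted mass is dominated by the
second moment, which the Agmon inequality makes at most half of the total. -/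
theorem integral_exp_le (h : IsProfile L ν ξ μ ψ p) (hL : 0 < L) (hν : 0 < ν) (hξ : 0 < ξ)
    (h1 : ∫ x in Ioo 0 L, (growth ν ξ x * ψ x) ^ 2 = 1) {κ η : ℝ} (hκ1 : κ ≤ 1)
    (hη : 0 < η) (hηκ : η ≤ 1 - κ ^ 2) :
    ∫ x in Ioo 0 L, Real.exp (κ * ξ * x ^ 2) * (growth ν ξ x * ψ x) ^ 2 ≤
      2 * Real.exp (2 * (μ - 2 * ξ * (ν + 1) + 1) / (η * ξ)) := by
  have hi1 := h.integrableOn_mul hν (g := fun x => x ^ 2 * Real.exp (κ * ξ * x ^ 2)) (by fun_prop)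
  have hi2 := h.integrableOn_mul hν (g := fun x => Real.exp (κ * ξ * x ^ 2)) (by fun_prop)
  have hi3 := h.integrableOn_mul hν (g := fun _ => 1) (by fun_prop)
  simp only [one_mul] at hi3
  have hlam := h.eigenvalue_nonneg hL hν h1
  have hag := h.agmon hL hν κ
  set lam := μ - 2 * ξ * (ν + 1) with hlamdef
  set A := ∫ x in Ioo 0 L, (x ^ 2 * Real.exp (κ * ξ * x ^ 2)) * (growth ν ξ x * ψ x) ^ 2 with hA
  set B := ∫ x in Ioo 0 L, Real.exp (κ * ξ * x ^ 2) * (growth ν ξ x * ψ x) ^ 2 with hB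
  have hA0 : 0 ≤ A := integral_nonneg fun x => by simp only [Pi.zero_apply]; positivity
  have hB0 : 0 ≤ B := integral_nonneg fun x => by simp only [Pi.zero_apply]; positivity
  -- Chosen so that the Agmon inequality becomes A ≤ (R/2) B; the + 1 keeps R positive even for lam
  -- = 0.
  set R := 2 * (lam + 1) / (η * ξ ^ 2) with hR
  have hRpos : 0 < R := by positivity
  have hpt : R * B ≤ R * Real.exp (ξ * R) + A := by
    have h2 : ∫ x in Ioo 0 L, R * (Real.exp (κ * ξ * x ^ 2) * (growth ν ξ x * ψ x) ^ 2) ≤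
        ∫ x in Ioo 0 L, (R * Real.exp (ξ * R) * (growth ν ξ x * ψ x) ^ 2 +
          (x ^ 2 * Real.exp (κ * ξ * x ^ 2)) * (growth ν ξ x * ψ x) ^ 2) := by
      refine integral_mono (hi2.const_mul R) ((hi3.const_mul _).add hi1) fun x => ?_
      simp only
      rw [← mul_assoc, ← add_mul]
      refine mul_le_mul_of_nonneg_right ?_ (sq_nonneg _)
      rcases le_total (x ^ 2) R with hx | hx
      · have h3 : κ * ξ * x ^ 2 ≤ ξ * R := by
          have h4 : κ * (ξ * x ^ 2) ≤ 1 * (ξ * x ^ 2) := by gcongr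
          have h5 : ξ * x ^ 2 ≤ ξ * R := by gcongr
          linarith
        have h4 : R * Real.exp (κ * ξ * x ^ 2) ≤ R * Real.exp (ξ * R) := by gcongr
        have h5 : 0 ≤ x ^ 2 * Real.exp (κ * ξ * x ^ 2) := by positivity
        linarith
      · have h4 : R * Real.exp (κ * ξ * x ^ 2) ≤ x ^ 2 * Real.exp (κ * ξ * x ^ 2) := by gcongr
        have h5 : 0 ≤ R * Real.exp (ξ * R) := by positivity
        linarith
    rw [integral_const_mul, integral_add (hi3.const_mul _) hi1, integral_const_mul, h1] at h2
    linarith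
  have hAB : A ≤ R / 2 * B := by
    have h2 : η * ξ ^ 2 * A ≤ lam * B :=
      le_trans (by gcongr) hag
    have h3 : R / 2 * B = (lam + 1) * B / (η * ξ ^ 2) := by rw [hR]; ring
    rw [h3, le_div_iff₀ (by positivity)]
    linarith
  have hfin : R * B ≤ R * (2 * Real.exp (ξ * R)) := by linarith
  have h6 := le_of_mul_le_mul_left hfin hRpos
  have h7 : ξ * R = 2 * (lam + 1) / (η * ξ) := by rw [hR]; field_simp
  rwa [h7] at h6

/-- The mass of the eigenfunction against `E = growth ν ξ` is not larger than the value of `E` at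
the point `a` which it would have for the ground state. -/
theorem sq_integral_growth_le (h : IsProfile L ν ξ μ ψ p) (hν : 0 < ν) (hξ : 0 < ξ)
    (h1 : ∫ x in Ioo 0 L, (growth ν ξ x * ψ x) ^ 2 = 1) {a : ℝ} (ha : 0 < a) (haL : a < L) :
    (∫ x in Ioo 0 L, growth ν ξ x ^ 2 * ψ x) ^ 2 ≤
      L * L ^ (2 * ν + 1) * Real.exp (ξ * a ^ 2) *
        (2 * Real.exp (2 * (μ - 2 * ξ * (ν + 1) + 1) / ((a / L) ^ 2 * ξ))) := by
  have hL : 0 < L := ha.trans haL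
  have hq1 : (a / L) ^ 2 ≤ 1 := pow_le_one₀ (by positivity) ((div_le_one hL).2 haL.le)
  -- Cauchy–Schwarz between E e^(-κξx²/2) and e^(κξx²/2) φ. With this κ the first factor squared is
  -- at most L^(2ν+1) e^(ξ(a/L)²x²), and the exponential does not exceed e^(ξa²) on (0, L).
  set κ := 1 - (a / L) ^ 2 with hκ
  have hq0 : 0 < (a / L) ^ 2 := by positivity
  have hexp := h.integral_exp_le hL hν hξ h1 (κ := κ) (η := (a / L) ^ 2) (by linarith)
    hq0 (by nlinarith)
  obtain ⟨C, hC⟩ := h.exists_abs_le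
  have hw : Continuous fun x : ℝ => Real.exp (-(κ * ξ * x ^ 2 / 2)) := by fun_prop
  have hw' : Continuous fun x : ℝ => Real.exp (κ * ξ * x ^ 2 / 2) := by fun_prop
  have hfb : ∀ x ∈ Ioo 0 L, (growth ν ξ x * Real.exp (-(κ * ξ * x ^ 2 / 2))) ^ 2 ≤
      L ^ (2 * ν + 1) * Real.exp (ξ * a ^ 2) := by
    intro x hx
    rw [growth_of_pos hx.1, mul_assoc, ← Real.exp_add, mul_pow, ← Real.rpow_natCast (x ^ _) 2,
      ← Real.rpow_mul hx.1.le, ← Real.exp_nat_mul]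
    have e1 : (ν + 1 / 2) * ((2 : ℕ) : ℝ) = 2 * ν + 1 := by push_cast; ring
    rw [e1]
    have hx0 := hx.1
    have h2 : x ^ 2 ≤ L ^ 2 := pow_le_pow_left₀ hx0.le hx.2.le 2
    have h3 : ((2 : ℕ) : ℝ) * (ξ * x ^ 2 / 2 + -(κ * ξ * x ^ 2 / 2)) ≤ ξ * a ^ 2 := by
      have h4 : ((2 : ℕ) : ℝ) * (ξ * x ^ 2 / 2 + -(κ * ξ * x ^ 2 / 2)) =
          ξ * (a / L) ^ 2 * x ^ 2 := by rw [hκ]; push_cast; ring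
      rw [h4]
      calc ξ * (a / L) ^ 2 * x ^ 2 ≤ ξ * (a / L) ^ 2 * L ^ 2 := by gcongr
        _ = ξ * a ^ 2 := by field_simp
    have := hx.2.le
    gcongr
  have hf : MemLp (fun x => growth ν ξ x * Real.exp (-(κ * ξ * x ^ 2 / 2))) 2
      (intervalMeasure L) :=
    memLp_of_abs_le ((continuous_growth hν).mul hw).aestronglyMeasurable
      (Real.sqrt (L ^ (2 * ν + 1) * Real.exp (ξ * a ^ 2))) fun x hx => Real.abs_le_sqrt (hfb x hx)
  have hg : MemLp (fun x => Real.exp (κ * ξ * x ^ 2 / 2) * (growth ν ξ x * ψ x)) 2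
      (intervalMeasure L) := by
    rw [memLp_two_iff_integrable_sq]
    · refine (h.integrableOn_mul hν (g := fun x => Real.exp (κ * ξ * x ^ 2 / 2) ^ 2)
        (by fun_prop)).congr (Eventually.of_forall fun x => ?_)
      simp only; ring
    · exact (hw'.continuousOn.mul ((continuous_growth hν).continuousOn.mul
        h.continuousOn_fst)).aestronglyMeasurable measurableSet_Ioo
  have hprod : ∫ x in Ioo 0 L, growth ν ξ x ^ 2 * ψ x = inner ℝ hf.toLp hg.toLp := by
    rw [← integral_mul_eq_inner hf hg]
    refine integral_congr_ae (Eventually.of_forall fun x => ?_)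
    simp only
    have : Real.exp (-(κ * ξ * x ^ 2 / 2)) * Real.exp (κ * ξ * x ^ 2 / 2) = 1 := by
      rw [← Real.exp_add, neg_add_cancel, Real.exp_zero]
    linear_combination (-(growth ν ξ x ^ 2 * ψ x)) * this
  have hfn : ‖hf.toLp‖ ^ 2 ≤ L * L ^ (2 * ν + 1) * Real.exp (ξ * a ^ 2) := by
    have h2 := norm_toLp_sq_le hL.le hf (Real.sqrt (L ^ (2 * ν + 1) * Real.exp (ξ * a ^ 2)))
      fun x hx => Real.abs_le_sqrt (hfb x hx)
    have hp := Real.rpow_nonneg hL.le (2 * ν + 1)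
    rw [Real.sq_sqrt (by positivity)] at h2
    linarith
  have hgn : ‖hg.toLp‖ ^ 2 ≤
      2 * Real.exp (2 * (μ - 2 * ξ * (ν + 1) + 1) / ((a / L) ^ 2 * ξ)) := by
    rw [norm_toLp_sq]
    refine le_trans (le_of_eq ?_) hexp
    refine integral_congr_ae (Eventually.of_forall fun x => ?_)
    simp only
    rw [mul_pow, ← Real.exp_nat_mul]
    congr 2
    push_cast; ring
  have hcs := abs_real_inner_le_norm hf.toLp hg.toLp
  rw [hprod, ← sq_abs]
  calc |inner ℝ hf.toLp hg.toLp| ^ 2 ≤ (‖hf.toLp‖ * ‖hg.toLp‖) ^ 2 :=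
        pow_le_pow_left₀ (abs_nonneg _) hcs 2
    _ = ‖hf.toLp‖ ^ 2 * ‖hg.toLp‖ ^ 2 := mul_pow _ _ _
    _ ≤ _ := mul_le_mul hfn hgn (sq_nonneg _) (le_trans (sq_nonneg _) hfn)

/-- The value of the profile at `0`. -/
theorem sq_limit_zero_le (h : IsProfile L ν ξ μ ψ p) (hν : 0 < ν) (hξ : 0 ≤ ξ)
    (hμ : 0 < μ) (h1 : ∫ x in Ioo 0 L, (growth ν ξ x * ψ x) ^ 2 = 1) {n : ℝ}
    (hn : Tendsto ψ (𝓝[>] 0) (𝓝 n)) (hL : (2 * Real.sqrt μ)⁻¹ ≤ L) :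
    n ^ 2 ≤ 4 * (4 * Real.sqrt μ) ^ (2 * ν + 2) := by
  have hsμ : 0 < Real.sqrt μ := Real.sqrt_pos.2 hμ
  -- Here μl² = 1/4, so the one-term expansion gives |ψ - n| ≤ S/4 on (0, l), where S is the
  -- supremum of |ψ| there. Then S ≤ |n| + S/4, hence |ψ| ≥ |n|/2, and the unit mass of Eψ on (l/2,
  -- l) bounds n.
  set l := (2 * Real.sqrt μ)⁻¹ with hl
  have hl0 : 0 < l := by positivity
  have hsub : Ioo 0 l ⊆ Ioo 0 L := Ioo_subset_Ioo_right hL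
  have hμl : μ * l ^ 2 = 1 / 4 := by
    rw [hl, inv_pow, mul_pow, Real.sq_sqrt hμ.le]; field_simp; norm_num
  obtain ⟨C, hC⟩ := h.exists_abs_le
  set S := sSup ((fun x => |ψ x|) '' Ioo 0 l) with hS
  have hne : ((fun x => |ψ x|) '' Ioo 0 l).Nonempty := (nonempty_Ioo.2 hl0).image _
  have hbd : BddAbove ((fun x => |ψ x|) '' Ioo 0 l) :=
    ⟨C, by rintro _ ⟨x, hx, rfl⟩; exact hC x (hsub hx)⟩
  have hSle : ∀ x ∈ Ioo 0 l, |ψ x| ≤ S := fun x hx => le_csSup hbd ⟨x, hx, rfl⟩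
  have hS0 : 0 ≤ S := (abs_nonneg _).trans (hSle (l / 2) ⟨by linarith, by linarith⟩)
  have hdiff : ∀ x ∈ Ioo 0 l, |ψ x - n| ≤ S / 4 := by
    intro x hx
    have h2 := h.abs_sub_sum_left_le hν hξ hμ.le hn hL hSle 1 x hx
    simp [leftIterate] at h2
    refine h2.trans ?_
    have hx0 := hx.1.le
    have h3 : μ * x ^ 2 ≤ μ * l ^ 2 := by have := hx.2.le; gcongr
    calc S * μ * x ^ 2 = S * (μ * x ^ 2) := by ring
      _ ≤ S * (1 / 4) := by rw [← hμl]; gcongr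
      _ = S / 4 := by ring
  have hSn : S ≤ |n| + S / 4 := by
    refine csSup_le hne ?_
    rintro _ ⟨x, hx, rfl⟩
    simp only
    have := abs_sub_abs_le_abs_sub (ψ x) n
    linarith [hdiff x hx]
  have hlow : ∀ x ∈ Ioo 0 l, |n| / 2 ≤ |ψ x| := by
    intro x hx
    have := abs_sub_abs_le_abs_sub n (ψ x)
    rw [abs_sub_comm] at this
    linarith [hdiff x hx]
  have hint := h.integrableOn_mul hν (g := fun _ => 1) (by fun_prop)
  simp only [one_mul] at hint
  have hsub2 : Ioo (l / 2) l ⊆ Ioo 0 L := (Ioo_subset_Ioo_left (by linarith)).trans hsub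
  have hkey : (l / 2) ^ (2 * ν + 1) * (n ^ 2 / 4) * (l / 2) ≤ 1 := by
    have h3 : ∫ x in Ioo (l / 2) l, (l / 2) ^ (2 * ν + 1) * (n ^ 2 / 4) ≤
        ∫ x in Ioo (l / 2) l, (growth ν ξ x * ψ x) ^ 2 := by
      refine setIntegral_mono_on (integrable_const _) (hint.mono_set hsub2) measurableSet_Ioo fun x hx => ?_
      have hx0 : 0 < x := by linarith [hx.1]
      rw [mul_pow]
      have h4 : n ^ 2 / 4 ≤ ψ x ^ 2 := by
        rw [← sq_abs n, ← sq_abs (ψ x)]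
        have := pow_le_pow_left₀ (by positivity) (hlow x ⟨hx0, hx.2⟩) 2
        linarith
      have h5 : (l / 2) ^ (2 * ν + 1) ≤ growth ν ξ x ^ 2 := by
        have e1 : (ν + 1 / 2) * ((2 : ℕ) : ℝ) = 2 * ν + 1 := by push_cast; ring
        rw [growth_of_pos hx0, mul_pow, ← Real.rpow_natCast (x ^ _) 2, ← Real.rpow_mul hx0.le, e1]
        have h6 : (1 : ℝ) ≤ Real.exp (ξ * x ^ 2 / 2) ^ 2 :=
          one_le_pow₀ (Real.one_le_exp (by positivity))
        have h7 : (l / 2) ^ (2 * ν + 1) ≤ x ^ (2 * ν + 1) :=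
          Real.rpow_le_rpow (by positivity) hx.1.le (by positivity)
        exact h7.trans (le_mul_of_one_le_right (Real.rpow_nonneg hx0.le _) h6)
      exact mul_le_mul h5 h4 (by positivity) (sq_nonneg _)
    have h4 : ∫ x in Ioo (l / 2) l, (growth ν ξ x * ψ x) ^ 2 ≤ 1 := by
      rw [← h1]
      exact setIntegral_mono_set hint (Eventually.of_forall fun x => sq_nonneg _)
        hsub2.eventuallyLE
    have h5 : ∫ x in Ioo (l / 2) l, (l / 2) ^ (2 * ν + 1) * (n ^ 2 / 4) =
        (l / 2) ^ (2 * ν + 1) * (n ^ 2 / 4) * (l / 2) := by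
      rw [setIntegral_const, Measure.real, Real.volume_Ioo, ENNReal.toReal_ofReal (by linarith),
        smul_eq_mul]
      ring
    linarith
  have h6 : l / 2 = (4 * Real.sqrt μ)⁻¹ := by rw [hl]; field_simp; norm_num
  have h7 : (l / 2) ^ (2 * ν + 1) * (l / 2) = ((4 * Real.sqrt μ) ^ (2 * ν + 2))⁻¹ := by
    rw [← Real.rpow_add_one (by positivity), h6, Real.inv_rpow (by positivity)]
    congr 2; ring
  have h8 : 0 < (4 * Real.sqrt μ) ^ (2 * ν + 2) := Real.rpow_pos_of_pos (by positivity) _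
  have h9 : ((4 * Real.sqrt μ) ^ (2 * ν + 2))⁻¹ * (n ^ 2 / 4) ≤ 1 := by
    rw [← h7]; linarith
  rw [inv_mul_le_iff₀ h8] at h9
  linarith

end IsProfile

/-! ### Test functions, H₀¹ and the domain of G_ξ. -/

section Sobolev

variable {L : ℝ}

namespace IsTestFunction

variable {φ η : ℝ → ℝ}

theorem exists_Icc (h : IsTestFunction L φ) (hL : 0 < L) :
    ∃ α β, 0 < α ∧ β < L ∧ ∀ x, x ∉ Icc α β → φ x = 0 := by
  rcases (tsupport φ).eq_empty_or_nonempty with h0 | hne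
  · refine ⟨L / 2, L / 2, by linarith, by linarith, fun x _ => ?_⟩
    exact image_eq_zero_of_notMem_tsupport (by simp [h0])
  · have hc : IsCompact (tsupport φ) := h.hasCompactSupport
    refine ⟨sInf (tsupport φ), sSup (tsupport φ), (h.tsupport_subset (hc.sInf_mem hne)).1,
      (h.tsupport_subset (hc.sSup_mem hne)).2, fun x hx => ?_⟩
    refine image_eq_zero_of_notMem_tsupport fun hxs => hx ?_
    exact ⟨csInf_le hc.bddBelow hxs, le_csSup hc.bddAbove hxs⟩

theorem of_forall_eq_zero (h : ContDiff ℝ ∞ φ) {α β : ℝ} (hα : 0 < α) (hβ : β < L)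
    (h0 : ∀ x, x ∉ Icc α β → φ x = 0) : IsTestFunction L φ := by
  have h1 : tsupport φ ⊆ Icc α β :=
    closure_minimal (fun x hx => by_contra fun h2 => hx (h0 x h2)) isClosed_Icc
  exact ⟨h, HasCompactSupport.of_support_subset_isCompact isCompact_Icc
    ((subset_tsupport _).trans h1), h1.trans fun x hx => ⟨hα.trans_le hx.1, hx.2.trans_lt hβ⟩⟩

theorem add_smul (h : IsTestFunction L φ) (h' : IsTestFunction L η) (c : ℝ) (hL : 0 < L) :
    IsTestFunction L (fun x => φ x + c * η x) := by
  obtain ⟨α, β, hα, hβ, h0⟩ := h.exists_Icc hL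
  obtain ⟨α', β', hα', hβ', h0'⟩ := h'.exists_Icc hL
  refine of_forall_eq_zero (h.contDiff.add (contDiff_const.mul h'.contDiff))
    (lt_min hα hα') (max_lt hβ hβ') fun x hx => ?_
  have h1 : x ∉ Icc α β := fun h => hx ⟨(min_le_left _ _).trans h.1, h.2.trans (le_max_left _ _)⟩
  have h2 : x ∉ Icc α' β' := fun h => hx ⟨(min_le_right _ _).trans h.1, h.2.trans (le_max_right _ _)⟩
  simp [h0 x h1, h0' x h2]

theorem zero (hL : 0 < L) : IsTestFunction L (fun _ => 0) :=
  of_forall_eq_zero contDiff_const (α := L / 2) (β := L / 2) (by linarith) (by linarith)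
    fun _ _ => rfl

theorem continuous (h : IsTestFunction L φ) : Continuous φ := h.contDiff.continuous

theorem memLp (h : IsTestFunction L φ) : MemLp φ 2 (intervalMeasure L) :=
  h.continuous.memLp_of_hasCompactSupport h.hasCompactSupport

/-- A primitive of a test function of mean zero is a test function. -/
theorem primitive (h : IsTestFunction L φ) (hL : 0 < L) (h0 : ∫ x in Ioo 0 L, φ x = 0) :
    IsTestFunction L (fun x => ∫ y in (0 : ℝ)..x, φ y) ∧
      deriv (fun x => ∫ y in (0 : ℝ)..x, φ y) = φ := by
  have hd : ∀ x, HasDerivAt (fun x => ∫ y in (0 : ℝ)..x, φ y) (φ x) x := fun x =>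
    (h.continuous.integral_hasStrictDerivAt 0 x).hasDerivAt
  have hderiv : deriv (fun x => ∫ y in (0 : ℝ)..x, φ y) = φ := funext fun x => (hd x).deriv
  refine ⟨?_, hderiv⟩
  obtain ⟨α, β, hα, hβ, hz⟩ := h.exists_Icc hL
  refine of_forall_eq_zero ?_ hα hβ fun x hx => ?_
  · rw [contDiff_infty_iff_deriv, hderiv]
    exact ⟨fun x => (hd x).differentiableAt, h.contDiff⟩
  · by_cases hxα : x < α
    · rw [intervalIntegral.integral_congr (g := fun _ => (0 : ℝ)) fun y hy => ?_]
      · simp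
      · refine hz y fun hy' => ?_
        rcases le_total 0 x with h1 | h1
        · rw [uIcc_of_le h1] at hy; linarith [hy.2, hy'.1]
        · rw [uIcc_of_ge h1] at hy; linarith [hy.2, hy'.1]
    · have hxβ : β < x := by
        by_contra h1; exact hx ⟨not_lt.1 hxα, not_lt.1 h1⟩
      rw [← intervalIntegral.integral_add_adjacent_intervals (b := L)
        (h.continuous.intervalIntegrable _ _) (h.continuous.intervalIntegrable _ _),
        ← setIntegral_Ioo_eq_intervalIntegral hL.le, h0, zero_add,
        intervalIntegral.integral_congr (g := fun _ => (0 : ℝ)) fun y hy => ?_]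
      · simp
      · refine hz y fun hy' => ?_
        rcases le_total L x with h1 | h1
        · rw [uIcc_of_le h1] at hy; linarith [hy.1, hy'.2]
        · rw [uIcc_of_ge h1] at hy; linarith [hy.1, hy'.2]

end IsTestFunction

theorem exists_isTestFunction_integral_eq_one (hL : 0 < L) :
    ∃ θ, IsTestFunction L θ ∧ ∫ x in Ioo 0 L, θ x = 1 := by
  let f : ContDiffBump (L / 2) := ⟨L / 8, L / 4, by positivity, by linarith⟩
  have hsub : tsupport (f.normed volume) ⊆ Ioo 0 L := by
    rw [f.tsupport_normed_eq, Real.closedBall_eq_Icc]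
    intro x hx
    have h1 : L / 2 - L / 4 ≤ x := hx.1
    have h2 : x ≤ L / 2 + L / 4 := hx.2
    constructor <;> linarith
  refine ⟨f.normed volume, ⟨f.contDiff_normed, f.hasCompactSupport_normed, hsub⟩, ?_⟩
  rw [setIntegral_eq_integral_of_forall_compl_eq_zero fun x hx =>
    image_eq_zero_of_notMem_tsupport fun h => hx (hsub h)]
  exact f.integral_normed

/-- The test functions, as a subspace of `L²(0, L)`. -/
def testSubmodule (hL : 0 < L) : Submodule ℝ (L2Interval L) where
  carrier := {v | ∃ φ, IsTestFunction L φ ∧ v =ᵐ[intervalMeasure L] φ}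
  add_mem' := by
    rintro u v ⟨φ, hφ, hu⟩ ⟨η, hη, hv⟩
    refine ⟨_, hφ.add_smul hη 1 hL, ?_⟩
    filter_upwards [Lp.coeFn_add u v, hu, hv] with x h1 h2 h3
    rw [h1, Pi.add_apply, h2, h3, one_mul]
  zero_mem' := ⟨_, IsTestFunction.zero hL, Lp.coeFn_zero _ _ _⟩
  smul_mem' := by
    rintro c v ⟨η, hη, hv⟩
    refine ⟨_, (IsTestFunction.zero hL).add_smul hη c hL, ?_⟩
    filter_upwards [Lp.coeFn_smul c v, hv] with x h1 h2
    rw [h1, Pi.smul_apply, h2, smul_eq_mul, zero_add]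

/-- An L² function orthogonal to all test functions vanishes almost everywhere, by the fundamental
lemma of the calculus of variations. -/
theorem topologicalClosure_testSubmodule (hL : 0 < L) :
    (testSubmodule hL).topologicalClosure = ⊤ := by
  rw [Submodule.topologicalClosure_eq_top_iff, Submodule.eq_bot_iff]
  intro v hv
  rw [Lp.eq_zero_iff_ae_eq_zero]
  have hvI : IntegrableOn v (Ioo 0 L) volume := integrable_coe v
  have h1 := isOpen_Ioo.ae_eq_zero_of_integral_contDiff_smul_eq_zero (f := v) (μ := volume)
    (U := Ioo 0 L) hvI.locallyIntegrableOn fun g hg hgc hgs => ?_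
  · exact (ae_restrict_iff' measurableSet_Ioo).2 h1
  · have hg' : IsTestFunction L g := ⟨hg, hgc, hgs⟩
    have h2 : inner ℝ (hg'.memLp.toLp : L2Interval L) v = 0 := hv _ ⟨g, hg', hg'.memLp.coeFn_toLp⟩
    rw [← setIntegral_eq_integral_of_forall_compl_eq_zero (s := Ioo 0 L) fun x hx => by
      simp [image_eq_zero_of_notMem_tsupport fun h => hx (hgs h)]]
    refine Eq.trans ?_ h2
    rw [inner_eq_integral]
    refine integral_congr_ae ?_
    filter_upwards [hg'.memLp.coeFn_toLp] with x hx
    rw [hx, smul_eq_mul]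

theorem isBoundedKernel_lt : IsBoundedKernel (fun x y => if y < x then 1 else 0) := by
  refine ⟨?_, fun x y => by split_ifs <;> simp⟩
  exact Measurable.ite (measurableSet_lt measurable_snd measurable_fst) measurable_const
    measurable_const

theorem integral_lt_kernel {x : ℝ} (hx : x ∈ Ioo 0 L) (v : ℝ → ℝ) :
    ∫ y in Ioo 0 L, (if y < x then 1 else 0) * v y = ∫ y in (0 : ℝ)..x, v y := by
  have h1 : ∀ y ∈ Ioo 0 L, (if y < x then 1 else 0) * v y = (Ioo 0 x).indicator v y := by
    intro y hy
    by_cases hys : y < x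
    · rw [if_pos hys, indicator_of_mem (show y ∈ Ioo 0 x from ⟨hy.1, hys⟩), one_mul]
    · rw [if_neg hys, indicator_of_notMem (fun h => hys h.2), zero_mul]
  rw [setIntegral_congr_fun measurableSet_Ioo h1, setIntegral_indicator measurableSet_Ioo,
    inter_eq_right.2 (Ioo_subset_Ioo_right hx.2.le), setIntegral_Ioo_eq_intervalIntegral hx.1.le]

/-- A function of mean zero is the weak derivative of its primitive, which belongs to `H₀¹`. -/
theorem primitive_mem_H10 (hL : 0 < L) (v : L2Interval L) (hv : ∫ x in Ioo 0 L, v x = 0) :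
    (kernelOp hL.le isBoundedKernel_lt v, v) ∈ H10 L := by
  obtain ⟨θ, hθ, hθ1⟩ := exists_isTestFunction_integral_eq_one hL
  have hone : MemLp (fun _ => (1 : ℝ)) 2 (intervalMeasure L) := memLp_const 1
  have hmean : ∀ w : L2Interval L, inner ℝ hone.toLp w = ∫ x in Ioo 0 L, w x := fun w => by
    rw [inner_eq_integral]
    refine integral_congr_ae ?_
    filter_upwards [hone.coeFn_toLp] with x hx
    rw [hx, one_mul]
  -- Subtracting a multiple of θ restores mean zero, so primitives of test functions remain test
  -- functions. Q is continuous and fixes v, so density passes through it.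
  let Q : L2Interval L → L2Interval L := fun w =>
    w - (inner ℝ hone.toLp w : ℝ) • hθ.memLp.toLp
  have hQ : Continuous Q := by fun_prop
  have hQv : Q v = v := by simp only [Q]; rw [hmean, hv, zero_smul, sub_zero]
  have hcont : Continuous fun w => (kernelOp hL.le isBoundedKernel_lt (Q w), Q w) := by fun_prop
  have hmem : v ∈ closure (testSubmodule hL : Set (L2Interval L)) := by
    rw [← Submodule.topologicalClosure_coe, topologicalClosure_testSubmodule]; trivial
  have h1 := map_mem_closure hcont hmem (t := {p | ∃ φ : ℝ → ℝ, IsTestFunction L φ ∧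
    p.1 =ᵐ[intervalMeasure L] φ ∧ p.2 =ᵐ[intervalMeasure L] deriv φ}) ?_
  · rwa [hQv] at h1
  · rintro w ⟨w₀, hw₀, hw⟩
    set c := (inner ℝ hone.toLp w : ℝ) with hc
    have hη := hw₀.add_smul hθ (-c) hL
    have hQw : Q w =ᵐ[intervalMeasure L] fun x => w₀ x + -c * θ x := by
      filter_upwards [Lp.coeFn_sub w (c • hθ.memLp.toLp), Lp.coeFn_smul c hθ.memLp.toLp,
        hθ.memLp.coeFn_toLp, hw] with x h1 h2 h3 h4
      simp only [Q]
      rw [h1, Pi.sub_apply, h2, Pi.smul_apply, h3, h4, smul_eq_mul]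
      ring
    have hη0 : ∫ x in Ioo 0 L, (w₀ x + -c * θ x) = 0 := by
      rw [integral_add (hw₀.memLp.integrable one_le_two)
        ((hθ.memLp.integrable one_le_two).const_mul _), integral_const_mul, hθ1, hc, hmean,
        integral_congr_ae hw]
      ring
    obtain ⟨h2, h3⟩ := hη.primitive hL hη0
    refine ⟨_, h2, ?_, ?_⟩
    · filter_upwards [kernelOp_coeFn hL.le isBoundedKernel_lt (Q w),
        ae_restrict_mem measurableSet_Ioo] with x hx hx0
      rw [hx, ← integral_lt_kernel hx0]
      refine integral_congr_ae ?_
      filter_upwards [hQw] with y hy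
      rw [hy]
    · rw [h3]; exact hQw

/-- The boundary values make u' of mean zero and make u its primitive from 0, so `primitive_mem_H10`
applies. -/
theorem mem_H10_of_hasDerivAt (hL : 0 < L) {u u' : ℝ → ℝ}
    (hd : ∀ x ∈ Ioo 0 L, HasDerivAt u (u' x) x) (h0 : Tendsto u (𝓝[>] 0) (𝓝 0))
    (h1 : Tendsto u (𝓝[<] L) (𝓝 0)) (hu : MemLp u 2 (intervalMeasure L))
    (hu' : MemLp u' 2 (intervalMeasure L)) : (hu.toLp, hu'.toLp) ∈ H10 L := by
  have hint : IntegrableOn u' (Ioo 0 L) := hu'.integrable one_le_two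
  have hint' : ∀ x, 0 ≤ x → x ≤ L → IntervalIntegrable u' volume 0 x := fun x hx hx' => by
    rw [intervalIntegrable_iff_integrableOn_Ioo_of_le hx]
    exact hint.mono_set (Ioo_subset_Ioo_right hx')
  have h2 : ∫ x in Ioo 0 L, (hu'.toLp : L2Interval L) x = 0 := by
    rw [integral_congr_ae hu'.coeFn_toLp, setIntegral_Ioo_eq_intervalIntegral hL.le,
      intervalIntegral.integral_eq_sub_of_hasDerivAt_of_tendsto hL hd (hint' L hL.le le_rfl) h0 h1,
      sub_zero]
  convert primitive_mem_H10 hL hu'.toLp h2 using 2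
  refine Lp.ext ?_
  filter_upwards [hu.coeFn_toLp, kernelOp_coeFn hL.le isBoundedKernel_lt hu'.toLp,
    ae_restrict_mem measurableSet_Ioo] with x h3 h4 hx
  rw [h3, h4]
  have h5 : ∫ y in Ioo 0 L, (if y < x then 1 else 0) * (hu'.toLp : L2Interval L) y =
      ∫ y in Ioo 0 L, (if y < x then 1 else 0) * u' y := by
    refine integral_congr_ae ?_
    filter_upwards [hu'.coeFn_toLp] with y hy
    rw [hy]
  have h6 := (hd x hx).continuousAt.continuousWithinAt (s := Iio x)
  rw [h5, integral_lt_kernel hx, intervalIntegral.integral_eq_sub_of_hasDerivAt_of_tendsto hx.1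
    (fun y hy => hd y ⟨hy.1, hy.2.trans hx.2⟩) (hint' x hx.1.le hx.2.le) h0 h6, sub_zero]

theorem continuousOn_grushinPotential (ν ξ : ℝ) :
    ContinuousOn (grushinPotential ν ξ) (Ioo 0 L) := by
  unfold grushinPotential
  refine ContinuousOn.add (by fun_prop) (continuousOn_const.div (by fun_prop) fun x hx => ?_)
  exact pow_ne_zero 2 hx.1.ne'

/-- A classical solution of `-u'' + V u = h` vanishing at the ends belongs to the domain of the
operator. -/
theorem isGrushinImage_of_hasDerivAt (hL : 0 < L) {ν ξ : ℝ} {u u' u'' h : ℝ → ℝ}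
    (hd : ∀ x ∈ Ioo 0 L, HasDerivAt u (u' x) x) (hd' : ∀ x ∈ Ioo 0 L, HasDerivAt u' (u'' x) x)
    (hh : ∀ x ∈ Ioo 0 L, u'' x = grushinPotential ν ξ x * u x - h x)
    (h0 : Tendsto u (𝓝[>] 0) (𝓝 0)) (h1 : Tendsto u (𝓝[<] L) (𝓝 0))
    (hu : MemLp u 2 (intervalMeasure L)) (hu' : MemLp u' 2 (intervalMeasure L))
    (hhL : MemLp h 2 (intervalMeasure L)) : IsGrushinImage L ν ξ hu.toLp hhL.toLp := by
  refine ⟨hu'.toLp, mem_H10_of_hasDerivAt hL hd h0 h1 hu hu', fun φ hφ => ?_⟩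
  have hφ'c : Continuous (deriv φ) := hφ.contDiff.continuous_deriv (by simp)
  have hφ' : MemLp (deriv φ) 2 (intervalMeasure L) :=
    hφ'c.memLp_of_hasCompactSupport hφ.hasCompactSupport.deriv
  have hVφc : Continuous fun x => grushinPotential ν ξ x * φ x := by
    refine ContinuousOn.continuous_of_tsupport_subset
      ((continuousOn_grushinPotential (L := L) ν ξ).mul hφ.continuous.continuousOn) isOpen_Ioo ?_
    exact (tsupport_mul_subset_right).trans hφ.tsupport_subset
  have hVφ : MemLp (fun x => grushinPotential ν ξ x * φ x) 2 (intervalMeasure L) :=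
    hVφc.memLp_of_hasCompactSupport hφ.hasCompactSupport.mul_left
  have e1 : ∫ x in Ioo 0 L, ((hu'.toLp : L2Interval L) x * deriv φ x + grushinPotential ν ξ x * (hu.toLp : L2Interval L) x * φ x) =
      ∫ x in Ioo 0 L, (u' x * deriv φ x + grushinPotential ν ξ x * u x * φ x) := by
    refine integral_congr_ae ?_
    filter_upwards [hu.coeFn_toLp, hu'.coeFn_toLp] with x h2 h3
    rw [h2, h3]
  have e2 : ∫ x in Ioo 0 L, (hhL.toLp : L2Interval L) x * φ x = ∫ x in Ioo 0 L, h x * φ x := by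
    refine integral_congr_ae ?_
    filter_upwards [hhL.coeFn_toLp] with x h2
    rw [h2]
  rw [e1, e2, ← sub_eq_zero]
  have i1 : Integrable (fun x => u' x * deriv φ x + grushinPotential ν ξ x * u x * φ x)
      (intervalMeasure L) := by
    refine ((hu'.integrable_mul hφ').add (hu.integrable_mul hVφ)).congr
      (Eventually.of_forall fun x => ?_)
    simp only [Pi.add_apply, Pi.mul_apply]
    ring
  have i2 : Integrable (fun x => h x * φ x) (intervalMeasure L) := hhL.integrable_mul hφ.memLp
  rw [← integral_sub i1 i2, setIntegral_Ioo_eq_intervalIntegral hL.le]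
  obtain ⟨α, β, hα, hβ, hz⟩ := hφ.exists_Icc hL
  -- The integrand is (u'φ)', and the boundary terms vanish because φ is zero near both ends.
  rw [intervalIntegral.integral_eq_sub_of_hasDerivAt_of_tendsto (fa := 0) (fb := 0) hL
    (f := fun x => u' x * φ x) ?_ ?_ ?_ ?_, sub_zero]
  · intro x hx
    refine ((hd' x hx).mul ((hφ.contDiff.differentiable (by simp)) x).hasDerivAt).congr_deriv ?_
    rw [hh x hx]; ring
  · rw [intervalIntegrable_iff_integrableOn_Ioo_of_le hL.le]
    exact i1.sub i2
  · refine tendsto_const_nhds.congr' ?_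
    filter_upwards [Ioo_mem_nhdsGT hα] with x hx
    rw [hz x fun h => absurd h.1 (not_le.2 hx.2), mul_zero]
  · refine tendsto_const_nhds.congr' ?_
    filter_upwards [Ioo_mem_nhdsLT hβ] with x hx
    rw [hz x fun h => absurd h.2 (not_le.2 hx.1), mul_zero]

/-- (E/x)² behaves like x^(2ν-1) near 0, which is integrable because ν > 0. E/x is the size of the
derivative of Eψ near 0 and serves below as the common L² majorant. -/
theorem memLp_growth_div (hL : 0 ≤ L) {ν : ℝ} (hν : 0 < ν) (ξ : ℝ) :
    MemLp (fun x => growth ν ξ x / x) 2 (intervalMeasure L) := by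
  have hmeas : Measurable fun x => growth ν ξ x / x :=
    (continuous_growth hν).measurable.div measurable_id
  rw [memLp_two_iff_integrable_sq hmeas.aestronglyMeasurable]
  have h1 : Integrable (fun x : ℝ => x ^ (2 * ν - 1)) (intervalMeasure L) :=
    (intervalIntegrable_iff_integrableOn_Ioo_of_le hL).1
      (intervalIntegral.intervalIntegrable_rpow' (by linarith))
  refine (h1.const_mul (Real.exp (|ξ| * L ^ 2))).mono' (hmeas.pow_const 2).aestronglyMeasurable ?_
  filter_upwards [ae_restrict_mem measurableSet_Ioo] with x hx
  have hx0 : 0 < x := hx.1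
  rw [Real.norm_of_nonneg (sq_nonneg _), growth_of_pos hx0, div_pow, mul_pow, ← Real.rpow_natCast,
    ← Real.rpow_mul hx0.le, ← Real.exp_nat_mul, mul_div_right_comm, ← Real.rpow_natCast x 2,
    ← Real.rpow_sub hx0, mul_comm]
  have h2 : ξ * x ^ 2 ≤ |ξ| * L ^ 2 := by
    have h3 : x ^ 2 ≤ L ^ 2 := pow_le_pow_left₀ hx0.le hx.2.le 2
    exact (mul_le_mul_of_nonneg_right (le_abs_self ξ) (sq_nonneg x)).trans
      (mul_le_mul_of_nonneg_left h3 (abs_nonneg _))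
  have h4 : (ν + 1 / 2) * ((2 : ℕ) : ℝ) - ((2 : ℕ) : ℝ) = 2 * ν - 1 := by push_cast; ring
  rw [h4]
  refine mul_le_mul_of_nonneg_right (Real.exp_le_exp.2 ?_) (Real.rpow_nonneg hx0.le _)
  rw [Real.rpow_natCast]
  push_cast
  linarith

/-- A cut-off of a solution of `(E² ψ')' = r` gives an element `χ E ψ` of the domain of `G_ξ`. -/
theorem exists_isGrushinImage_cutoff (hL : 0 < L) {ν ξ : ℝ} (hν : 0 < ν)
    {χ χ₁ χ₂ ψ p r : ℝ → ℝ} {S : Set ℝ} {C : ℝ}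
    (hχ : ∀ x, HasDerivAt χ (χ₁ x) x) (hχ₁ : ∀ x, HasDerivAt χ₁ (χ₂ x) x) (hχ₂ : Continuous χ₂)
    (hS : ∀ x ∉ S, χ x = 0 ∧ χ₁ x = 0 ∧ χ₂ x = 0)
    (hψ : ∀ x ∈ Ioo 0 L, HasDerivAt ψ (p x / growth ν ξ x ^ 2) x)
    (hp : ∀ x ∈ Ioo 0 L, HasDerivAt p (r x) x) (hr : ContinuousOn r (Ioo 0 L))
    (hC : ∀ x ∈ Ioo 0 L, x ∈ S → |ψ x| ≤ C ∧ |p x| ≤ C * growth ν ξ x ^ 2 ∧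
      |r x| ≤ C * growth ν ξ x ^ 2)
    (hend : Tendsto (fun x => χ x * ψ x) (𝓝[<] L) (𝓝 0)) :
    ∃ (hu : MemLp (fun x => χ x * (growth ν ξ x * ψ x)) 2 (intervalMeasure L))
      (hh : MemLp (fun x => -(χ₂ x * (growth ν ξ x * ψ x)
        + 2 * (χ₁ x * (growthRate ν ξ x * growth ν ξ x * ψ x + p x / growth ν ξ x)))
        - χ x * (2 * ξ * (ν + 1) * (growth ν ξ x * ψ x) + r x / growth ν ξ x)) 2
        (intervalMeasure L)),
      IsGrushinImage L ν ξ hu.toLp hh.toLp := by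
  have hχc : Continuous χ := continuous_iff_continuousAt.2 fun x => (hχ x).continuousAt
  have hχ₁c : Continuous χ₁ := continuous_iff_continuousAt.2 fun x => (hχ₁ x).continuousAt
  have hbdd : ∀ f : ℝ → ℝ, Continuous f → ∃ D, ∀ x ∈ Icc 0 L, |f x| ≤ D := fun f hf =>
    isCompact_Icc.exists_bound_of_continuousOn hf.continuousOn
  obtain ⟨D₀, hD₀⟩ := hbdd _ hχc
  obtain ⟨D₁, hD₁⟩ := hbdd _ hχ₁c
  obtain ⟨D₂, hD₂⟩ := hbdd _ hχ₂
  have hL0 : (0 : ℝ) ∈ Icc 0 L := ⟨le_rfl, hL.le⟩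
  have hD₀0 : 0 ≤ D₀ := (abs_nonneg _).trans (hD₀ 0 hL0)
  have hD₁0 : 0 ≤ D₁ := (abs_nonneg _).trans (hD₁ 0 hL0)
  have hD₂0 : 0 ≤ D₂ := (abs_nonneg _).trans (hD₂ 0 hL0)
  set E := growth ν ξ with hE
  have hEp : ∀ x ∈ Ioo 0 L, 0 < E x := fun x hx => growth_pos hx.1
  have hEc : ContinuousOn E (Ioo 0 L) := (continuous_growth hν).continuousOn
  have hψc : ContinuousOn ψ (Ioo 0 L) := fun x hx => (hψ x hx).continuousAt.continuousWithinAt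
  have hpc : ContinuousOn p (Ioo 0 L) := fun x hx => (hp x hx).continuousAt.continuousWithinAt
  have hQc : ContinuousOn (growthRate ν ξ) (Ioo 0 L) := fun x hx =>
    (hasDerivAt_growthRate hx.1).continuousAt.continuousWithinAt
  have hpEc : ContinuousOn (fun x => p x / E x) (Ioo 0 L) := hpc.div hEc fun x hx => (hEp x hx).ne'
  have hrEc : ContinuousOn (fun x => r x / E x) (Ioo 0 L) := hr.div hEc fun x hx => (hEp x hx).ne'
  have hw := memLp_growth_div hL.le hν ξ
  -- Everything is compared with E/x: x < L trades E for L·E/x, and growthRate·E equals (ν + 1/2 +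
  -- ξx²) E/x.
  have key : ∀ x ∈ Ioo 0 L, x ∈ S → 0 ≤ C ∧ 0 ≤ E x / x ∧ |E x * ψ x| ≤ L * C * (E x / x) ∧
      |growthRate ν ξ x * E x * ψ x + p x / E x| ≤
        ((ν + 1 / 2 + |ξ| * L ^ 2) * C + L * C) * (E x / x) ∧
      |r x / E x| ≤ L * C * (E x / x) := by
    intro x hx hxS
    have hx0 : 0 < x := hx.1
    obtain ⟨h1, h2, h3⟩ := hC x hx hxS
    have hC0 : 0 ≤ C := (abs_nonneg _).trans h1
    have hEx := hEp x hx
    have hq : 0 ≤ E x / x := by positivity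
    have hEq : E x * C ≤ L * C * (E x / x) := by
      have h4 : E x * C = x * C * (E x / x) := by field_simp
      rw [h4]
      have := hx.2.le
      gcongr
    have hdiv : ∀ s, |s| ≤ C * E x ^ 2 → |s / E x| ≤ E x * C := fun s hs => by
      rw [abs_div, abs_of_pos hEx, div_le_iff₀ hEx]
      linarith
    have h5 : |E x * ψ x| ≤ E x * C := by
      rw [abs_mul, abs_of_pos hEx]
      gcongr
    have h6 : |growthRate ν ξ x * E x * ψ x| ≤ (ν + 1 / 2 + |ξ| * L ^ 2) * C * (E x / x) := by
      have h7 : growthRate ν ξ x * E x * ψ x = (ν + 1 / 2 + ξ * x ^ 2) * ψ x * (E x / x) := by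
        unfold growthRate; field_simp
      rw [h7, abs_mul, abs_mul, abs_of_nonneg hq]
      have h8 : |ν + 1 / 2 + ξ * x ^ 2| ≤ ν + 1 / 2 + |ξ| * L ^ 2 := by
        refine (abs_add_le _ _).trans ?_
        rw [abs_of_pos (by positivity : 0 < ν + 1 / 2), abs_mul, abs_of_nonneg (sq_nonneg x)]
        have := hx.2.le
        gcongr
      gcongr
    refine ⟨hC0, hq, h5.trans hEq, ?_, (hdiv _ h3).trans hEq⟩
    refine (abs_add_le _ _).trans ?_
    rw [add_mul]
    exact add_le_add h6 ((hdiv _ h2).trans hEq)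
  have hmem : ∀ (g : ℝ → ℝ) (K : ℝ), ContinuousOn g (Ioo 0 L) → (∀ x ∈ Ioo 0 L, x ∉ S → g x = 0) →
      (∀ x ∈ Ioo 0 L, x ∈ S → |g x| ≤ K * (E x / x)) → MemLp g 2 (intervalMeasure L) := by
    intro g K hg h0 hK
    refine hw.of_le_mul (c := |K|) (hg.aestronglyMeasurable measurableSet_Ioo) ?_
    filter_upwards [ae_restrict_mem measurableSet_Ioo] with x hx
    by_cases hxS : x ∈ S
    · rw [Real.norm_eq_abs, Real.norm_eq_abs, abs_of_nonneg (key x hx hxS).2.1]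
      exact (hK x hx hxS).trans (mul_le_mul_of_nonneg_right (le_abs_self K) (key x hx hxS).2.1)
    · rw [h0 x hx hxS, norm_zero]; positivity
  have hmul : ∀ (c D s K w : ℝ), |c| ≤ D → |s| ≤ K * w → |c * s| ≤ D * K * w :=
    fun c D s K w hc hs => by
      rw [abs_mul, mul_assoc]
      exact mul_le_mul hc hs (abs_nonneg _) ((abs_nonneg _).trans hc)
  have hu : MemLp (fun x => χ x * (E x * ψ x)) 2 (intervalMeasure L) := by
    refine hmem _ (D₀ * (L * C)) (hχc.continuousOn.mul (hEc.mul hψc))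
      (fun x hx hxS => by rw [(hS x hxS).1, zero_mul]) fun x hx hxS => ?_
    exact hmul _ _ _ _ _ (hD₀ x (Ioo_subset_Icc_self hx)) (key x hx hxS).2.2.1
  have hv₁ : MemLp (fun x => χ₁ x * (E x * ψ x)) 2 (intervalMeasure L) := by
    refine hmem _ (D₁ * (L * C)) (hχ₁c.continuousOn.mul (hEc.mul hψc))
      (fun x hx hxS => by rw [(hS x hxS).2.1, zero_mul]) fun x hx hxS => ?_
    exact hmul _ _ _ _ _ (hD₁ x (Ioo_subset_Icc_self hx)) (key x hx hxS).2.2.1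
  have hv₂ : MemLp (fun x => χ₂ x * (E x * ψ x)) 2 (intervalMeasure L) := by
    refine hmem _ (D₂ * (L * C)) (hχ₂.continuousOn.mul (hEc.mul hψc))
      (fun x hx hxS => by rw [(hS x hxS).2.2, zero_mul]) fun x hx hxS => ?_
    exact hmul _ _ _ _ _ (hD₂ x (Ioo_subset_Icc_self hx)) (key x hx hxS).2.2.1
  have hF : ContinuousOn (fun x => growthRate ν ξ x * E x * ψ x + p x / E x) (Ioo 0 L) :=
    ((hQc.mul hEc).mul hψc).add hpEc
  have hw₀ : MemLp (fun x => χ x * (growthRate ν ξ x * E x * ψ x + p x / E x)) 2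
      (intervalMeasure L) := by
    refine hmem _ (D₀ * ((ν + 1 / 2 + |ξ| * L ^ 2) * C + L * C)) (hχc.continuousOn.mul hF)
      (fun x hx hxS => by rw [(hS x hxS).1, zero_mul]) fun x hx hxS => ?_
    exact hmul _ _ _ _ _ (hD₀ x (Ioo_subset_Icc_self hx)) (key x hx hxS).2.2.2.1
  have hw₁ : MemLp (fun x => χ₁ x * (growthRate ν ξ x * E x * ψ x + p x / E x)) 2
      (intervalMeasure L) := by
    refine hmem _ (D₁ * ((ν + 1 / 2 + |ξ| * L ^ 2) * C + L * C)) (hχ₁c.continuousOn.mul hF)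
      (fun x hx hxS => by rw [(hS x hxS).2.1, zero_mul]) fun x hx hxS => ?_
    exact hmul _ _ _ _ _ (hD₁ x (Ioo_subset_Icc_self hx)) (key x hx hxS).2.2.2.1
  have hz : MemLp (fun x => χ x * (r x / E x)) 2 (intervalMeasure L) := by
    refine hmem _ (D₀ * (L * C)) (hχc.continuousOn.mul hrEc)
      (fun x hx hxS => by rw [(hS x hxS).1, zero_mul]) fun x hx hxS => ?_
    exact hmul _ _ _ _ _ (hD₀ x (Ioo_subset_Icc_self hx)) (key x hx hxS).2.2.2.2
  have hh : MemLp (fun x => -(χ₂ x * (E x * ψ x)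
        + 2 * (χ₁ x * (growthRate ν ξ x * E x * ψ x + p x / E x)))
        - χ x * (2 * ξ * (ν + 1) * (E x * ψ x) + r x / E x)) 2 (intervalMeasure L) := by
    refine (((hv₂.add (hw₁.const_mul 2)).neg).sub ((hu.const_mul (2 * ξ * (ν + 1))).add hz)).ae_eq
      (Eventually.of_forall fun x => ?_)
    simp only [Pi.add_apply, Pi.sub_apply, Pi.neg_apply]
    ring
  refine ⟨hu, hh, isGrushinImage_of_hasDerivAt hL
    (u' := fun x => χ₁ x * (E x * ψ x) + χ x * (growthRate ν ξ x * E x * ψ x + p x / E x))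
    (u'' := fun x => grushinPotential ν ξ x * (χ x * (E x * ψ x)) - (-(χ₂ x * (E x * ψ x)
        + 2 * (χ₁ x * (growthRate ν ξ x * E x * ψ x + p x / E x)))
        - χ x * (2 * ξ * (ν + 1) * (E x * ψ x) + r x / E x))) ?_ ?_ (fun x _ => rfl) ?_ ?_ hu
    (hv₁.add hw₀) hh⟩
  · intro x hx
    have hEx := hEp x hx
    refine ((hχ x).fun_mul ((hasDerivAt_growth hx.1).fun_mul (hψ x hx))).congr_deriv ?_
    rw [← hE]
    field_simp
  · intro x hx
    have hEx := hEp x hx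
    have d1 := hasDerivAt_growth (ν := ν) (ξ := ξ) hx.1
    have d2 := hasDerivAt_growthRate (ν := ν) (ξ := ξ) hx.1
    refine (((hχ₁ x).fun_mul (d1.fun_mul (hψ x hx))).fun_add ((hχ x).fun_mul
      (((d2.fun_mul d1).fun_mul (hψ x hx)).fun_add
        ((hp x hx).fun_div d1 hEx.ne')))).congr_deriv ?_
    -- The Riccati identity cancels the potential against E''/E and leaves only the constant
    -- 2ξ(ν+1).
    have h1 := growthRate_riccati (ν := ν) (ξ := ξ) hx.1
    have h2 : grushinPotential ν ξ x = -(ν + 1 / 2) / x ^ 2 + ξ + growthRate ν ξ x ^ 2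
      - 2 * ξ * (ν + 1) := by linarith
    rw [← hE, h2]
    field_simp
    ring
  · have h1 : Tendsto (fun x => D₀ * C * E x) (𝓝[>] 0) (𝓝 0) := by
      have h2 := (continuous_growth (ξ := ξ) hν).tendsto' 0 0 (growth_zero hν)
      simpa using (h2.mono_left nhdsWithin_le_nhds).const_mul (D₀ * C)
    by_cases hC0 : 0 ≤ C
    · refine squeeze_zero_norm' ?_ h1
      filter_upwards [Ioo_mem_nhdsGT hL] with x hx
      have hEx := hEp x hx
      by_cases hxS : x ∈ S
      · rw [Real.norm_eq_abs, abs_mul, abs_mul, abs_of_pos hEx]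
        have h3 := hD₀ x (Ioo_subset_Icc_self hx)
        have h4 := (hC x hx hxS).1
        calc |χ x| * (E x * |ψ x|) ≤ D₀ * (E x * C) := by gcongr
          _ = D₀ * C * E x := by ring
      · rw [(hS x hxS).1, zero_mul, norm_zero]; positivity
    · refine tendsto_const_nhds.congr' ?_
      filter_upwards [Ioo_mem_nhdsGT hL] with x hx
      rw [(hS x fun hxS => hC0 (key x hx hxS).1).1, zero_mul]
  · have h1 := ((continuous_growth (ξ := ξ) hν).tendsto L).mono_left
      (nhdsWithin_le_nhds (s := Iio L))
    have h2 := hend.mul h1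
    rw [zero_mul] at h2
    refine h2.congr fun x => ?_
    rw [← hE]; ring

end Sobolev

/-! ### Gevrey cut-offs in time and Leibniz weights. -/

section TimeCutoff

/-- Cut-off functions with `n` controlled derivatives, obtained by iterated averaging. -/
theorem exists_cutoff_of_averages (n : ℕ) : ∀ (a : ℕ → ℝ), (∀ i, 0 < a i) → ∀ s, 0 < s →
    ∃ κ : ℕ → ℝ → ℝ, (∀ j, Continuous (κ j)) ∧
      (∀ j < n, ∀ t, HasDerivAt (κ j) (κ (j + 1) t) t) ∧
      (∀ j t, |κ j t| ≤ ∏ i ∈ Finset.range j, 2 / a i) ∧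
      (∀ j, ∀ t ≤ 0, κ j t = 0) ∧
      (∀ t, s + ∑ i ∈ Finset.range n, a i ≤ t → κ 0 t = 1 ∧ ∀ j, κ (j + 1) t = 0) := by
  induction n with
  | zero =>
    intro a ha s hs
    -- A linear ramp on [0, s]. With n = 0 no derivative is claimed, so the entries j ≥ 1 are filled
    -- with zero.
    refine ⟨fun j => if j = 0 then fun t => max 0 (min 1 (t / s)) else fun _ => 0, fun j => ?_,
      fun j hj => absurd hj (Nat.not_lt_zero j), fun j t => ?_, fun j t ht => ?_, fun t ht => ?_⟩
    · beta_reduce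
      split_ifs <;> fun_prop
    · beta_reduce
      split_ifs with h
      · subst h
        rw [Finset.range_zero, Finset.prod_empty, abs_of_nonneg (le_max_left _ _)]
        exact max_le zero_le_one (min_le_left _ _)
      · rw [abs_zero]
        exact Finset.prod_nonneg fun i _ => (div_pos two_pos (ha i)).le
    · beta_reduce
      split_ifs with h
      · exact max_eq_left ((min_le_right _ _).trans (div_nonpos_of_nonpos_of_nonneg ht hs.le))
      · rfl
    · simp only [Finset.range_zero, Finset.sum_empty, add_zero] at ht
      refine ⟨?_, fun j => by simp⟩
      beta_reduce
      rw [if_pos rfl, min_eq_left ((one_le_div hs).2 ht), max_eq_right zero_le_one]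
  | succ n ih =>
    intro a ha s hs
    obtain ⟨κ, hc, hd, hb, h0, h1⟩ := ih (fun i => a (i + 1)) (fun i => ha _) s hs
    have ha0 := ha 0
    -- Averaging over [t - a 0, t] gains one derivative, now a difference quotient costing a factor
    -- 2 / a 0, and delays the arrival at 1 by a 0.
    refine ⟨fun j => Nat.casesOn j (fun t => (∫ r in (t - a 0)..t, κ 0 r) / a 0)
      fun j t => (κ j t - κ j (t - a 0)) / a 0, fun j => ?_, fun j hj t => ?_, fun j t => ?_,
      fun j t ht => ?_, fun t ht => ?_⟩
    · cases j with
      | zero =>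
        have h2 : ∀ t, ∫ r in (t - a 0)..t, κ 0 r =
            (∫ r in (0 : ℝ)..t, κ 0 r) - ∫ r in (0 : ℝ)..(t - a 0), κ 0 r := fun t =>
          (intervalIntegral.integral_interval_sub_left ((hc 0).intervalIntegrable _ _)
            ((hc 0).intervalIntegrable _ _)).symm
        have h3 : Continuous fun t => ∫ r in (0 : ℝ)..t, κ 0 r :=
          intervalIntegral.continuous_primitive (fun _ _ => (hc 0).intervalIntegrable _ _) 0
        simp only [h2]
        exact (h3.sub (h3.comp (continuous_id.sub continuous_const))).div_const _
      | succ j =>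
        exact ((hc j).sub ((hc j).comp (continuous_id.sub continuous_const))).div_const _
    · cases j with
      | zero =>
        have h2 : ∀ t, ∫ r in (t - a 0)..t, κ 0 r =
            (∫ r in (0 : ℝ)..t, κ 0 r) - ∫ r in (0 : ℝ)..(t - a 0), κ 0 r := fun t =>
          (intervalIntegral.integral_interval_sub_left ((hc 0).intervalIntegrable _ _)
            ((hc 0).intervalIntegrable _ _)).symm
        have h3 : ∀ t, HasDerivAt (fun t => ∫ r in (0 : ℝ)..t, κ 0 r) (κ 0 t) t := fun t =>
          ((hc 0).integral_hasStrictDerivAt 0 t).hasDerivAt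
        simp only [h2]
        exact ((h3 t).fun_sub (HasDerivAt.comp_sub_const t (a 0) (h3 (t - a 0)))).div_const (a 0)
      | succ j =>
        have hj' : j < n := Nat.succ_lt_succ_iff.1 hj
        exact ((hd j hj' t).fun_sub
          (HasDerivAt.comp_sub_const t (a 0) (hd j hj' (t - a 0)))).div_const (a 0)
    · cases j with
      | zero =>
        rw [Finset.range_zero, Finset.prod_empty]
        change |(∫ r in (t - a 0)..t, κ 0 r) / a 0| ≤ 1
        rw [abs_div, abs_of_pos ha0, div_le_one ha0, ← Real.norm_eq_abs]
        have h2 := intervalIntegral.norm_integral_le_of_norm_le_const (a := t - a 0) (b := t)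
          (f := κ 0) (C := 1) fun r _ => by simpa using hb 0 r
        rwa [sub_sub_cancel, abs_of_pos ha0, one_mul] at h2
      | succ j =>
        rw [Finset.prod_range_succ', abs_div, abs_of_pos ha0, mul_div_assoc']
        refine div_le_div_of_nonneg_right ?_ ha0.le
        refine (abs_sub _ _).trans ((add_le_add (hb j _) (hb j _)).trans_eq ?_)
        ring
    · cases j with
      | zero =>
        change (∫ r in (t - a 0)..t, κ 0 r) / a 0 = 0
        rw [intervalIntegral.integral_congr (g := fun _ => (0 : ℝ)) fun r hr => ?_]
        · simp
        · rw [uIcc_of_le (by linarith)] at hr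
          exact h0 0 r (hr.2.trans ht)
      | succ j =>
        change (κ j t - κ j (t - a 0)) / a 0 = 0
        rw [h0 j t ht, h0 j (t - a 0) (by linarith), sub_zero, zero_div]
    · rw [Finset.sum_range_succ'] at ht
      have h2 : ∀ r, t - a 0 ≤ r → κ 0 r = 1 ∧ ∀ j, κ (j + 1) r = 0 := fun r hr =>
        h1 r (by linarith)
      refine ⟨?_, fun j => ?_⟩
      · change (∫ r in (t - a 0)..t, κ 0 r) / a 0 = 1
        rw [intervalIntegral.integral_congr (g := fun _ => (1 : ℝ)) fun r hr => ?_]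
        · simp [ha0.ne']
        · rw [uIcc_of_le (by linarith)] at hr
          exact (h2 r hr.1).1
      · change (κ j t - κ j (t - a 0)) / a 0 = 0
        cases j with
        | zero => rw [(h2 t (by linarith)).1, (h2 _ le_rfl).1, sub_self, zero_div]
        | succ j => rw [(h2 t (by linarith)).2, (h2 _ le_rfl).2, sub_self, zero_div]

/-- There are cut-offs in time vanishing at `0`, equal to `1` at `S`, whose derivatives are bounded
by the numbers `B j`, and `∑ B j X ^ j / (j !)²` converges for every `X`. -/
structure IsCutoffBound (S : ℝ) (B : ℕ → ℝ) : Prop where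
  nonneg : ∀ j, 0 ≤ B j
  summable : ∀ X, 0 < X → Summable fun j => B j * X ^ j / (j.factorial : ℝ) ^ 2
  exists_cutoff : ∀ n : ℕ, ∃ κ : ℕ → ℝ → ℝ, (∀ j, Continuous (κ j)) ∧
    (∀ j < n, ∀ t, HasDerivAt (κ j) (κ (j + 1) t) t) ∧ (∀ j t, |κ j t| ≤ B j) ∧
    (∀ j, κ j 0 = 0) ∧ κ 0 S = 1 ∧ ∀ j, κ (j + 1) S = 0

/-- Averaging lengths proportional to (i+1)^(-3/2) are summable, so they can be scaled to total at
most S/2, and they give B j = (2/c)^j (j!)^(3/2), which (j!)² still beats. Any exponent strictly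
between 1 and 2 would do. B does not depend on the number n of derivatives, although the cut-off
does. -/
theorem exists_isCutoffBound {S : ℝ} (hS : 0 < S) : ∃ B, IsCutoffBound S B := by
  have hsum : Summable fun i : ℕ => 1 / ((i + 1 : ℕ) : ℝ) ^ (3 / 2 : ℝ) :=
    (summable_nat_add_iff 1).2 (Real.summable_one_div_nat_rpow.2 (by norm_num))
  set Z := ∑' i : ℕ, 1 / ((i + 1 : ℕ) : ℝ) ^ (3 / 2 : ℝ) with hZ
  have hterm : ∀ i : ℕ, 0 < 1 / ((i + 1 : ℕ) : ℝ) ^ (3 / 2 : ℝ) := fun i => by positivity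
  have hZ0 : 0 < Z := hsum.tsum_pos (fun i => (hterm i).le) 0 (hterm 0)
  set c := S / 2 / Z with hc
  have hc0 : 0 < c := by positivity
  set a : ℕ → ℝ := fun i => c * (1 / ((i + 1 : ℕ) : ℝ) ^ (3 / 2 : ℝ)) with ha
  have ha0 : ∀ i, 0 < a i := fun i => mul_pos hc0 (hterm i)
  have hB : ∀ j, 0 < ∏ i ∈ Finset.range j, 2 / a i := fun j =>
    Finset.prod_pos fun i _ => div_pos two_pos (ha0 i)
  refine ⟨fun j => ∏ i ∈ Finset.range j, 2 / a i, fun j => (hB j).le, fun X hX => ?_, fun n => ?_⟩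
  · refine summable_of_ratio_test_tendsto_lt_one zero_lt_one (Eventually.of_forall fun j => ?_) ?_ (l := 0)
    · have := hB j
      positivity
    · have h1 : Tendsto (fun j : ℕ => 2 * X / c * ((j + 1 : ℕ) : ℝ) ^ (-(1 / 2) : ℝ)) atTop
          (𝓝 0) := by
        have h2 := (tendsto_rpow_neg_atTop (y := 1 / 2) (by norm_num)).comp
          (tendsto_natCast_atTop_atTop (R := ℝ))
        simpa using ((tendsto_add_atTop_iff_nat 1).2 h2).const_mul (2 * X / c)
      refine h1.congr fun j => ?_
      have hBj := hB j
      have hBj1 := hB (j + 1)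
      rw [Real.norm_of_nonneg (by positivity), Real.norm_of_nonneg (by positivity)]
      have hj : (0 : ℝ) < ((j + 1 : ℕ) : ℝ) := by positivity
      have h3 : ((j + 1 : ℕ) : ℝ) ^ (-(1 / 2) : ℝ) =
          ((j + 1 : ℕ) : ℝ) ^ (3 / 2 : ℝ) / ((j + 1 : ℕ) : ℝ) ^ 2 := by
        rw [← Real.rpow_natCast, ← Real.rpow_sub hj]
        norm_num
      rw [h3, Finset.prod_range_succ, Nat.factorial_succ, pow_succ]
      set P := ∏ i ∈ Finset.range j, 2 / a i
      simp only [ha]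
      push_cast
      have h4 : (0 : ℝ) < ((j : ℝ) + 1) ^ (3 / 2 : ℝ) := by positivity
      field_simp
      ring
  · obtain ⟨κ, h1, h2, h3, h4, h5⟩ := exists_cutoff_of_averages n a ha0 (S / 2) (by positivity)
    have h6 : S / 2 + ∑ i ∈ Finset.range n, a i ≤ S := by
      rw [ha, ← Finset.mul_sum]
      have h7 := hsum.sum_le_tsum (Finset.range n) fun i _ => (hterm i).le
      have h8 : c * ∑ i ∈ Finset.range n, 1 / ((i + 1 : ℕ) : ℝ) ^ (3 / 2 : ℝ) ≤ c * Z := by gcongr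
      have h9 : c * Z = S / 2 := by rw [hc]; field_simp
      linarith
    exact ⟨κ, h1, h2, h3, fun j => h4 j 0 le_rfl, (h5 S h6).1, (h5 S h6).2⟩

/-- Bounds for the derivatives of the product of `e ^ (μ t)` and a function whose derivatives are
bounded by `B`. -/
noncomputable def leibnizBound (B : ℕ → ℝ) (μ : ℝ) (i : ℕ) : ℝ :=
  ∑ jm ∈ Finset.HasAntidiagonal.antidiagonal i, (i.choose jm.1 : ℝ) * (B jm.1 * μ ^ jm.2)

theorem leibnizBound_nonneg {B : ℕ → ℝ} (hB : ∀ j, 0 ≤ B j) {μ : ℝ} (hμ : 0 ≤ μ) (i : ℕ) :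
    0 ≤ leibnizBound B μ i :=
  Finset.sum_nonneg fun jm _ => by have := hB jm.1; positivity

/-- One factorial turns μ^m into e^(θμ), the other keeps an exponential series in X/θ. As θ is free,
the growth in μ can be made arbitrarily slow at the expense of e^(X/θ). -/
theorem summable_pow_div_factorial_sq {X μ θ : ℝ} (hX : 0 < X) (hμ : 0 ≤ μ) (hθ : 0 < θ) :
    (Summable fun m : ℕ => (μ * X) ^ m / (m.factorial : ℝ) ^ 2) ∧
      ∑' m : ℕ, (μ * X) ^ m / (m.factorial : ℝ) ^ 2 ≤ Real.exp (θ * μ) * Real.exp (X / θ) := by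
  have h1 : ∀ m : ℕ, (μ * X) ^ m / (m.factorial : ℝ) ^ 2 ≤
      Real.exp (θ * μ) * ((X / θ) ^ m / (m.factorial : ℝ)) := fun m => by
    have h2 := Real.pow_div_factorial_le_exp (θ * μ) (by positivity) m
    have h3 : (μ * X) ^ m / (m.factorial : ℝ) ^ 2 =
        (θ * μ) ^ m / (m.factorial : ℝ) * ((X / θ) ^ m / (m.factorial : ℝ)) := by
      have h4 : μ * X = (θ * μ) * (X / θ) := by field_simp
      rw [h4, mul_pow]; ring
    rw [h3]
    gcongr
  have h2 := (Real.summable_pow_div_factorial (X / θ)).mul_left (Real.exp (θ * μ))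
  have h3 := Summable.of_nonneg_of_le (fun m => by positivity) h1 h2
  refine ⟨h3, (h3.tsum_le_tsum h1 h2).trans_eq ?_⟩
  rw [tsum_mul_left, Real.exp_eq_exp_ℝ, NormedSpace.exp_eq_tsum_div]

theorem summable_antidiagonal {β γ : ℕ → ℝ} (h1 : Summable β) (h2 : Summable γ)
    (hβ : ∀ j, 0 ≤ β j) (hγ : ∀ j, 0 ≤ γ j) :
    (Summable fun i => ∑ jm ∈ Finset.HasAntidiagonal.antidiagonal i, β jm.1 * γ jm.2) ∧
      ∑' i, ∑ jm ∈ Finset.HasAntidiagonal.antidiagonal i, β jm.1 * γ jm.2 =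
        (∑' j, β j) * ∑' m, γ m := by
  have h3 : Summable fun x : ℕ × ℕ => β x.1 * γ x.2 := h1.mul_of_nonneg h2 hβ hγ
  exact ⟨summable_sum_mul_antidiagonal_of_summable_mul h3,
    (h1.tsum_mul_tsum_eq_tsum_sum_antidiagonal h2 h3).symm⟩

/-- Since C(j+m, j)/((j+m)!)² = 1/(C(j+m, j) (j!)² (m!)²), the Leibniz sums are dominated by a
Cauchy product of two convergent series. -/
theorem summable_leibnizBound {B : ℕ → ℝ} (hB : ∀ j, 0 ≤ B j) {X μ θ : ℝ} (hX : 0 < X)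
    (hμ : 0 ≤ μ) (hθ : 0 < θ) (hs : Summable fun j => B j * X ^ j / (j.factorial : ℝ) ^ 2) :
    (Summable fun i => leibnizBound B μ i * (X ^ i / (i.factorial : ℝ) ^ 2)) ∧
      ∑' i, leibnizBound B μ i * (X ^ i / (i.factorial : ℝ) ^ 2) ≤
        (∑' j, B j * X ^ j / (j.factorial : ℝ) ^ 2) *
          (Real.exp (θ * μ) * Real.exp (X / θ)) := by
  obtain ⟨h1, h2⟩ := summable_pow_div_factorial_sq hX hμ hθ
  have hβ : ∀ j : ℕ, 0 ≤ B j * X ^ j / (j.factorial : ℝ) ^ 2 := fun j => by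
    have := hB j; positivity
  have hγ : ∀ m : ℕ, 0 ≤ (μ * X) ^ m / (m.factorial : ℝ) ^ 2 := fun m => by positivity
  have h3 : ∀ i, leibnizBound B μ i * (X ^ i / (i.factorial : ℝ) ^ 2) ≤
      ∑ jm ∈ Finset.HasAntidiagonal.antidiagonal i, B jm.1 * X ^ jm.1 / (jm.1.factorial : ℝ) ^ 2 *
        ((μ * X) ^ jm.2 / (jm.2.factorial : ℝ) ^ 2) := fun i => by
    rw [leibnizBound, Finset.sum_mul]
    refine Finset.sum_le_sum fun jm hjm => ?_
    obtain ⟨j, m⟩ := jm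
    have hi : j + m = i := Finset.HasAntidiagonal.mem_antidiagonal.1 hjm
    subst hi
    simp only
    have h4 := Nat.add_choose_mul_factorial_mul_factorial j m
    have h5 : ((j + m).choose j : ℝ) * j.factorial * m.factorial = (j + m).factorial := by
      rw [Nat.choose_symm_add]
      exact_mod_cast h4
    have h6 : (1 : ℝ) ≤ (j + m).choose j := by
      exact_mod_cast Nat.choose_pos (Nat.le_add_right j m)
    have hBj := hB j
    rw [← h5, pow_add, mul_pow μ X m]
    have hj : (0 : ℝ) < j.factorial := by positivity
    have hm : (0 : ℝ) < m.factorial := by positivity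
    have h7 : ((j + m).choose j : ℝ) * (B j * μ ^ m) *
        (X ^ j * X ^ m / (((j + m).choose j : ℝ) * j.factorial * m.factorial) ^ 2) =
        B j * X ^ j / (j.factorial : ℝ) ^ 2 * (μ ^ m * X ^ m / (m.factorial : ℝ) ^ 2) /
          ((j + m).choose j : ℝ) := by
      field_simp
    rw [h7]
    exact div_le_self (by positivity) h6
  obtain ⟨h4, h6⟩ := summable_antidiagonal hs h1 hβ hγ
  have h5 := Summable.of_nonneg_of_le (fun i => mul_nonneg (leibnizBound_nonneg hB hμ i)
    (by positivity)) h3 h4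
  refine ⟨h5, (h5.tsum_le_tsum h3 h4).trans ?_⟩
  rw [h6]
  exact mul_le_mul_of_nonneg_left h2 (tsum_nonneg hβ)

/-- Leibniz' formula for `κ e ^ (μ (t - S))`, with alternating signs. -/
theorem exists_weights {S μ : ℝ} (hμ : 0 ≤ μ) {n : ℕ} {B : ℕ → ℝ} {κ : ℕ → ℝ → ℝ}
    (hc : ∀ j, Continuous (κ j)) (hd : ∀ j < n, ∀ t, HasDerivAt (κ j) (κ (j + 1) t) t)
    (hb : ∀ j t, |κ j t| ≤ B j) (h0 : ∀ j, κ j 0 = 0) (h1 : κ 0 S = 1)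
    (h2 : ∀ j, κ (j + 1) S = 0) :
    ∃ w : ℕ → ℝ → ℝ, (∀ i, Continuous (w i)) ∧
      (∀ i < n, ∀ t, HasDerivAt (w i) (-w (i + 1) t) t) ∧
      (∀ i t, |w i t| ≤ leibnizBound B μ i * Real.exp (μ * (t - S))) ∧
      (∀ i, w i 0 = 0) ∧ ∀ i, w i S = (-μ) ^ i := by
  -- At S only the term without derivatives of κ survives, and it gives (-μ)^i.
  refine ⟨fun i t => (-1) ^ i * ((∑ jm ∈ Finset.HasAntidiagonal.antidiagonal i,
    (i.choose jm.1 : ℝ) * (κ jm.1 t * μ ^ jm.2)) * Real.exp (μ * (t - S))), fun i => ?_,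
    fun i hi t => ?_, fun i t => ?_, fun i => ?_, fun i => ?_⟩
  · refine continuous_const.mul ((continuous_finsetSum _ fun jm _ => ?_).mul (by fun_prop))
    exact continuous_const.mul ((hc _).mul continuous_const)
  · have e1 : HasDerivAt (fun t => Real.exp (μ * (t - S))) (Real.exp (μ * (t - S)) * μ) t :=
      ((((hasDerivAt_id t).sub_const S).const_mul μ).exp).congr_deriv (by simp)
    have e2 : HasDerivAt (fun t => ∑ jm ∈ Finset.HasAntidiagonal.antidiagonal i,
        (i.choose jm.1 : ℝ) * (κ jm.1 t * μ ^ jm.2)) (∑ jm ∈ Finset.HasAntidiagonal.antidiagonal i,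
        (i.choose jm.1 : ℝ) * (κ (jm.1 + 1) t * μ ^ jm.2)) t := by
      refine HasDerivAt.fun_sum fun jm hjm => ?_
      have h3 := Finset.HasAntidiagonal.mem_antidiagonal.1 hjm
      exact ((hd jm.1 (by omega) t).mul_const _).const_mul _
    refine ((e2.fun_mul e1).const_mul ((-1) ^ i)).congr_deriv ?_
    beta_reduce
    rw [Finset.sum_antidiagonal_choose_succ_mul (fun j m => κ j t * μ ^ m) i]
    have e3 : ∑ ij ∈ Finset.HasAntidiagonal.antidiagonal i, (i.choose ij.1 : ℝ) * (κ ij.1 t * μ ^ (ij.2 + 1)) =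
        (∑ ij ∈ Finset.HasAntidiagonal.antidiagonal i, (i.choose ij.1 : ℝ) * (κ ij.1 t * μ ^ ij.2)) * μ := by
      rw [Finset.sum_mul]
      exact Finset.sum_congr rfl fun ij _ => by ring
    have e4 : ∑ ij ∈ Finset.HasAntidiagonal.antidiagonal i, (i.choose ij.2 : ℝ) * (κ (ij.1 + 1) t * μ ^ ij.2) =
        ∑ ij ∈ Finset.HasAntidiagonal.antidiagonal i, (i.choose ij.1 : ℝ) * (κ (ij.1 + 1) t * μ ^ ij.2) := by
      refine Finset.sum_congr rfl fun ij hij => ?_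
      rw [Nat.choose_symm_of_eq_add (Finset.HasAntidiagonal.mem_antidiagonal.1 hij).symm]
    rw [e3, e4]
    ring
  · rw [abs_mul, abs_pow, abs_neg, abs_one, one_pow, one_mul, abs_mul, Real.abs_exp]
    refine mul_le_mul_of_nonneg_right ?_ (Real.exp_pos _).le
    refine (Finset.abs_sum_le_sum_abs _ _).trans (Finset.sum_le_sum fun jm _ => ?_)
    rw [abs_mul, abs_mul, abs_of_nonneg (pow_nonneg hμ _), Nat.abs_cast]
    have := hb jm.1 t
    gcongr
  · simp [h0]
  · beta_reduce
    rw [Finset.sum_eq_single (0, i)]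
    · simp [h1, neg_pow μ]
    · rintro ⟨j, m⟩ hjm hne
      cases j with
      | zero => exact absurd (by rw [← Finset.HasAntidiagonal.mem_antidiagonal.1 hjm, zero_add]) hne
      | succ j => simp [h2]
    · simp

end TimeCutoff

/-! ### Duality between the evolution and chains of vectors. -/

section Duality

variable {L ν ξ T : ℝ} {f₀ : L2Interval L} {f : ℝ → L2Interval L}

theorem IsGrushinSolution.continuousOn_inner (hf : IsGrushinSolution L ν ξ T f₀ f)
    (v : L2Interval L) : ContinuousOn (fun t => inner ℝ (f t) v) (Icc 0 T) :=
  hf.continuousOn.inner continuousOn_const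

/-- The weak formulation holds at every interior time. -/
theorem IsGrushinSolution.hasDerivAt_inner (hf : IsGrushinSolution L ν ξ T f₀ f)
    {g h : L2Interval L} (hg : IsGrushinImage L ν ξ g h) {t : ℝ} (ht : t ∈ Ioo 0 T) :
    HasDerivAt (fun s => inner ℝ (f s) g) (-(inner ℝ (f t) h)) t := by
  obtain ⟨hac, hae⟩ := hf.weak g h hg
  have hT : 0 < T := ht.1.trans ht.2
  have hk : ContinuousOn (fun s => -(inner ℝ (f s) h : ℝ)) (Icc 0 T) :=
    (hf.continuousOn_inner h).neg
  -- Absolute continuity recovers the pairing from its almost everywhere derivative. That derivative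
  -- agrees with a continuous function, so the pairing is C¹ inside the interval.
  have h1 : ∀ s ∈ Ioo 0 T, (inner ℝ (f s) g : ℝ) =
      inner ℝ (f 0) g + ∫ r in (0 : ℝ)..s, -(inner ℝ (f r) h : ℝ) := by
    intro s hs
    have h2 := (hac.mono (c := 0) (d := s) (by
      rw [uIcc_of_le hs.1.le, uIcc_of_le hT.le]
      exact Icc_subset_Icc_right hs.2.le)).integral_deriv_eq_sub
    rw [← sub_eq_iff_eq_add', ← h2]
    refine intervalIntegral.integral_congr_ae ?_
    rw [ae_restrict_iff' measurableSet_Ioo] at hae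
    filter_upwards [hae] with r hr hrs
    rw [uIoc_of_le hs.1.le] at hrs
    exact (hr ⟨hrs.1, hrs.2.trans_lt hs.2⟩).deriv
  have h2 : HasDerivAt (fun s => ∫ r in (0 : ℝ)..s, -(inner ℝ (f r) h : ℝ))
      (-(inner ℝ (f t) h)) t := by
    refine intervalIntegral.integral_hasDerivAt_right ?_ ?_ ?_
    · refine ContinuousOn.intervalIntegrable_of_Icc ht.1.le (hk.mono ?_)
      exact Icc_subset_Icc_right ht.2.le
    · exact (hk.mono Ioo_subset_Icc_self).stronglyMeasurableAtFilter isOpen_Ioo t ht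
    · exact hk.continuousAt (Icc_mem_nhds ht.1 ht.2)
  refine HasDerivAt.congr_of_eventuallyEq (h2.const_add (inner ℝ (f 0) g : ℝ)) ?_
  filter_upwards [isOpen_Ioo.mem_nhds ht] with s hs using h1 s hs

/-- Eigenvectors decay exponentially along the evolution. -/
theorem IsGrushinSolution.inner_eigenvector (hf : IsGrushinSolution L ν ξ T f₀ f) {lam : ℝ}
    {g : L2Interval L} (hg : IsGrushinImage L ν ξ g (lam • g)) {s t : ℝ} (hs : 0 ≤ s) (hst : s ≤ t)
    (ht : t ≤ T) : inner ℝ (f t) g = Real.exp (-lam * (t - s)) * inner ℝ (f s) g := by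
  rcases hst.eq_or_lt with rfl | hst
  · simp
  have hc : ContinuousOn (fun r => Real.exp (lam * (r - s)) * (inner ℝ (f r) g : ℝ)) (Icc s t) :=
    (by fun_prop : Continuous fun r => Real.exp (lam * (r - s))).continuousOn.mul
      ((hf.continuousOn_inner g).mono (Icc_subset_Icc hs ht))
  have hd : ∀ r ∈ Ioo s t, HasDerivAt (fun r => Real.exp (lam * (r - s)) * (inner ℝ (f r) g : ℝ))
      0 r := by
    intro r hr
    have e1 : HasDerivAt (fun r => Real.exp (lam * (r - s))) (Real.exp (lam * (r - s)) * lam) r :=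
      ((((hasDerivAt_id r).sub_const s).const_mul lam).exp).congr_deriv (by simp)
    refine (e1.fun_mul (hf.hasDerivAt_inner hg ⟨hs.trans_lt hr.1, hr.2.trans_le ht⟩)).congr_deriv ?_
    rw [real_inner_smul_right]
    ring
  obtain ⟨r, -, hr⟩ := exists_hasDerivAt_eq_slope _ (fun _ => 0) hst hc hd
  rw [eq_comm, div_eq_zero_iff] at hr
  have h1 := hr.resolve_right (sub_pos.2 hst).ne'
  rw [sub_self, mul_zero, Real.exp_zero, one_mul, sub_eq_zero] at h1
  rw [← h1, ← mul_assoc, ← Real.exp_add]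
  simp

/-- Duality with a chain `G v (i + 1) = -v i - lam v (i + 1) - k i`. -/
theorem IsGrushinSolution.abs_inner_le (hf : IsGrushinSolution L ν ξ T f₀ f) {S lam μ θ X A D : ℝ}
    {B : ℕ → ℝ} (hB : IsCutoffBound S B) (hS : 0 < S) (hST : S < T) (hμ : 0 ≤ μ) (hlam : lam ≤ μ)
    (hθ : 0 < θ) (hX : 0 < X) (hD : 0 ≤ D) {v k : ℕ → L2Interval L} {φ : L2Interval L} {q : ℝ → ℝ}
    (hv0 : v 0 = 0)
    (hv : ∀ i, IsGrushinImage L ν ξ (v (i + 1)) (-k i - lam • v (i + 1) - v i))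
    (hA : ∀ i, ‖v (i + 1)‖ ≤ A * (X ^ i / (i.factorial : ℝ) ^ 2))
    (hq : ContinuousOn q (Icc 0 S)) (hq0 : ∀ t ∈ Icc 0 S, 0 ≤ q t)
    (hk : ∀ i, ∀ t ∈ Icc 0 S,
      |inner ℝ (f t) (k i)| ≤ D * (X ^ i / (i.factorial : ℝ) ^ 2) * q t)
    (hφ : Tendsto (fun n => ∑ i ∈ Finset.range n, (-μ) ^ i * inner ℝ (f S) (v (i + 1))) atTop
      (𝓝 (inner ℝ (f S) φ))) :
    |inner ℝ (f S) φ| ≤ D * ((∑' j, B j * X ^ j / (j.factorial : ℝ) ^ 2) *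
      (Real.exp (θ * μ) * Real.exp (X / θ))) * ∫ t in (0 : ℝ)..S, q t := by
  obtain ⟨hs, hs'⟩ := summable_leibnizBound hB.nonneg hX hμ hθ (hB.summable X hX)
  -- Used for the remainder only: M (n + 1) is paired with (n!)⁻² instead of ((n+1)!)⁻², and the
  -- missing (n+1)² is at most 4^(n+1).
  obtain ⟨hs4, -⟩ := summable_leibnizBound hB.nonneg (by positivity : 0 < 4 * X) hμ hθ
    (hB.summable (4 * X) (by positivity))
  set M := leibnizBound B μ with hM
  have hM0 : ∀ i, 0 ≤ M i := leibnizBound_nonneg hB.nonneg hμ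
  set G := ∑' i, M i * (X ^ i / (i.factorial : ℝ) ^ 2) with hG
  obtain ⟨E, hE⟩ := isCompact_Icc.exists_bound_of_continuousOn
    (hf.continuousOn.mono (Icc_subset_Icc_right hST.le))
  have hE0 : 0 ≤ E := (norm_nonneg _).trans (hE S ⟨hS.le, le_rfl⟩)
  have hA0 : 0 ≤ A := by
    have h1 := (norm_nonneg _).trans (hA 0)
    simpa using h1
  have hqi : IntervalIntegrable q volume 0 S := hq.intervalIntegrable_of_Icc hS.le
  have hqI : 0 ≤ ∫ t in (0 : ℝ)..S, q t :=
    intervalIntegral.integral_nonneg hS.le hq0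
  have main : ∀ n : ℕ, |∑ i ∈ Finset.range (n + 1), (-μ) ^ i * (inner ℝ (f S) (v (i + 1)) : ℝ)| ≤
      D * G * (∫ t in (0 : ℝ)..S, q t) +
        S * (M (n + 1) * (A * (X ^ n / (n.factorial : ℝ) ^ 2)) * E) := by
    intro n
    obtain ⟨κ, c1, c2, c3, c4, c5, c6⟩ := hB.exists_cutoff (n + 1)
    obtain ⟨w, w1, w2, w3, w4, w5⟩ := exists_weights (μ := μ) hμ c1 c2 c3 c4 c5 c6
    set F : ℕ → ℝ → ℝ := fun i t => inner ℝ (f t) (v i) with hF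
    set K : ℕ → ℝ → ℝ := fun i t => inner ℝ (f t) (k i) with hK
    set e : ℝ → ℝ := fun t => Real.exp (lam * (S - t)) with he
    have hec : Continuous e := by fun_prop
    have hFc : ∀ i, ContinuousOn (F i) (Icc 0 S) := fun i =>
      (hf.continuousOn_inner _).mono (Icc_subset_Icc_right hST.le)
    have hKc : ∀ i, ContinuousOn (K i) (Icc 0 S) := fun i =>
      (hf.continuousOn_inner _).mono (Icc_subset_Icc_right hST.le)
    have hF0 : ∀ t, F 0 t = 0 := fun t => by simp only [hF, hv0, inner_zero_right]
    -- Φ vanishes at 0 and is the wanted partial sum at S. Because w_i' = -w_{i+1} and the image of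
    -- v_{i+1} contains -v_i, its derivative telescopes to the terms with k_i and a single last term
    -- of index n + 1.
    set Φ : ℝ → ℝ := fun t => (∑ i ∈ Finset.range (n + 1), w i t * F (i + 1) t) * e t with hΦ
    set Ψ : ℝ → ℝ := fun t => ((∑ i ∈ Finset.range (n + 1), w i t * K i t) -
      w (n + 1) t * F (n + 1) t) * e t with hΨ
    have hΦc : ContinuousOn Φ (Icc 0 S) :=
      (continuousOn_finsetSum _ fun i _ => (w1 i).continuousOn.mul (hFc _)).mul hec.continuousOn
    have hΨc : ContinuousOn Ψ (Icc 0 S) :=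
      ((continuousOn_finsetSum _ fun i _ => (w1 i).continuousOn.mul (hKc _)).sub
        ((w1 _).continuousOn.mul (hFc _))).mul hec.continuousOn
    have hd : ∀ t ∈ Ioo 0 S, HasDerivAt Φ (Ψ t) t := by
      intro t ht
      have d1 : HasDerivAt e (-lam * e t) t :=
        ((((hasDerivAt_id t).const_sub S).const_mul lam).exp).congr_deriv (by simp [he]; ring)
      have d2 : ∀ i, HasDerivAt (F (i + 1)) (K i t + lam * F (i + 1) t + F i t) t := fun i =>
        (hf.hasDerivAt_inner (hv i) ⟨ht.1, ht.2.trans hST⟩).congr_deriv (by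
          rw [inner_sub_right, inner_sub_right, inner_neg_right, real_inner_smul_right]; ring)
      have d3 : HasDerivAt (fun t => ∑ i ∈ Finset.range (n + 1), w i t * F (i + 1) t)
          (∑ i ∈ Finset.range (n + 1), (-w (i + 1) t * F (i + 1) t +
            w i t * (K i t + lam * F (i + 1) t + F i t))) t :=
        HasDerivAt.fun_sum fun i hi => (w2 i (Finset.mem_range.1 hi) t).fun_mul (d2 i)
      refine (d3.fun_mul d1).congr_deriv ?_
      have d4 := Finset.sum_range_sub' (fun i => w i t * F i t) (n + 1)
      rw [hF0, mul_zero, zero_sub] at d4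
      have d5 : ∑ i ∈ Finset.range (n + 1), (-w (i + 1) t * F (i + 1) t +
            w i t * (K i t + lam * F (i + 1) t + F i t)) =
          ∑ i ∈ Finset.range (n + 1), w i t * K i t +
          lam * ∑ i ∈ Finset.range (n + 1), w i t * F (i + 1) t +
          ∑ i ∈ Finset.range (n + 1), (w i t * F i t - w (i + 1) t * F (i + 1) t) := by
        rw [Finset.mul_sum, ← Finset.sum_add_distrib, ← Finset.sum_add_distrib]
        exact Finset.sum_congr rfl fun i _ => by ring
      rw [d5, d4, hΨ]
      ring
    have hint := intervalIntegral.integral_eq_sub_of_hasDerivAt_of_le hS.le hΦc hd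
      (hΨc.intervalIntegrable_of_Icc hS.le)
    have hΦ0 : Φ 0 = 0 := by simp [hΦ, w4]
    have hΦS : Φ S = ∑ i ∈ Finset.range (n + 1), (-μ) ^ i * F (i + 1) S := by
      simp [hΦ, he, w5]
    rw [hΦ0, sub_zero, hΦS] at hint
    rw [← hint, ← Real.norm_eq_abs]
    set R := M (n + 1) * (A * (X ^ n / (n.factorial : ℝ) ^ 2)) * E with hR
    refine (intervalIntegral.norm_integral_le_of_norm_le hS.le (g := fun t => D * G * q t + R)
      (Eventually.of_forall fun t ht => ?_) ((hqi.const_mul _).add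
        intervalIntegrable_const)).trans_eq ?_
    · have ht' : t ∈ Icc 0 S := ⟨ht.1.le, ht.2⟩
      -- The factor e^(lam (S - t)) is compensated by the e^(μ(t - S)) carried by the weights, since
      -- lam ≤ μ.
      have e1 : Real.exp (μ * (t - S)) * e t ≤ 1 := by
        rw [he, ← Real.exp_add, Real.exp_le_one_iff]
        nlinarith [ht.2]
      have e2 : ∀ i, |w i t| * e t ≤ M i := fun i => by
        refine (mul_le_mul_of_nonneg_right (w3 i t) (Real.exp_pos _).le).trans ?_
        rw [mul_assoc]
        exact mul_le_of_le_one_right (hM0 i) e1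
      have het : 0 < e t := Real.exp_pos _
      have hqt := hq0 t ht'
      have e3 : ∑ i ∈ Finset.range (n + 1), |w i t| * e t * |K i t| ≤ D * G * q t := by
        calc ∑ i ∈ Finset.range (n + 1), |w i t| * e t * |K i t|
            ≤ ∑ i ∈ Finset.range (n + 1), D * q t * (M i * (X ^ i / (i.factorial : ℝ) ^ 2)) := by
              refine Finset.sum_le_sum fun i _ => ?_
              refine (mul_le_mul (e2 i) (hk i t ht') (abs_nonneg _) (hM0 i)).trans_eq ?_
              ring
          _ ≤ D * q t * G := by
              rw [← Finset.mul_sum]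
              refine mul_le_mul_of_nonneg_left ?_ (by positivity)
              exact hs.sum_le_tsum _ fun i _ => mul_nonneg (hM0 i) (by positivity)
          _ = D * G * q t := by ring
      have e4 : |w (n + 1) t| * e t * |F (n + 1) t| ≤ R := by
        rw [hR, mul_assoc (M (n + 1))]
        refine mul_le_mul (e2 _) ?_ (abs_nonneg _) (hM0 _)
        refine (abs_real_inner_le_norm _ _).trans ?_
        rw [mul_comm]
        exact mul_le_mul (hA n) (hE t ht') (norm_nonneg _) (by positivity)
      calc ‖Ψ t‖ = |(∑ i ∈ Finset.range (n + 1), w i t * K i t) - w (n + 1) t * F (n + 1) t| *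
            e t := by rw [hΨ, Real.norm_eq_abs, abs_mul, abs_of_pos het]
        _ ≤ ((∑ i ∈ Finset.range (n + 1), |w i t| * |K i t|) +
            |w (n + 1) t| * |F (n + 1) t|) * e t := by
            refine mul_le_mul_of_nonneg_right ((abs_sub _ _).trans (add_le_add ?_ ?_)) het.le
            · refine (Finset.abs_sum_le_sum_abs _ _).trans_eq ?_
              exact Finset.sum_congr rfl fun i _ => abs_mul _ _
            · exact (abs_mul _ _).le
        _ = (∑ i ∈ Finset.range (n + 1), |w i t| * e t * |K i t|) +
            |w (n + 1) t| * e t * |F (n + 1) t| := by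
            rw [add_mul, Finset.sum_mul]
            congr 1
            · exact Finset.sum_congr rfl fun i _ => by ring
            · ring
        _ ≤ D * G * q t + R := add_le_add e3 e4
    · rw [intervalIntegral.integral_add (hqi.const_mul _) intervalIntegrable_const,
        intervalIntegral.integral_const_mul, intervalIntegral.integral_const, sub_zero, smul_eq_mul]
  have hrem : Tendsto (fun n : ℕ => S * (M (n + 1) * (A * (X ^ n / (n.factorial : ℝ) ^ 2)) * E))
      atTop (𝓝 0) := by
    have h1 := (tendsto_add_atTop_iff_nat 1).2 hs4.tendsto_atTop_zero
    have h2 := h1.const_mul (S * A * E / X)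
    rw [mul_zero] at h2
    refine squeeze_zero (fun n => ?_) (fun n => ?_) h2
    · have := hM0 (n + 1)
      positivity
    · have hMn := hM0 (n + 1)
      have h3 : ((n + 1 : ℕ) : ℝ) ^ 2 ≤ 4 ^ (n + 1) := by
        have h4 : (n + 1) ≤ 2 ^ (n + 1) := Nat.lt_two_pow_self.le
        have h5 : ((n + 1 : ℕ) : ℝ) ≤ 2 ^ (n + 1) := by exact_mod_cast h4
        calc ((n + 1 : ℕ) : ℝ) ^ 2 ≤ (2 ^ (n + 1)) ^ 2 := by gcongr
          _ = 4 ^ (n + 1) := by rw [← pow_mul, mul_comm, pow_mul]; norm_num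
      have h6 : (0 : ℝ) < ((n + 1 : ℕ) : ℝ) := by positivity
      have h7 : S * (M (n + 1) * (A * (X ^ n / (n.factorial : ℝ) ^ 2)) * E) =
          S * A * E / X * (M (n + 1) * (((n + 1 : ℕ) : ℝ) ^ 2 * X ^ (n + 1) /
            ((n + 1).factorial : ℝ) ^ 2)) := by
        rw [Nat.factorial_succ, Nat.cast_mul, pow_succ X n]
        have h8 : (0 : ℝ) < n.factorial := by positivity
        field_simp
      rw [h7, mul_pow 4 X]
      gcongr
  have h1 := le_of_tendsto_of_tendsto ((tendsto_add_atTop_iff_nat 1).2 hφ).abs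
    (tendsto_const_nhds.add hrem) (Eventually.of_forall main)
  rw [add_zero] at h1
  refine h1.trans (mul_le_mul_of_nonneg_right (mul_le_mul_of_nonneg_left hs' hD) hqI)

end Duality

/-! ### Cut-offs in space and localisation to (a, b). -/

section Cutoff

variable {L : ℝ}

theorem norm_le_of_ae_abs_le (hL : 0 ≤ L) {v : L2Interval L} {C : ℝ} (hC : 0 ≤ C)
    (h : ∀ᵐ x ∂(intervalMeasure L), |v x| ≤ C) : ‖v‖ ≤ C * Real.sqrt L := by
  refine le_of_sq_le_sq ?_ (by positivity)
  rw [norm_sq_eq_integral, mul_pow, Real.sq_sqrt hL]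
  have h1 : ∫ x in Ioo 0 L, v x ^ 2 ≤ ∫ _ in Ioo 0 L, C ^ 2 := by
    refine integral_mono_ae (Lp.memLp v).integrable_sq (by simp) ?_
    filter_upwards [h] with x hx
    rw [← sq_abs]
    exact pow_le_pow_left₀ (abs_nonneg _) hx 2
  simpa [hL, mul_comm] using h1

/-- The norm of the restriction to `(a, b)`. -/
noncomputable def restrictNorm (a b : ℝ) (v : L2Interval L) : ℝ :=
  ‖LpToLpRestrictCLM ℝ ℝ ℝ (intervalMeasure L) 2 (Ioo a b) v‖

theorem restrictNorm_nonneg (a b : ℝ) (v : L2Interval L) : 0 ≤ restrictNorm a b v := norm_nonneg _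

theorem continuous_restrictNorm (a b : ℝ) :
    Continuous (restrictNorm a b : L2Interval L → ℝ) :=
  (ContinuousLinearMap.continuous _).norm

theorem restrictNorm_sq {a b : ℝ} (ha : 0 ≤ a) (hb : b ≤ L) (v : L2Interval L) :
    restrictNorm a b v ^ 2 = ∫ x in Ioo a b, |v x| ^ 2 := by
  have hs : (intervalMeasure L).restrict (Ioo a b) = volume.restrict (Ioo a b) := by
    rw [Measure.restrict_restrict measurableSet_Ioo,
      inter_eq_left.2 (Ioo_subset_Ioo ha hb)]
  rw [restrictNorm, ← real_inner_self_eq_norm_sq, L2.inner_def, ← hs]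
  refine integral_congr_ae ?_
  filter_upwards [LpToLpRestrictCLM_coeFn (F := ℝ) (p := 2) ℝ (Ioo a b) v] with x hx
  rw [hx, real_inner_self_eq_norm_sq, Real.norm_eq_abs]

theorem abs_inner_le_restrictNorm {a b : ℝ} {v k : L2Interval L}
    (hk : ∀ᵐ x ∂(intervalMeasure L), x ∉ Ioo a b → k x = 0) :
    |inner ℝ v k| ≤ restrictNorm a b v * ‖k‖ := by
  set R := LpToLpRestrictCLM ℝ ℝ ℝ (intervalMeasure L) 2 (Ioo a b) with hR
  have h1 : (inner ℝ v k : ℝ) = inner ℝ (R v) (R k) := by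
    rw [inner_eq_integral, L2.inner_def]
    have h2 : ∫ x, inner ℝ (R v x) (R k x) ∂((intervalMeasure L).restrict (Ioo a b)) =
        ∫ x, v x * k x ∂((intervalMeasure L).restrict (Ioo a b)) := by
      refine integral_congr_ae ?_
      filter_upwards [LpToLpRestrictCLM_coeFn (F := ℝ) (p := 2) ℝ (Ioo a b) v,
        LpToLpRestrictCLM_coeFn (F := ℝ) (p := 2) ℝ (Ioo a b) k] with x hx hx'
      rw [hx, hx']
      simp [mul_comm]
    rw [h2]
    refine (setIntegral_eq_integral_of_ae_compl_eq_zero ?_).symm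
    filter_upwards [hk] with x hx hx'
    rw [hx hx', mul_zero]
  rw [h1]
  refine (abs_real_inner_le_norm _ _).trans (mul_le_mul_of_nonneg_left ?_ (norm_nonneg _))
  exact norm_Lp_toLp_restrict_le _ k

/-- A smooth transition from `1` to `0` on `[a, b]`, with its first two derivatives. -/
theorem exists_transition {a b : ℝ} (hab : a < b) :
    ∃ (χ χ₁ χ₂ : ℝ → ℝ) (D : ℝ), 1 ≤ D ∧ (∀ x, HasDerivAt χ (χ₁ x) x) ∧
      (∀ x, HasDerivAt χ₁ (χ₂ x) x) ∧ Continuous χ₂ ∧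
      (∀ x, |χ x| ≤ D ∧ |1 - χ x| ≤ D ∧ |χ₁ x| ≤ D ∧ |χ₂ x| ≤ D) ∧
      (∀ x, x ∉ Icc a b → χ₁ x = 0 ∧ χ₂ x = 0) ∧ (∀ x < a, χ x = 1) ∧ ∀ x, b < x → χ x = 0 := by
  set χ : ℝ → ℝ := fun x => Real.smoothTransition ((b - x) / (b - a)) with hχ
  have hsm : ContDiff ℝ ∞ χ := Real.smoothTransition.contDiff.comp (by fun_prop)
  have hba : 0 < b - a := sub_pos.2 hab
  have hsm1 : ContDiff ℝ ∞ (deriv χ) := (contDiff_infty_iff_deriv.1 hsm).2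
  have hsm2 : ContDiff ℝ ∞ (deriv (deriv χ)) := (contDiff_infty_iff_deriv.1 hsm1).2
  have h1 : ∀ x < a, χ x = 1 := fun x hx =>
    Real.smoothTransition.one_of_one_le ((one_le_div hba).2 (by linarith))
  have h0 : ∀ x, b < x → χ x = 0 := fun x hx =>
    Real.smoothTransition.zero_of_nonpos (div_nonpos_of_nonpos_of_nonneg (by linarith) hba.le)
  have hzero : ∀ (g : ℝ → ℝ) (c d : ℝ), (∀ x < a, g x = c) → (∀ x, b < x → g x = d) →
      ∀ x, x ∉ Icc a b → deriv g x = 0 := by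
    intro g c d hc hd x hx
    rcases lt_or_ge x a with h | h
    · have h2 : g =ᶠ[𝓝 x] fun _ => c := by
        filter_upwards [gt_mem_nhds h] with y hy using hc y hy
      rw [h2.deriv_eq, deriv_const]
    · have h3 : b < x := by by_contra h4; exact hx ⟨h, not_lt.1 h4⟩
      have h2 : g =ᶠ[𝓝 x] fun _ => d := by
        filter_upwards [lt_mem_nhds h3] with y hy using hd y hy
      rw [h2.deriv_eq, deriv_const]
  have hz1 := hzero χ 1 0 h1 h0
  have hz2 := hzero (deriv χ) 0 0 (fun x hx => hz1 x fun h => absurd h.1 (not_le.2 hx))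
    fun x hx => hz1 x fun h => absurd h.2 (not_le.2 hx)
  obtain ⟨D₁, hD₁⟩ := isCompact_Icc.exists_bound_of_continuousOn
    (hsm1.continuous.continuousOn (s := Icc a b))
  obtain ⟨D₂, hD₂⟩ := isCompact_Icc.exists_bound_of_continuousOn
    (hsm2.continuous.continuousOn (s := Icc a b))
  refine ⟨χ, deriv χ, deriv (deriv χ), max 1 (max D₁ D₂), le_max_left _ _,
    fun x => ((hsm.differentiable (by simp)) x).hasDerivAt,
    fun x => ((hsm1.differentiable (by simp)) x).hasDerivAt, hsm2.continuous, fun x => ?_,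
    fun x hx => ⟨hz1 x hx, hz2 x hx⟩, h1, h0⟩
  have e0 := Real.smoothTransition.nonneg ((b - x) / (b - a))
  have e1 := Real.smoothTransition.le_one ((b - x) / (b - a))
  have hm : (0 : ℝ) ≤ max 1 (max D₁ D₂) := zero_le_one.trans (le_max_left _ _)
  refine ⟨?_, ?_, ?_, ?_⟩
  · exact (abs_le.2 ⟨by linarith, e1⟩).trans (le_max_left _ _)
  · refine (abs_le.2 ⟨?_, ?_⟩).trans (le_max_left _ _) <;> simp only [hχ] <;> linarith
  · by_cases hx : x ∈ Icc a b
    · exact (hD₁ x hx).trans ((le_max_left _ _).trans (le_max_right _ _))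
    · rw [hz1 x hx, abs_zero]; exact hm
  · by_cases hx : x ∈ Icc a b
    · exact (hD₂ x hx).trans ((le_max_right _ _).trans (le_max_right _ _))
    · rw [hz2 x hx, abs_zero]; exact hm

variable {ν ξ T : ℝ} {f₀ : L2Interval L} {f : ℝ → L2Interval L}

/-- The contribution of one side of a cut-off to the duality estimate. -/
theorem IsGrushinSolution.abs_inner_cutoff_le (hf : IsGrushinSolution L ν ξ T f₀ f)
    {S μ θ X : ℝ} {B : ℕ → ℝ} (hB : IsCutoffBound S B) (hS : 0 < S) (hST : S < T) (hμ : 0 ≤ μ)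
    (hlam : 2 * ξ * (ν + 1) ≤ μ) (hθ : 0 < θ) (hX : 0 < X) (hν : 0 < ν) (hξ : 0 ≤ ξ)
    {a b a₁ a₂ : ℝ} (ha : 0 < a) (haa : a < a₁) (ha₁₂ : a₁ ≤ a₂) (hab : a₂ < b) (hbL : b ≤ L)
    {χ χ₁ χ₂ : ℝ → ℝ} {D : ℝ} (hχ : ∀ x, HasDerivAt χ (χ₁ x) x)
    (hχ₁ : ∀ x, HasDerivAt χ₁ (χ₂ x) x) (hχ₂ : Continuous χ₂)
    (hD : ∀ x, |χ x| ≤ D ∧ |χ₁ x| ≤ D ∧ |χ₂ x| ≤ D)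
    (hχ0 : ∀ x, x ∉ Icc a₁ a₂ → χ₁ x = 0 ∧ χ₂ x = 0) {U : Set ℝ} (hU : ∀ x ∉ U, χ x = 0)
    (hIU : Icc a₁ a₂ ⊆ U) {ψ p : ℕ → ℝ → ℝ}
    (hψ : ∀ i, ∀ x ∈ Ioo 0 L, HasDerivAt (ψ i) (p i x / growth ν ξ x ^ 2) x)
    (hp0 : ∀ x ∈ Ioo 0 L, HasDerivAt (p 0) 0 x)
    (hp : ∀ i, ∀ x ∈ Ioo 0 L, HasDerivAt (p (i + 1)) (growth ν ξ x ^ 2 * ψ i x) x) {C : ℝ}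
    (hC : ∀ i, ∀ x ∈ Ioo 0 L, x ∈ U → |ψ i x| ≤ C * (X ^ i / (i.factorial : ℝ) ^ 2) ∧
      |p i x| ≤ C * (X ^ i / (i.factorial : ℝ) ^ 2) * growth ν ξ x ^ 2) {K : ℝ} (hK0 : 0 ≤ K)
    (hK : ∀ i, ∀ x ∈ Icc a₁ a₂, growth ν ξ x * |ψ i x| ≤ K * (X ^ i / (i.factorial : ℝ) ^ 2) ∧
      |p i x| / growth ν ξ x ≤ K * (X ^ i / (i.factorial : ℝ) ^ 2))
    (hend : ∀ i, Tendsto (fun x => χ x * ψ i x) (𝓝[<] L) (𝓝 0)) {η : ℝ → ℝ} {C' : ℝ}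
    (hη : ∀ N : ℕ, ∀ x ∈ Ioo 0 L, x ∈ U →
      |η x - ∑ i ∈ Finset.range N, (-μ) ^ i * ψ i x| ≤
        C' * ((μ * X) ^ N / (N.factorial : ℝ) ^ 2)) {φ : L2Interval L}
    (hφ : φ =ᵐ[intervalMeasure L] fun x => χ x * (growth ν ξ x * η x)) :
    |inner ℝ (f S) φ| ≤ D * (3 + 2 * ((ν + 1 / 2) / a₁ + ξ * a₂)) * K * Real.sqrt L *
      ((∑' j, B j * X ^ j / (j.factorial : ℝ) ^ 2) * (Real.exp (θ * μ) * Real.exp (X / θ))) *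
        ∫ t in (0 : ℝ)..S, restrictNorm a b (f t) := by
  have ha₁ : 0 < a₁ := ha.trans haa
  have ha₂L : a₂ < L := hab.trans_le hbL
  have hL : 0 < L := ha₁.trans_le (ha₁₂.trans ha₂L.le)
  have hIoo : Icc a₁ a₂ ⊆ Ioo 0 L := fun x hx => ⟨ha₁.trans_le hx.1, hx.2.trans_lt ha₂L⟩
  have hD0 : 0 ≤ D := (abs_nonneg _).trans (hD 0).1
  have ha₁U : a₁ ∈ U := hIU ⟨le_rfl, ha₁₂⟩
  have ha₁I : a₁ ∈ Ioo 0 L := hIoo ⟨le_rfl, ha₁₂⟩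
  have hC0 : 0 ≤ C := by
    have h1 := (abs_nonneg _).trans (hC 0 a₁ ha₁I ha₁U).1
    simpa using h1
  have hC'0 : 0 ≤ C' := by
    have h1 := (abs_nonneg _).trans (hη 0 a₁ ha₁I ha₁U)
    simpa using h1
  set E := growth ν ξ with hE
  have hE0 : ∀ x, 0 ≤ E x := growth_nonneg
  have hEL : ∀ x ∈ Ioo 0 L, E x ≤ E L := fun x hx => growth_mono hν hξ hx.1.le hx.2.le
  set Z : ℕ → ℝ := fun i => X ^ i / (i.factorial : ℝ) ^ 2 with hZ
  have hZ0 : ∀ i, 0 ≤ Z i := fun i => by positivity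
  -- Size of k_i = χ₂ Eψ_i + 2χ₁ (Eψ_i)' on the transition zone: 1 from the first term, 2 from the
  -- part p_i/E of (Eψ_i)', and 2 growthRate, bounded on [a₁, a₂], from the rest.
  set M := 3 + 2 * ((ν + 1 / 2) / a₁ + ξ * a₂) with hM
  have hM0 : 0 ≤ M := by have := ha₁.trans_le ha₁₂; positivity
  set uF : ℕ → ℝ → ℝ := fun i x => χ x * (E x * ψ i x) with huF
  set kF : ℕ → ℝ → ℝ := fun i x => χ₂ x * (E x * ψ i x) +
    2 * (χ₁ x * (growthRate ν ξ x * E x * ψ i x + p i x / E x)) with hkF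
  have hU' : ∀ x ∉ U, χ x = 0 ∧ χ₁ x = 0 ∧ χ₂ x = 0 := fun x hx =>
    ⟨hU x hx, hχ0 x fun h => hx (hIU h)⟩
  have hψc : ∀ i, ContinuousOn (ψ i) (Ioo 0 L) := fun i x hx =>
    (hψ i x hx).continuousAt.continuousWithinAt
  have hpc : ∀ i, ContinuousOn (p i) (Ioo 0 L) := fun i x hx => by
    cases i with
    | zero => exact (hp0 x hx).continuousAt.continuousWithinAt
    | succ i => exact (hp i x hx).continuousAt.continuousWithinAt
  have hEc : ContinuousOn E (Ioo 0 L) := (continuous_growth hν).continuousOn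
  have hEp : ∀ x ∈ Ioo 0 L, 0 < E x := fun x hx => growth_pos hx.1
  have hχ₁c : Continuous χ₁ := continuous_iff_continuousAt.2 fun x => (hχ₁ x).continuousAt
  have hQc : ContinuousOn (growthRate ν ξ) (Ioo 0 L) := fun x hx =>
    (hasDerivAt_growthRate hx.1).continuousAt.continuousWithinAt
  have hkc : ∀ i, ContinuousOn (kF i) (Ioo 0 L) := fun i =>
    (hχ₂.continuousOn.mul (hEc.mul (hψc i))).add (continuousOn_const.mul
      (hχ₁c.continuousOn.mul (((hQc.mul hEc).mul (hψc i)).add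
        ((hpc i).div hEc fun x hx => (hEp x hx).ne'))))
  have hk0 : ∀ i x, x ∉ Icc a₁ a₂ → kF i x = 0 := fun i x hx => by
    simp only [hkF]
    rw [(hχ0 x hx).1, (hχ0 x hx).2]
    ring
  have hkb : ∀ i x, |kF i x| ≤ D * M * K * Z i := by
    intro i x
    have hKZ := mul_nonneg hK0 (hZ0 i)
    by_cases hx : x ∈ Icc a₁ a₂
    · obtain ⟨h1, h2⟩ := hK i x hx
      obtain ⟨-, d1, d2⟩ := hD x
      have hx0 : 0 < x := ha₁.trans_le hx.1
      have hEx := hEp x (hIoo hx)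
      have hQ : |growthRate ν ξ x| ≤ (ν + 1 / 2) / a₁ + ξ * a₂ := by
        rw [abs_of_nonneg (growthRate_nonneg hν hξ hx0), growthRate]
        have := hx.1
        have := hx.2
        gcongr
      have e1 : |χ₂ x * (E x * ψ i x)| ≤ D * (K * Z i) := by
        rw [abs_mul, abs_mul, abs_of_pos hEx]
        gcongr
      have e2 : |growthRate ν ξ x * E x * ψ i x + p i x / E x| ≤
          ((ν + 1 / 2) / a₁ + ξ * a₂) * (K * Z i) + K * Z i := by
        refine (abs_add_le _ _).trans (add_le_add ?_ ?_)
        · rw [mul_assoc, abs_mul, abs_mul (E x), abs_of_pos hEx]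
          gcongr
          exact (abs_nonneg _).trans hQ
        · rw [abs_div, abs_of_pos hEx]
          exact h2
      have e3 : |χ₁ x * (growthRate ν ξ x * E x * ψ i x + p i x / E x)| ≤
          D * (((ν + 1 / 2) / a₁ + ξ * a₂) * (K * Z i) + K * Z i) := by
        rw [abs_mul]
        gcongr
      calc |kF i x| ≤ |χ₂ x * (E x * ψ i x)| +
            2 * |χ₁ x * (growthRate ν ξ x * E x * ψ i x + p i x / E x)| := by
            refine (abs_add_le _ _).trans_eq ?_
            rw [abs_mul 2, abs_two]
        _ ≤ D * (K * Z i) + 2 * (D * (((ν + 1 / 2) / a₁ + ξ * a₂) * (K * Z i) + K * Z i)) := by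
            gcongr
        _ = D * M * K * Z i := by rw [hM]; ring
    · rw [hk0 i x hx, abs_zero]
      have := mul_nonneg (mul_nonneg hD0 hM0) hKZ
      linarith
  have hkL : ∀ i, MemLp (kF i) 2 (intervalMeasure L) := fun i =>
    memLp_of_abs_le ((hkc i).aestronglyMeasurable measurableSet_Ioo) _ fun x _ => hkb i x
  have himg : ∀ i, ∃ (hu : MemLp (uF i) 2 (intervalMeasure L))
      (hh : MemLp (fun x => -kF i x - χ x * (2 * ξ * (ν + 1) * (E x * ψ i x) +
        (Nat.casesOn i 0 fun j => E x ^ 2 * ψ j x) / E x)) 2 (intervalMeasure L)),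
      IsGrushinImage L ν ξ hu.toLp hh.toLp := by
    intro i
    cases i with
    | zero =>
      refine exists_isGrushinImage_cutoff hL hν (C := C * Z 0) hχ hχ₁ hχ₂ hU' (hψ 0) hp0
        continuousOn_const (fun x hx hxU => ⟨(hC 0 x hx hxU).1, (hC 0 x hx hxU).2, ?_⟩) (hend 0)
      change |(0 : ℝ)| ≤ _
      rw [abs_zero]
      have := hZ0 0
      positivity
    | succ i =>
      refine exists_isGrushinImage_cutoff hL hν (C := C * Z (i + 1) + C * Z i) hχ hχ₁ hχ₂ hU'
        (hψ (i + 1)) (hp i) ((hEc.pow 2).mul (hψc i))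
        (fun x hx hxU => ⟨?_, ?_, ?_⟩) (hend (i + 1))
      · have := mul_nonneg hC0 (hZ0 i)
        linarith [(hC (i + 1) x hx hxU).1]
      · have := mul_nonneg (mul_nonneg hC0 (hZ0 i)) (sq_nonneg (growth ν ξ x))
        linarith [(hC (i + 1) x hx hxU).2]
      · have h1 := mul_nonneg (mul_nonneg hC0 (hZ0 (i + 1))) (sq_nonneg (growth ν ξ x))
        rw [abs_mul, abs_of_nonneg (sq_nonneg (E x))]
        have h2 := mul_le_mul_of_nonneg_right (hC i x hx hxU).1 (sq_nonneg (growth ν ξ x))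
        linarith
  choose hu hh himg using himg
  -- The index is shifted by one: v (i + 1) = χEψ_i, while v 0 = 0 encodes (E²ψ_0')' = 0.
  set v : ℕ → L2Interval L := fun i => Nat.casesOn i 0 fun j => (hu j).toLp with hv
  have hvs : ∀ i, v (i + 1) = (hu i).toLp := fun i => rfl
  have hvc : ∀ i, (v (i + 1) : ℝ → ℝ) =ᵐ[intervalMeasure L] uF i := fun i => (hu i).coeFn_toLp
  -- The global constant C enters only through A, hence only the vanishing remainder. The final
  -- bound sees the iterates on [a₁, a₂] alone, through K.
  refine hf.abs_inner_le (lam := 2 * ξ * (ν + 1)) (A := D * (E L * C) * Real.sqrt L) (v := v)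
    (k := fun i => (hkL i).toLp) hB hS hST hμ hlam hθ hX (by positivity) rfl (fun i => ?_)
    (fun i => ?_) ?_ (fun t _ => restrictNorm_nonneg _ _ _) (fun i t ht => ?_) ?_
  · have h1 : (hh i).toLp = -(hkL i).toLp - (2 * ξ * (ν + 1)) • v (i + 1) - v i := by
      refine Lp.ext ?_
      cases i with
      | zero =>
        rw [show v 0 = 0 from rfl, sub_zero]
        filter_upwards [(hh 0).coeFn_toLp, (hkL 0).coeFn_toLp, hvc 0,
          Lp.coeFn_sub (-(hkL 0).toLp) ((2 * ξ * (ν + 1)) • v (0 + 1)), Lp.coeFn_neg ((hkL 0).toLp),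
          Lp.coeFn_smul (2 * ξ * (ν + 1)) (v (0 + 1))] with x e1 e2 e3 e4 e5 e6
        rw [e1, e4, Pi.sub_apply, e5, e6, Pi.neg_apply, Pi.smul_apply, e2, e3, smul_eq_mul]
        change -kF 0 x - χ x * (2 * ξ * (ν + 1) * (E x * ψ 0 x) + 0 / E x) = _
        simp only [huF]
        ring
      | succ i =>
        filter_upwards [(hh (i + 1)).coeFn_toLp, (hkL (i + 1)).coeFn_toLp, hvc (i + 1), hvc i,
          Lp.coeFn_sub (-(hkL (i + 1)).toLp - (2 * ξ * (ν + 1)) • v (i + 1 + 1)) (v (i + 1)),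
          Lp.coeFn_sub (-(hkL (i + 1)).toLp) ((2 * ξ * (ν + 1)) • v (i + 1 + 1)),
          Lp.coeFn_neg ((hkL (i + 1)).toLp), Lp.coeFn_smul (2 * ξ * (ν + 1)) (v (i + 1 + 1)),
          ae_restrict_mem measurableSet_Ioo] with x e1 e2 e3 e3' e4' e4 e5 e6 hx
        rw [e1, e4', Pi.sub_apply, e4, Pi.sub_apply, e5, e6, Pi.neg_apply, Pi.smul_apply, e2, e3,
          e3', smul_eq_mul]
        simp only [huF]
        have hEx := hEp x hx
        field_simp
        ring
    rw [← h1, hvs]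
    exact himg i
  · have h1 : ‖v (i + 1)‖ ≤ D * (E L * (C * Z i)) * Real.sqrt L := by
      have hEL0 := hE0 L
      have hZi := hZ0 i
      refine norm_le_of_ae_abs_le hL.le (by positivity) ?_
      filter_upwards [hvc i, ae_restrict_mem measurableSet_Ioo] with x hx hx0
      rw [hx]
      by_cases hxU : x ∈ U
      · simp only [huF]
        rw [abs_mul, abs_mul, abs_of_nonneg (hE0 x)]
        have := (hC i x hx0 hxU).1
        have := (hD x).1
        have := hEL x hx0
        have := mul_nonneg (hE0 x) (abs_nonneg (ψ i x))
        gcongr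
      · simp only [huF]
        rw [hU x hxU, zero_mul, abs_zero]
        positivity
    refine h1.trans_eq ?_
    ring
  · exact (continuous_restrictNorm a b).comp_continuousOn
      (hf.continuousOn.mono (Icc_subset_Icc_right hST.le))
  · have hZi := hZ0 i
    have h1 : ‖((hkL i).toLp : L2Interval L)‖ ≤ D * M * K * Z i * Real.sqrt L := by
      refine norm_le_of_ae_abs_le hL.le (by positivity) ?_
      filter_upwards [(hkL i).coeFn_toLp] with x hx
      rw [hx]; exact hkb i x
    refine (abs_inner_le_restrictNorm (a := a) (b := b) ?_).trans ?_
    · filter_upwards [(hkL i).coeFn_toLp] with x hx hx'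
      rw [hx]
      exact hk0 i x fun h => hx' ⟨haa.trans_le h.1, h.2.trans_lt hab⟩
    · refine (mul_le_mul_of_nonneg_left h1 (restrictNorm_nonneg _ _ _)).trans_eq ?_
      ring
  · have hlim : Tendsto (fun n : ℕ => ‖f S‖ * (D * (E L * (C' * ((μ * X) ^ n /
        (n.factorial : ℝ) ^ 2))) * Real.sqrt L)) atTop (𝓝 0) := by
      have h1 := (summable_pow_div_factorial_sq hX hμ hθ).1.tendsto_atTop_zero
      have h2 := h1.const_mul (‖f S‖ * (D * (E L * C') * Real.sqrt L))
      rw [mul_zero] at h2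
      refine h2.congr fun n => ?_
      ring
    rw [tendsto_iff_norm_sub_tendsto_zero]
    refine squeeze_zero (fun _ => norm_nonneg _) (fun n => ?_) hlim
    have h1 : ∑ i ∈ Finset.range n, (-μ) ^ i * (inner ℝ (f S) (v (i + 1)) : ℝ) -
        inner ℝ (f S) φ = -inner ℝ (f S) (φ - ∑ i ∈ Finset.range n, (-μ) ^ i • v (i + 1)) := by
      rw [inner_sub_right, inner_sum]
      simp only [real_inner_smul_right]
      ring
    rw [h1, norm_neg]
    refine (norm_inner_le_norm _ _).trans (mul_le_mul_of_nonneg_left ?_ (norm_nonneg _))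
    have hEL0 := hE0 L
    refine norm_le_of_ae_abs_le hL.le (by positivity) ?_
    have h2 : ∀ᵐ x ∂(intervalMeasure L), ∀ i, ((-μ) ^ i • v (i + 1) : L2Interval L) x =
        (-μ) ^ i * uF i x := by
      rw [ae_all_iff]
      intro i
      filter_upwards [Lp.coeFn_smul ((-μ) ^ i) (v (i + 1)), hvc i] with x e1 e2
      rw [e1, Pi.smul_apply, e2, smul_eq_mul]
    filter_upwards [hφ, h2, Lp.coeFn_sub φ (∑ i ∈ Finset.range n, (-μ) ^ i • v (i + 1)),
      Lp.coeFn_finsetSum (Finset.range n) (fun i => (-μ) ^ i • v (i + 1)),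
      ae_restrict_mem measurableSet_Ioo] with x e1 e2 e3 e4 hx
    have e5 : (φ - ∑ i ∈ Finset.range n, (-μ) ^ i • v (i + 1) : L2Interval L) x =
        χ x * (E x * (η x - ∑ i ∈ Finset.range n, (-μ) ^ i * ψ i x)) := by
      rw [e3, Pi.sub_apply, e1, e4, Finset.sum_apply, Finset.sum_congr rfl fun i _ => e2 i,
        mul_sub, mul_sub, Finset.mul_sum, Finset.mul_sum]
      congr 1
      exact Finset.sum_congr rfl fun i _ => by simp only [huF]; ring
    rw [e5]
    by_cases hxU : x ∈ U
    · rw [abs_mul, abs_mul, abs_of_nonneg (hE0 x)]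
      have := hη n x hx hxU
      have := (hD x).1
      have := hEL x hx
      have := mul_nonneg (hE0 x) (abs_nonneg (η x - ∑ i ∈ Finset.range n, (-μ) ^ i * ψ i x))
      gcongr
    · rw [hU x hxU, zero_mul, abs_zero]
      positivity

end Cutoff

/-! ### Observation of one mode, left and right of the cut-off. -/

section TwoSides

variable {L ν ξ : ℝ}

/-- The flux of index i + 1 comes with (i!)⁻². Passing to ((i+1)!)⁻² costs (i+1)² ≤ 4^(i+1), which
is why the common scale is X = 4L² rather than L². -/
theorem pow_div_factorial_sq_le_succ (hL : 0 < L) {y : ℝ} (hy0 : 0 ≤ y) (hyL : y ≤ L) (i : ℕ) :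
    y ^ (2 * i + 1) / (i.factorial : ℝ) ^ 2 ≤
      L⁻¹ * ((4 * L ^ 2) ^ (i + 1) / ((i + 1).factorial : ℝ) ^ 2) := by
  have h1 : y ^ (2 * i + 1) ≤ L ^ (2 * i + 1) := pow_le_pow_left₀ hy0 hyL _
  have h4 : (i + 1) ≤ 2 ^ (i + 1) := Nat.lt_two_pow_self.le
  have h5 : ((i : ℝ) + 1) ≤ 2 ^ (i + 1) := by exact_mod_cast h4
  have h3 : ((i : ℝ) + 1) ^ 2 ≤ 4 ^ (i + 1) := by
    calc ((i : ℝ) + 1) ^ 2 ≤ (2 ^ (i + 1)) ^ 2 := by gcongr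
      _ = 4 ^ (i + 1) := by rw [← pow_mul, mul_comm, pow_mul]; norm_num
  have hf : (0 : ℝ) < i.factorial := by positivity
  have h6 : L⁻¹ * ((4 * L ^ 2) ^ (i + 1) / ((i + 1).factorial : ℝ) ^ 2) =
      L ^ (2 * i + 1) * (4 ^ (i + 1) / ((i : ℝ) + 1) ^ 2) / (i.factorial : ℝ) ^ 2 := by
    rw [Nat.factorial_succ, mul_pow, ← pow_mul]
    push_cast
    have h7 : L ^ (2 * (i + 1)) = L ^ (2 * i + 1) * L := by ring
    rw [h7]
    field_simp
  rw [h6]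
  refine div_le_div_of_nonneg_right ?_ (by positivity)
  refine h1.trans (le_mul_of_one_le_right (by positivity) ?_)
  rwa [one_le_div (by positivity)]

theorem pow_div_factorial_sq_le {y : ℝ} (hy0 : 0 ≤ y) (hyL : y ≤ L) (i : ℕ) :
    y ^ (2 * i) / (i.factorial : ℝ) ^ 2 ≤ (4 * L ^ 2) ^ i / (i.factorial : ℝ) ^ 2 := by
  refine div_le_div_of_nonneg_right ?_ (by positivity)
  rw [pow_mul]
  refine pow_le_pow_left₀ (by positivity) ?_ _
  nlinarith

theorem abs_leftIterate_le_of_lt (hν : 0 < ν) (hξ : 0 ≤ ξ) (i : ℕ) {x : ℝ} (hx : x ∈ Ioo 0 L) :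
    |leftIterate ν ξ i x| ≤ (4 * L ^ 2) ^ i / (i.factorial : ℝ) ^ 2 ∧
      |leftIterateFlux ν ξ i x| ≤
        L⁻¹ * ((4 * L ^ 2) ^ i / (i.factorial : ℝ) ^ 2) * growth ν ξ x ^ 2 := by
  have hL : 0 < L := hx.1.trans hx.2
  refine ⟨(abs_leftIterate_le hν hξ i hx).1.trans (pow_div_factorial_sq_le hx.1.le hx.2.le i), ?_⟩
  cases i with
  | zero =>
    simp only [leftIterateFlux, abs_zero]
    positivity
  | succ i =>
    refine (abs_leftIterate_le hν hξ i hx).2.trans ?_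
    rw [mul_comm]
    exact mul_le_mul_of_nonneg_right (pow_div_factorial_sq_le_succ hL hx.1.le hx.2.le i)
      (sq_nonneg _)

theorem abs_rightIterate_le_of_lt (hν : 0 < ν) (hξ : 0 ≤ ξ) (i : ℕ) {x : ℝ} (hx : x ∈ Ioo 0 L) :
    growth ν ξ x ^ 2 * |rightIterate L ν ξ i x| ≤
        L * ((4 * L ^ 2) ^ i / (i.factorial : ℝ) ^ 2) ∧
      |rightIterateFlux L ν ξ i x| ≤ (4 * L ^ 2) ^ i / (i.factorial : ℝ) ^ 2 := by
  have hL : 0 < L := hx.1.trans hx.2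
  have h0 : 0 ≤ L - x := sub_nonneg.2 hx.2.le
  have h1 : L - x ≤ L := by linarith [hx.1]
  constructor
  · refine (abs_rightIterate_le hL hν hξ i hx).1.trans ?_
    rw [mul_div_assoc]
    exact mul_le_mul_of_nonneg_left (pow_div_factorial_sq_le h0 h1 i) hL.le
  · cases i with
    | zero => simp [rightIterateFlux]
    | succ i =>
      refine (abs_rightIterate_le hL hν hξ i hx).2.trans ?_
      rw [mul_div_assoc]
      refine (mul_le_mul_of_nonneg_left (pow_div_factorial_sq_le_succ hL h0 h1 i) hL.le).trans_eq ?_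
      field_simp

variable {T : ℝ} {f₀ : L2Interval L} {f : ℝ → L2Interval L}

/-- The trivial cut-off χ = 1 is admissible because ψ is bounded near 0 and vanishes at L. -/
theorem IsProfile.isGrushinImage {μ : ℝ} {ψ p : ℝ → ℝ} (h : IsProfile L ν ξ μ ψ p) (hL : 0 < L)
    (hν : 0 < ν) (hξ : 0 ≤ ξ) (hμ : 0 ≤ μ) {φ : L2Interval L}
    (hφ : φ =ᵐ[intervalMeasure L] fun x => growth ν ξ x * ψ x) :
    IsGrushinImage L ν ξ φ ((μ - 2 * ξ * (ν + 1)) • φ) := by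
  obtain ⟨C, hC⟩ := h.exists_abs_le
  have hC0 : 0 ≤ C := (abs_nonneg _).trans (hC (L / 2) ⟨by linarith, by linarith⟩)
  have hEc := continuous_growth (ξ := ξ) hν
  have key : ∀ x ∈ Ioo 0 L, |ψ x| ≤ C + μ * C * L + μ * C ∧
      |p x| ≤ (C + μ * C * L + μ * C) * growth ν ξ x ^ 2 ∧
      |-μ * (growth ν ξ x ^ 2 * ψ x)| ≤ (C + μ * C * L + μ * C) * growth ν ξ x ^ 2 := by
    intro x hx
    refine ⟨?_, ?_, ?_⟩
    · have := mul_nonneg hμ hC0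
      have := mul_nonneg this hL.le
      linarith [hC x hx]
    · refine (h.abs_snd_le hν hξ hμ hC0 le_rfl hC hx).trans ?_
      rw [mul_comm]
      refine mul_le_mul_of_nonneg_right ?_ (sq_nonneg _)
      have := mul_nonneg hμ hC0
      have := mul_le_mul_of_nonneg_left hx.2.le this
      linarith
    · rw [abs_mul, abs_neg, abs_of_nonneg hμ, abs_mul, abs_of_nonneg (sq_nonneg (growth ν ξ x))]
      have h1 := mul_nonneg hμ hC0
      have h2 := mul_nonneg h1 hL.le
      calc μ * (growth ν ξ x ^ 2 * |ψ x|) ≤ μ * (growth ν ξ x ^ 2 * C) := by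
            have := hC x hx; gcongr
        _ = μ * C * growth ν ξ x ^ 2 := by ring
        _ ≤ (C + μ * C * L + μ * C) * growth ν ξ x ^ 2 :=
            mul_le_mul_of_nonneg_right (by linarith) (sq_nonneg _)
  obtain ⟨hu, hh, himg⟩ := exists_isGrushinImage_cutoff hL hν (ξ := ξ) (χ := fun _ => 1)
    (χ₁ := fun _ => 0) (χ₂ := fun _ => 0) (S := univ) (C := C + μ * C * L + μ * C)
    (fun x => hasDerivAt_const x 1)
    (fun x => hasDerivAt_const x 0) continuous_const (fun x hx => absurd (mem_univ x) hx)
    h.hasDerivAt_fst h.hasDerivAt_snd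
    (continuousOn_const.mul ((hEc.pow 2).continuousOn.mul h.continuousOn_fst))
    (fun x hx _ => key x hx) (by simpa using h.tendsto_fst_right)
  have h1 : hu.toLp = φ := by
    refine Lp.ext ?_
    filter_upwards [hu.coeFn_toLp, hφ] with x e1 e2
    rw [e1, e2, one_mul]
  have h2 : hh.toLp = (μ - 2 * ξ * (ν + 1)) • φ := by
    refine Lp.ext ?_
    filter_upwards [hh.coeFn_toLp, hφ, Lp.coeFn_smul (μ - 2 * ξ * (ν + 1)) φ,
      ae_restrict_mem measurableSet_Ioo] with x e1 e2 e3 hx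
    have hEx : 0 < growth ν ξ x := growth_pos hx.1
    rw [e1, e3, Pi.smul_apply, e2, smul_eq_mul]
    field_simp
    ring
  rwa [h1, h2] at himg

/-- The expansion from 0 is normalised by n = ψ(0), its iterates are bounded independently of ξ, and
E is at most E(a₂) on the transition zone: hence the cost |n| E(a₂). -/
theorem IsGrushinSolution.abs_inner_left_le (hf : IsGrushinSolution L ν ξ T f₀ f)
    {S μ θ : ℝ} {B : ℕ → ℝ} (hB : IsCutoffBound S B) (hS : 0 < S) (hST : S < T) (hμ : 0 ≤ μ)
    (hlam : 2 * ξ * (ν + 1) ≤ μ) (hθ : 0 < θ) (hν : 0 < ν) (hξ : 0 ≤ ξ)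
    {a b a₁ a₂ : ℝ} (ha : 0 < a) (haa : a < a₁) (ha₁₂ : a₁ ≤ a₂) (hab : a₂ < b) (hbL : b ≤ L)
    {χ χ₁ χ₂ : ℝ → ℝ} {D : ℝ} (hχ : ∀ x, HasDerivAt χ (χ₁ x) x)
    (hχ₁ : ∀ x, HasDerivAt χ₁ (χ₂ x) x) (hχ₂ : Continuous χ₂)
    (hD : ∀ x, |χ x| ≤ D ∧ |χ₁ x| ≤ D ∧ |χ₂ x| ≤ D)
    (hχ0 : ∀ x, x ∉ Icc a₁ a₂ → χ₁ x = 0 ∧ χ₂ x = 0) (hχr : ∀ x, a₂ < x → χ x = 0)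
    {ψ p : ℝ → ℝ} (h : IsProfile L ν ξ μ ψ p) {n : ℝ} (hn : Tendsto ψ (𝓝[>] 0) (𝓝 n))
    {φ : L2Interval L} (hφ : φ =ᵐ[intervalMeasure L] fun x => χ x * (growth ν ξ x * ψ x)) :
    |inner ℝ (f S) φ| ≤ D * (3 + 2 * ((ν + 1 / 2) / a₁ + ξ * a₂)) *
      (|n| * (1 + L⁻¹) * growth ν ξ a₂) * Real.sqrt L *
      ((∑' j, B j * (4 * L ^ 2) ^ j / (j.factorial : ℝ) ^ 2) *
        (Real.exp (θ * μ) * Real.exp (4 * L ^ 2 / θ))) *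
        ∫ t in (0 : ℝ)..S, restrictNorm a b (f t) := by
  have ha₁ : 0 < a₁ := ha.trans haa
  have ha₂L : a₂ < L := hab.trans_le hbL
  have hL : 0 < L := ha₁.trans_le (ha₁₂.trans ha₂L.le)
  have hE0 : ∀ x, 0 ≤ growth ν ξ x := growth_nonneg
  obtain ⟨C, hC⟩ := h.exists_abs_le
  have hC0 : 0 ≤ C := (abs_nonneg _).trans (hC a₁ ⟨ha₁, ha₁₂.trans_lt ha₂L⟩)
  have hbound : ∀ i, ∀ x ∈ Ioo 0 L,
      |n * leftIterate ν ξ i x| ≤ |n| * (1 + L⁻¹) * ((4 * L ^ 2) ^ i / (i.factorial : ℝ) ^ 2) ∧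
      |n * leftIterateFlux ν ξ i x| ≤
        |n| * (1 + L⁻¹) * ((4 * L ^ 2) ^ i / (i.factorial : ℝ) ^ 2) * growth ν ξ x ^ 2 := by
    intro i x hx
    obtain ⟨h1, h2⟩ := abs_leftIterate_le_of_lt hν hξ i hx
    have hZ : 0 ≤ (4 * L ^ 2) ^ i / (i.factorial : ℝ) ^ 2 := by positivity
    have hL1 : 0 < L⁻¹ := inv_pos.2 hL
    rw [abs_mul, abs_mul, mul_assoc |n|, mul_assoc |n|]
    constructor
    · refine mul_le_mul_of_nonneg_left (h1.trans ?_) (abs_nonneg _)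
      exact le_mul_of_one_le_left hZ (by linarith)
    · refine mul_le_mul_of_nonneg_left (h2.trans ?_) (abs_nonneg _)
      refine mul_le_mul_of_nonneg_right ?_ (sq_nonneg _)
      exact mul_le_mul_of_nonneg_right (by linarith) hZ
  refine hf.abs_inner_cutoff_le hB hS hST hμ hlam hθ (by positivity) hν hξ ha haa ha₁₂ hab hbL hχ
    hχ₁ hχ₂ hD hχ0 (U := Iic a₂) (fun x hx => hχr x (not_le.1 hx)) (fun x hx => hx.2)
    (ψ := fun i x => n * leftIterate ν ξ i x) (p := fun i x => n * leftIterateFlux ν ξ i x)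
    (fun i x _ => ?_) (fun x _ => ?_) (fun i x _ => ?_) (C := |n| * (1 + L⁻¹))
    (fun i x hx _ => hbound i x hx) ?_ (fun i x hx => ?_) (fun i => ?_) (η := ψ) (C' := C)
    (fun N x hx _ => ?_) hφ
  · exact ((hasDerivAt_leftIterate hν hξ i x).const_mul n).congr_deriv (by ring)
  · simpa [leftIterateFlux] using hasDerivAt_const x (0 : ℝ)
  · exact ((hasDerivAt_leftIterateFlux hν hξ i x).const_mul n).congr_deriv (by ring)
  · have := hE0 a₂
    positivity
  · have hx0 : x ∈ Ioo 0 L := ⟨ha₁.trans_le hx.1, hx.2.trans_lt ha₂L⟩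
    obtain ⟨h1, h2⟩ := hbound i x hx0
    have hEx : 0 < growth ν ξ x := growth_pos hx0.1
    have hEa : growth ν ξ x ≤ growth ν ξ a₂ := growth_mono hν hξ hx0.1.le hx.2
    have hW : 0 ≤ |n| * (1 + L⁻¹) * ((4 * L ^ 2) ^ i / (i.factorial : ℝ) ^ 2) := by positivity
    have h3 : |n| * (1 + L⁻¹) * growth ν ξ a₂ * ((4 * L ^ 2) ^ i / (i.factorial : ℝ) ^ 2) =
        growth ν ξ a₂ * (|n| * (1 + L⁻¹) * ((4 * L ^ 2) ^ i / (i.factorial : ℝ) ^ 2)) := by ring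
    rw [h3]
    constructor
    · exact mul_le_mul hEa h1 (abs_nonneg _) (hE0 _)
    · rw [div_le_iff₀ hEx]
      refine h2.trans ?_
      have h4 := mul_le_mul_of_nonneg_left hEa (mul_nonneg hW hEx.le)
      linarith
  · refine tendsto_const_nhds.congr' ?_
    filter_upwards [Ioo_mem_nhdsLT ha₂L] with x hx
    rw [hχr x hx.1, zero_mul]
  · have h1 := h.abs_sub_sum_left_le hν hξ hμ hn le_rfl hC N x hx
    have h2 : ∑ i ∈ Finset.range N, (-μ) ^ i * (n * leftIterate ν ξ i x) =
        n * ∑ i ∈ Finset.range N, (-μ) ^ i * leftIterate ν ξ i x := by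
      rw [Finset.mul_sum]
      exact Finset.sum_congr rfl fun i _ => by ring
    rw [h2]
    refine h1.trans ?_
    have h3 := pow_div_factorial_sq_le (L := L) hx.1.le hx.2.le N
    calc C * μ ^ N * x ^ (2 * N) / (N.factorial : ℝ) ^ 2
        = C * μ ^ N * (x ^ (2 * N) / (N.factorial : ℝ) ^ 2) := by ring
      _ ≤ C * μ ^ N * ((4 * L ^ 2) ^ N / (N.factorial : ℝ) ^ 2) := by gcongr
      _ = C * ((μ * (4 * L ^ 2)) ^ N / (N.factorial : ℝ) ^ 2) := by rw [mul_pow μ]; ring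

/-- The expansion from L is normalised by the conormal derivative there, and its iterates have size
E⁻². So Eρ_i is of order 1/E, at most 1/E(a₁) on the transition zone. The piece lives on x ≥ a₁,
away from the singularity of the iterates. -/
theorem IsGrushinSolution.abs_inner_right_le (hf : IsGrushinSolution L ν ξ T f₀ f)
    {S μ θ : ℝ} {B : ℕ → ℝ} (hB : IsCutoffBound S B) (hS : 0 < S) (hST : S < T) (hμ : 0 ≤ μ)
    (hlam : 2 * ξ * (ν + 1) ≤ μ) (hθ : 0 < θ) (hν : 0 < ν) (hξ : 0 ≤ ξ)
    {a b a₁ a₂ : ℝ} (ha : 0 < a) (haa : a < a₁) (ha₁₂ : a₁ ≤ a₂) (hab : a₂ < b) (hbL : b ≤ L)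
    {χ χ₁ χ₂ : ℝ → ℝ} {D : ℝ} (hχ : ∀ x, HasDerivAt χ (χ₁ x) x)
    (hχ₁ : ∀ x, HasDerivAt χ₁ (χ₂ x) x) (hχ₂ : Continuous χ₂)
    (hD : ∀ x, |χ x| ≤ D ∧ |χ₁ x| ≤ D ∧ |χ₂ x| ≤ D)
    (hχ0 : ∀ x, x ∉ Icc a₁ a₂ → χ₁ x = 0 ∧ χ₂ x = 0) (hχl : ∀ x < a₁, χ x = 0)
    {ψ p : ℝ → ℝ} (h : IsProfile L ν ξ μ ψ p)
    {φ : L2Interval L} (hφ : φ =ᵐ[intervalMeasure L] fun x => χ x * (growth ν ξ x * ψ x)) :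
    |inner ℝ (f S) φ| ≤ D * (3 + 2 * ((ν + 1 / 2) / a₁ + ξ * a₂)) *
      (|μ * ∫ x in Ioo 0 L, growth ν ξ x ^ 2 * ψ x| * (L + 1) / growth ν ξ a₁) * Real.sqrt L *
      ((∑' j, B j * (4 * L ^ 2) ^ j / (j.factorial : ℝ) ^ 2) *
        (Real.exp (θ * μ) * Real.exp (4 * L ^ 2 / θ))) *
        ∫ t in (0 : ℝ)..S, restrictNorm a b (f t) := by
  have ha₁ : 0 < a₁ := ha.trans haa
  have ha₂L : a₂ < L := hab.trans_le hbL
  have hL : 0 < L := ha₁.trans_le (ha₁₂.trans ha₂L.le)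
  have hE0 : ∀ x, 0 ≤ growth ν ξ x := growth_nonneg
  have hE₁ : 0 < growth ν ξ a₁ := growth_pos ha₁
  have hEm : ∀ x, a₁ ≤ x → growth ν ξ a₁ ≤ growth ν ξ x := fun x hx => growth_mono hν hξ ha₁.le hx
  obtain ⟨C, hC⟩ := h.exists_abs_le
  have hC0 : 0 ≤ C := (abs_nonneg _).trans (hC a₁ ⟨ha₁, ha₁₂.trans_lt ha₂L⟩)
  set n := μ * ∫ x in Ioo 0 L, growth ν ξ x ^ 2 * ψ x with hn
  have hbound : ∀ i, ∀ x ∈ Ioo 0 L,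
      growth ν ξ x ^ 2 * |n * rightIterate L ν ξ i x| ≤
        |n| * (L + 1) * ((4 * L ^ 2) ^ i / (i.factorial : ℝ) ^ 2) ∧
      |n * rightIterateFlux L ν ξ i x| ≤
        |n| * (L + 1) * ((4 * L ^ 2) ^ i / (i.factorial : ℝ) ^ 2) := by
    intro i x hx
    obtain ⟨h1, h2⟩ := abs_rightIterate_le_of_lt hν hξ i hx
    have hZ : 0 ≤ (4 * L ^ 2) ^ i / (i.factorial : ℝ) ^ 2 := by positivity
    rw [abs_mul n, abs_mul n, mul_left_comm, mul_assoc |n|]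
    constructor
    · refine mul_le_mul_of_nonneg_left (h1.trans ?_) (abs_nonneg _)
      exact mul_le_mul_of_nonneg_right (by linarith) hZ
    · refine mul_le_mul_of_nonneg_left (h2.trans ?_) (abs_nonneg _)
      exact le_mul_of_one_le_left hZ (by linarith)
  refine hf.abs_inner_cutoff_le hB hS hST hμ hlam hθ (by positivity) hν hξ ha haa ha₁₂ hab hbL hχ
    hχ₁ hχ₂ hD hχ0 (U := Ici a₁) (fun x hx => hχl x (not_le.1 hx)) (fun x hx => hx.1)
    (ψ := fun i x => n * rightIterate L ν ξ i x) (p := fun i x => n * rightIterateFlux L ν ξ i x)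
    (fun i x hx => ?_) (fun x _ => ?_) (fun i x hx => ?_)
    (C := |n| * (L + 1) / growth ν ξ a₁ ^ 2)
    (fun i x hx hxU => ?_) (by positivity) (fun i x hx => ?_) (fun i => ?_) (η := ψ)
    (C' := growth ν ξ L ^ 2 * C / growth ν ξ a₁ ^ 2) (fun N x hx hxU => ?_) hφ
  · exact ((hasDerivAt_rightIterate hν i hx).const_mul n).congr_deriv (by ring)
  · simpa [rightIterateFlux] using hasDerivAt_const x (-n)
  · exact ((hasDerivAt_rightIterateFlux hν i hx).const_mul n).congr_deriv (by ring)
  · obtain ⟨h1, h2⟩ := hbound i x hx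
    have h3 : growth ν ξ a₁ ^ 2 ≤ growth ν ξ x ^ 2 := pow_le_pow_left₀ hE₁.le (hEm x hxU) 2
    have hW : 0 ≤ |n| * (L + 1) * ((4 * L ^ 2) ^ i / (i.factorial : ℝ) ^ 2) := by positivity
    have h4 : |n| * (L + 1) / growth ν ξ a₁ ^ 2 * ((4 * L ^ 2) ^ i / (i.factorial : ℝ) ^ 2) =
        |n| * (L + 1) * ((4 * L ^ 2) ^ i / (i.factorial : ℝ) ^ 2) / growth ν ξ a₁ ^ 2 := by ring
    rw [h4]
    constructor
    · rw [le_div_iff₀ (by positivity), mul_comm]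
      exact (mul_le_mul_of_nonneg_right h3 (abs_nonneg _)).trans h1
    · refine h2.trans ?_
      rw [div_mul_eq_mul_div, le_div_iff₀ (by positivity)]
      exact mul_le_mul_of_nonneg_left h3 hW
  · have hx0 : x ∈ Ioo 0 L := ⟨ha₁.trans_le hx.1, hx.2.trans_lt ha₂L⟩
    obtain ⟨h1, h2⟩ := hbound i x hx0
    have hEx : 0 < growth ν ξ x := growth_pos hx0.1
    have hEa := hEm x hx.1
    have hW : 0 ≤ |n| * (L + 1) * ((4 * L ^ 2) ^ i / (i.factorial : ℝ) ^ 2) := by positivity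
    have h3 : |n| * (L + 1) / growth ν ξ a₁ * ((4 * L ^ 2) ^ i / (i.factorial : ℝ) ^ 2) =
        |n| * (L + 1) * ((4 * L ^ 2) ^ i / (i.factorial : ℝ) ^ 2) / growth ν ξ a₁ := by ring
    rw [h3]
    constructor
    · rw [le_div_iff₀ hE₁]
      refine le_trans ?_ h1
      have h4 := mul_le_mul_of_nonneg_left hEa
        (mul_nonneg hEx.le (abs_nonneg (n * rightIterate L ν ξ i x)))
      refine h4.trans_eq ?_
      ring
    · exact div_le_div₀ hW h2 hE₁ hEa
  · have hχc : ContinuousAt χ L := (hχ L).continuousAt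
    have h1 := (hχc.tendsto.mono_left nhdsWithin_le_nhds).mul
      ((tendsto_rightIterate (ξ := ξ) hL hν i).const_mul n)
    simpa using h1
  · have hEL : ∀ x ∈ Ioo 0 L, growth ν ξ x ^ 2 * |ψ x| ≤ growth ν ξ L ^ 2 * C := fun x hx => by
      have h1 : growth ν ξ x ≤ growth ν ξ L := growth_mono hν hξ hx.1.le hx.2.le
      have h2 := hC x hx
      have h3 := hE0 x
      gcongr
    have h1 := h.abs_sub_sum_right_le hL hν hξ hμ hEL N x hx
    rw [← hn] at h1
    have h2 : ∑ i ∈ Finset.range N, (-μ) ^ i * (n * rightIterate L ν ξ i x) =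
        n * ∑ i ∈ Finset.range N, (-μ) ^ i * rightIterate L ν ξ i x := by
      rw [Finset.mul_sum]
      exact Finset.sum_congr rfl fun i _ => by ring
    rw [h2, div_mul_eq_mul_div, le_div_iff₀ (by positivity), mul_comm]
    have h4 : growth ν ξ a₁ ^ 2 ≤ growth ν ξ x ^ 2 := pow_le_pow_left₀ hE₁.le (hEm x hxU) 2
    refine (mul_le_mul_of_nonneg_right h4 (abs_nonneg _)).trans (h1.trans ?_)
    have h3 := pow_div_factorial_sq_le (L := L) (y := L - x) (by linarith [hx.2])
      (by linarith [hx.1]) N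
    calc growth ν ξ L ^ 2 * C * μ ^ N * (L - x) ^ (2 * N) / (N.factorial : ℝ) ^ 2
        = growth ν ξ L ^ 2 * C * μ ^ N * ((L - x) ^ (2 * N) / (N.factorial : ℝ) ^ 2) := by ring
      _ ≤ growth ν ξ L ^ 2 * C * μ ^ N * ((4 * L ^ 2) ^ N / (N.factorial : ℝ) ^ 2) := by gcongr
      _ = growth ν ξ L ^ 2 * C * ((μ * (4 * L ^ 2)) ^ N / (N.factorial : ℝ) ^ 2) := by
          rw [mul_pow μ]; ring

/-- Observation of a single mode. -/
theorem IsGrushinSolution.abs_inner_profile_le (hf : IsGrushinSolution L ν ξ T f₀ f)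
    {S μ θ : ℝ} {B : ℕ → ℝ} (hB : IsCutoffBound S B) (hS : 0 < S) (hST : S < T) (hμ : 0 ≤ μ)
    (hlam : 2 * ξ * (ν + 1) ≤ μ) (hθ : 0 < θ) (hν : 0 < ν) (hξ : 0 ≤ ξ)
    {a b a₁ a₂ : ℝ} (ha : 0 < a) (haa : a < a₁) (ha₁₂ : a₁ ≤ a₂) (hab : a₂ < b) (hbL : b ≤ L)
    {χ χ₁ χ₂ : ℝ → ℝ} {D : ℝ} (hχ : ∀ x, HasDerivAt χ (χ₁ x) x)
    (hχ₁ : ∀ x, HasDerivAt χ₁ (χ₂ x) x) (hχ₂ : Continuous χ₂)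
    (hD : ∀ x, |χ x| ≤ D ∧ |1 - χ x| ≤ D ∧ |χ₁ x| ≤ D ∧ |χ₂ x| ≤ D)
    (hχ0 : ∀ x, x ∉ Icc a₁ a₂ → χ₁ x = 0 ∧ χ₂ x = 0) (hχl : ∀ x < a₁, χ x = 1)
    (hχr : ∀ x, a₂ < x → χ x = 0)
    {ψ p : ℝ → ℝ} (h : IsProfile L ν ξ μ ψ p) {n : ℝ} (hn : Tendsto ψ (𝓝[>] 0) (𝓝 n))
    {φ : L2Interval L} (hφ : φ =ᵐ[intervalMeasure L] fun x => growth ν ξ x * ψ x) :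
    |inner ℝ (f S) φ| ≤ D * (3 + 2 * ((ν + 1 / 2) / a₁ + ξ * a₂)) *
      (|n| * (1 + L⁻¹) * growth ν ξ a₂ +
        |μ * ∫ x in Ioo 0 L, growth ν ξ x ^ 2 * ψ x| * (L + 1) / growth ν ξ a₁) * Real.sqrt L *
      ((∑' j, B j * (4 * L ^ 2) ^ j / (j.factorial : ℝ) ^ 2) *
        (Real.exp (θ * μ) * Real.exp (4 * L ^ 2 / θ))) *
        ∫ t in (0 : ℝ)..S, restrictNorm a b (f t) := by
  have hχc : Continuous χ := continuous_iff_continuousAt.2 fun x => (hχ x).continuousAt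
  have hmem : ∀ g : ℝ → ℝ, Continuous g → (∀ x, |g x| ≤ D) →
      MemLp (fun x => g x * φ x) 2 (intervalMeasure L) := fun g hg hgD => by
    refine (Lp.memLp φ).of_le_mul (c := D) (hg.aestronglyMeasurable.mul
      (Lp.aestronglyMeasurable φ)) (Eventually.of_forall fun x => ?_)
    rw [norm_mul]
    exact mul_le_mul_of_nonneg_right (hgD x) (norm_nonneg _)
  have m1 := hmem χ hχc fun x => (hD x).1
  have m2 := hmem (fun x => 1 - χ x) (by fun_prop) fun x => (hD x).2.1
  have hsum : φ = m1.toLp + m2.toLp := by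
    refine Lp.ext ?_
    filter_upwards [Lp.coeFn_add m1.toLp m2.toLp, m1.coeFn_toLp, m2.coeFn_toLp] with x e1 e2 e3
    rw [e1, Pi.add_apply, e2, e3]
    ring
  have h1 := hf.abs_inner_left_le hB hS hST hμ hlam hθ hν hξ ha haa ha₁₂ hab hbL hχ hχ₁ hχ₂
    (fun x => ⟨(hD x).1, (hD x).2.2⟩) hχ0 hχr h hn (φ := m1.toLp) (by
      filter_upwards [m1.coeFn_toLp, hφ] with x e1 e2
      rw [e1, e2])
  have h2 := hf.abs_inner_right_le hB hS hST hμ hlam hθ hν hξ ha haa ha₁₂ hab hbL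
    (χ := fun x => 1 - χ x) (χ₁ := fun x => -χ₁ x) (χ₂ := fun x => -χ₂ x) (D := D)
    (fun x => (hχ x).const_sub 1) (fun x => (hχ₁ x).fun_neg) hχ₂.neg
    (fun x => ⟨(hD x).2.1, by rw [abs_neg]; exact (hD x).2.2.1, by
      rw [abs_neg]; exact (hD x).2.2.2⟩)
    (fun x hx => by rw [(hχ0 x hx).1, (hχ0 x hx).2, neg_zero]; exact ⟨rfl, rfl⟩)
    (fun x hx => by rw [hχl x hx, sub_self]) h (φ := m2.toLp) (by
      filter_upwards [m2.coeFn_toLp, hφ] with x e1 e2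
      rw [e1, e2])
  rw [hsum, inner_add_right]
  refine (abs_add_le _ _).trans ((add_le_add h1 h2).trans_eq ?_)
  ring

end TwoSides

/-! ### Observability uniform over the modes. -/

section Observability

theorem pow_le_factorial_mul_exp {θ μ : ℝ} (hθ : 0 < θ) (hμ : 0 ≤ μ) (n : ℕ) :
    μ ^ n ≤ n.factorial / θ ^ n * Real.exp (θ * μ) := by
  have h1 := Real.pow_div_factorial_le_exp (θ * μ) (by positivity) n
  rw [div_le_iff₀ (by positivity), mul_pow] at h1
  rw [div_mul_eq_mul_div, le_div_iff₀ (by positivity)]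
  linarith

/-- Cauchy–Schwarz, from the nonnegativity of the integral of the square of q minus its mean. -/
theorem sq_intervalIntegral_le {S : ℝ} (hS : 0 < S) {q : ℝ → ℝ} (hq : ContinuousOn q (Icc 0 S)) :
    (∫ t in (0 : ℝ)..S, q t) ^ 2 ≤ S * ∫ t in (0 : ℝ)..S, q t ^ 2 := by
  have h1 : IntervalIntegrable q volume 0 S := hq.intervalIntegrable_of_Icc hS.le
  have h2 : IntervalIntegrable (fun t => q t ^ 2) volume 0 S :=
    (hq.pow 2).intervalIntegrable_of_Icc hS.le
  set I := ∫ t in (0 : ℝ)..S, q t with hI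
  have h3 : 0 ≤ ∫ t in (0 : ℝ)..S, (q t ^ 2 - 2 * (I / S) * q t + (I / S) ^ 2) :=
    intervalIntegral.integral_nonneg hS.le fun t _ => by nlinarith [sq_nonneg (q t - I / S)]
  rw [intervalIntegral.integral_add (h2.sub (h1.const_mul _)) intervalIntegrable_const,
    intervalIntegral.integral_sub h2 (h1.const_mul _), intervalIntegral.integral_const_mul,
    intervalIntegral.integral_const, ← hI, sub_zero, smul_eq_mul] at h3
  have h4 : S * (2 * (I / S) * I - S * (I / S) ^ 2) = I ^ 2 := by field_simp; ring
  have h5 := mul_le_mul_of_nonneg_left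
    (by linarith : 2 * (I / S) * I - S * (I / S) ^ 2 ≤ ∫ t in (0 : ℝ)..S, q t ^ 2) hS.le
  linarith

variable {L ν ξ : ℝ}

/-- A crude form of `sq_limit_zero_le` with an integer power, using √μ ≤ μ and k ≥ ν + 1. The
condition 1/(4L²) ≤ μ makes the interval of length 1/(2√μ) fit into (0, L). -/
theorem IsProfile.abs_limit_zero_le {μ : ℝ} {ψ p : ℝ → ℝ} (h : IsProfile L ν ξ μ ψ p)
    (hν : 0 < ν) (hξ : 0 ≤ ξ) (h1 : ∫ x in Ioo 0 L, (growth ν ξ x * ψ x) ^ 2 = 1) {n : ℝ}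
    (hn : Tendsto ψ (𝓝[>] 0) (𝓝 n)) (hL : 0 < L) (hμ1 : 1 ≤ μ) (hμL : 1 / (4 * L ^ 2) ≤ μ)
    {k : ℕ} (hk : ν + 1 ≤ k) : |n| ≤ 2 * (4 * μ) ^ k := by
  have hμ : 0 < μ := zero_lt_one.trans_le hμ1
  have hs : (2 * Real.sqrt μ)⁻¹ ≤ L := by
    have h2 : 1 / (2 * L) ≤ Real.sqrt μ := by
      refine Real.le_sqrt_of_sq_le (le_of_eq_of_le ?_ hμL)
      field_simp; norm_num
    rw [div_le_iff₀ (by positivity)] at h2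
    rw [inv_le_iff_one_le_mul₀ (by positivity)]
    linarith
  have h2 := h.sq_limit_zero_le hν hξ hμ h1 hn hs
  have h3 : Real.sqrt μ ≤ μ := Real.sqrt_le_iff.2 ⟨hμ.le, by nlinarith⟩
  have h4 : (4 * Real.sqrt μ) ^ (2 * ν + 2) ≤ ((4 * μ) ^ k) ^ 2 := by
    calc (4 * Real.sqrt μ) ^ (2 * ν + 2) ≤ (4 * μ) ^ (2 * ν + 2) := by
          have := Real.sqrt_nonneg μ
          exact Real.rpow_le_rpow (by positivity) (by linarith) (by linarith)
      _ ≤ (4 * μ) ^ ((k * 2 : ℕ) : ℝ) := by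
          refine Real.rpow_le_rpow_of_exponent_le (by linarith) ?_
          push_cast; linarith
      _ = ((4 * μ) ^ k) ^ 2 := by rw [Real.rpow_natCast, pow_mul]
  refine abs_le_of_sq_le_sq ?_ (by positivity)
  calc n ^ 2 ≤ 4 * (4 * Real.sqrt μ) ^ (2 * ν + 2) := h2
    _ ≤ 4 * ((4 * μ) ^ k) ^ 2 := by linarith
    _ = (2 * (4 * μ) ^ k) ^ 2 := by ring

/-- For large ξ the number w = (a/L)²ξ satisfies w ≥ 1 and τw ≥ 1, so the Agmon exponent 2(λ+1)/w is
at most 2(λτ+1). The loss e^(λτ) has τ at one's disposal and is paid later by the decay of the mode.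
-/
theorem IsProfile.abs_integral_growth_le {μ : ℝ} {ψ p : ℝ → ℝ} (h : IsProfile L ν ξ μ ψ p)
    (hν : 0 < ν) (hξ : 0 < ξ) (h1 : ∫ x in Ioo 0 L, (growth ν ξ x * ψ x) ^ 2 = 1) {a τ : ℝ}
    (ha : 0 < a) (haL : a < L) (hlam : 0 ≤ μ - 2 * ξ * (ν + 1)) (hτ : 0 < τ)
    (hξ1 : (L / a) ^ 2 ≤ ξ) (hξτ : (L / a) ^ 2 * τ⁻¹ ≤ ξ) :
    |∫ x in Ioo 0 L, growth ν ξ x ^ 2 * ψ x| ≤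
      Real.sqrt (2 * (L * L ^ (2 * ν + 1))) * Real.exp 1 *
        (Real.exp (ξ * a ^ 2 / 2) * Real.exp ((μ - 2 * ξ * (ν + 1)) * τ)) := by
  have hL : 0 < L := ha.trans haL
  set lam := μ - 2 * ξ * (ν + 1)
  set w := (a / L) ^ 2 * ξ with hw
  have hw0 : 0 < w := by positivity
  have hLa : (a / L) ^ 2 * (L / a) ^ 2 = 1 := by field_simp
  have hw1 : 1 ≤ w := by
    rw [hw, ← hLa]
    exact mul_le_mul_of_nonneg_left hξ1 (by positivity)
  have hwτ : τ⁻¹ ≤ w := by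
    have h2 := mul_le_mul_of_nonneg_left hξτ (by positivity : 0 ≤ (a / L) ^ 2)
    rwa [← mul_assoc, hLa, one_mul] at h2
  have hexp : 2 * (lam + 1) / w ≤ 2 * (lam * τ + 1) := by
    rw [div_le_iff₀ hw0]
    have h2 : 1 ≤ τ * w := by
      have := mul_le_mul_of_nonneg_left hwτ hτ.le
      rwa [mul_inv_cancel₀ hτ.ne'] at this
    have h3 := mul_le_mul_of_nonneg_left h2 hlam
    nlinarith
  have h2 := h.sq_integral_growth_le hν hξ h1 ha haL
  refine abs_le_of_sq_le_sq ?_ (by positivity)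
  have hP : 0 ≤ L * L ^ (2 * ν + 1) := mul_nonneg hL.le (Real.rpow_nonneg hL.le _)
  calc _ ≤ L * L ^ (2 * ν + 1) * Real.exp (ξ * a ^ 2) * (2 * Real.exp (2 * (lam + 1) / w)) := h2
    _ ≤ L * L ^ (2 * ν + 1) * Real.exp (ξ * a ^ 2) * (2 * Real.exp (2 * (lam * τ + 1))) := by
        gcongr
    _ = (Real.sqrt (2 * (L * L ^ (2 * ν + 1))) * Real.exp 1 *
        (Real.exp (ξ * a ^ 2 / 2) * Real.exp (lam * τ))) ^ 2 := by
        rw [mul_pow, mul_pow, Real.sq_sqrt (by positivity), mul_pow, ← Real.exp_nat_mul,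
          ← Real.exp_nat_mul, ← Real.exp_nat_mul]
        have e1 : 2 * (lam * τ + 1) = ((2 : ℕ) : ℝ) * 1 + ((2 : ℕ) : ℝ) * (lam * τ) := by
          push_cast; ring
        have e2 : ξ * a ^ 2 = ((2 : ℕ) : ℝ) * (ξ * a ^ 2 / 2) := by push_cast; ring
        rw [e1, Real.exp_add, e2]
        push_cast
        ring_nf

/-- Bookkeeping of powers of μ: one from the weight in front of x, one from M and k from A. Together
they are absorbed by a second factor ex = e^(θμ). -/
theorem mul_le_of_observation {x μ M A M₀ c D r G ex e₀ I P : ℝ} {k : ℕ}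
    (h : x ≤ D * M * A * r * (G * (ex * e₀)) * I) (hM : M ≤ M₀ * μ) (hA : A ≤ μ ^ k * c)
    (hP : μ ^ (k + 2) ≤ P * ex) (hμ : 0 < μ) (hD : 0 ≤ D) (hr : 0 ≤ r) (hG : 0 ≤ G)
    (hex : 0 ≤ ex) (he₀ : 0 ≤ e₀) (hI : 0 ≤ I) (hM₀ : 0 ≤ M₀) (hA0 : 0 ≤ A) :
    μ * x ≤ D * r * (G * e₀) * (P * M₀ * c) * (ex * ex) * I := by
  have hc : 0 ≤ μ ^ k * c := hA0.trans hA
  have hc0 : 0 ≤ c := nonneg_of_mul_nonneg_right hc (by positivity)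
  calc μ * x ≤ μ * (D * M * A * r * (G * (ex * e₀)) * I) := mul_le_mul_of_nonneg_left h hμ.le
    _ = D * r * (G * e₀) * (μ * (M * A)) * ex * I := by ring
    _ ≤ D * r * (G * e₀) * (μ * ((M₀ * μ) * (μ ^ k * c))) * ex * I := by gcongr
    _ = D * r * (G * e₀) * (μ ^ (k + 2) * (M₀ * c)) * ex * I := by ring
    _ ≤ D * r * (G * e₀) * (P * ex * (M₀ * c)) * ex * I := by gcongr
    _ = D * r * (G * e₀) * (P * M₀ * c) * (ex * ex) * I := by ring

/-- Uniform observability of the modes. -/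
theorem exists_forall_profile_le {a b T ε : ℝ} (hν : 0 < ν) (ha : 0 < a) (hab : a < b) (hbL : b ≤ L)
    (hT : 0 < T) (hε : 0 < ε) :
    ∃ ξ₀ : ℝ, 0 < ξ₀ ∧ ∃ K₀ : ℝ, 0 ≤ K₀ ∧ ∀ ξ : ℝ, ξ₀ ≤ ξ →
      ∀ (f₀ : L2Interval L) (f : ℝ → L2Interval L), IsGrushinSolution L ν ξ T f₀ f →
        ∀ (μ : ℝ) (ψ p : ℝ → ℝ) (φ : L2Interval L), 0 < μ → IsProfile L ν ξ μ ψ p →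
          φ =ᵐ[intervalMeasure L] (fun x => growth ν ξ x * ψ x) → ‖φ‖ = 1 →
          μ * |inner ℝ (f T) φ| ≤ K₀ * Real.exp (ξ * (a + ε / 2) ^ 2 / 2) *
            ∫ t in (0 : ℝ)..(T / 2), restrictNorm a b (f t) := by
  have hL : 0 < L := ha.trans (hab.trans_le hbL)
  have haL : a < L := hab.trans_le hbL
  obtain ⟨a₂, ha₂, ha₂'⟩ := exists_between (lt_min hab (by linarith : a < a + ε / 2))
  obtain ⟨a₁, haa, ha₁₂⟩ := exists_between ha₂
  have ha₂b : a₂ < b := ha₂'.trans_le (min_le_left _ _)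
  have ha₂ε : a₂ < a + ε / 2 := ha₂'.trans_le (min_le_right _ _)
  have ha₁ : 0 < a₁ := ha.trans haa
  have ha₂0 : 0 < a₂ := ha.trans ha₂
  obtain ⟨χ, χ₁, χ₂, D, hD1, hχ, hχ₁, hχ₂, hD, hχ0, hχl, hχr⟩ := exists_transition ha₁₂
  have hD0 : 0 ≤ D := zero_le_one.trans hD1
  have hS : 0 < T / 2 := half_pos hT
  have hST : T / 2 < T := half_lt_self hT
  obtain ⟨B, hB⟩ := exists_isCutoffBound hS
  -- The room left in the exponent between a₂ and a + ε/2.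
  set s := (a + ε / 2) ^ 2 - a₂ ^ 2 with hs
  have hs0 : 0 < s := by
    have := pow_lt_pow_left₀ ha₂ε ha₂0.le two_ne_zero
    linarith
  -- The total loss is e^(2θμ) with μ = λ + 2ξ(ν+1). Here 2θλ ≤ λT/8 is paid by the decay in time
  -- and 4θξ(ν+1) ≤ ξs/2 by the gap s.
  set θ := min (T / 16) (s / (8 * (ν + 1))) with hθ
  have hθ0 : 0 < θ := lt_min (by positivity) (by positivity)
  have hθT : θ ≤ T / 16 := min_le_left _ _
  have hθs : 8 * (ν + 1) * θ ≤ s := by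
    have h1 : θ ≤ s / (8 * (ν + 1)) := min_le_right _ _
    rw [le_div_iff₀ (by positivity)] at h1
    linarith
  obtain ⟨k, hk⟩ := exists_nat_ge (ν + 1)
  have hk1 : 1 ≤ k := by
    by_contra h
    have h0 : k = 0 := by omega
    rw [h0, Nat.cast_zero] at hk
    linarith
  set M₀ := 3 + 2 * ((ν + 1 / 2) / a₁ + a₂) with hM₀
  have hM₀0 : 0 < M₀ := by positivity
  set cl := 2 * 4 ^ k * (1 + L⁻¹) * a₂ ^ (ν + 1 / 2) with hcl
  have hcl0 : 0 ≤ cl := by have := Real.rpow_nonneg ha₂0.le (ν + 1 / 2); positivity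
  set R := Real.sqrt (2 * (L * L ^ (2 * ν + 1))) * Real.exp 1 with hR
  have hR0 : 0 ≤ R := by positivity
  set cr := R * (L + 1) / a₁ ^ (ν + 1 / 2) with hcr
  have hE₁ : 0 < a₁ ^ (ν + 1 / 2) := Real.rpow_pos_of_pos ha₁ _
  have hcr0 : 0 ≤ cr := by positivity
  set G := (∑' j, B j * (4 * L ^ 2) ^ j / (j.factorial : ℝ) ^ 2) with hG
  have hG0 : 0 ≤ G := tsum_nonneg fun j => by have := hB.nonneg j; positivity
  set P := (((k + 2).factorial : ℝ) / θ ^ (k + 2)) with hP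
  have hP0 : 0 ≤ P := by positivity
  -- The term 1 gives ξ ≥ 1 and then μ ≥ 1. The second term is what the Agmon bound with τ = T/8
  -- requires, and the third gives 1/(4L²) ≤ μ.
  refine ⟨1 + (L / a) ^ 2 * (1 + (T / 8)⁻¹) + 1 / (4 * L ^ 2), by positivity,
    D * Real.sqrt L * (G * Real.exp (4 * L ^ 2 / θ)) * (P * (M₀ * (cl + cr))), by positivity, ?_⟩
  intro ξ hξ₀ f₀ f hf μ ψ p φ hμ hprof hφ hφ1
  have q1 : 0 ≤ (L / a) ^ 2 := sq_nonneg _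
  have q2 : 0 ≤ (L / a) ^ 2 * (T / 8)⁻¹ := by positivity
  have q3 : 0 ≤ 1 / (4 * L ^ 2) := by positivity
  rw [mul_add, mul_one] at hξ₀
  have hξ1 : 1 ≤ ξ := by linarith
  have hξ : 0 < ξ := by linarith
  have hnorm : ∫ x in Ioo 0 L, (growth ν ξ x * ψ x) ^ 2 = 1 := by
    rw [← one_pow 2, ← hφ1, norm_sq_eq_integral]
    refine integral_congr_ae ?_
    filter_upwards [hφ] with x hx
    rw [hx]
  have hlam := hprof.eigenvalue_nonneg hL hν hnorm
  have hξμ : ξ ≤ μ := by nlinarith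
  have hμ1 : 1 ≤ μ := hξ1.trans hξμ
  obtain ⟨n, hn⟩ := hprof.exists_tendsto_fst_zero hL hν hξ.le hμ.le
  have hnb := hprof.abs_limit_zero_le hν hξ.le hnorm hn hL hμ1 (by linarith) hk
  have hJ := hprof.abs_integral_growth_le hν hξ hnorm ha haL hlam (τ := T / 8) (by positivity)
    (by linarith) (by linarith)
  rw [← hR] at hJ
  have hobs := hf.abs_inner_profile_le hB hS hST hμ.le (by linarith) hθ0 hν hξ.le ha haa ha₁₂.le
    ha₂b hbL hχ hχ₁ hχ₂ hD hχ0 hχl hχr hprof hn hφ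
  rw [← hG] at hobs
  set lam := μ - 2 * ξ * (ν + 1) with hlamdef
  set I := ∫ t in (0 : ℝ)..(T / 2), restrictNorm a b (f t) with hI
  have hI0 : 0 ≤ I := intervalIntegral.integral_nonneg hS.le fun t _ => restrictNorm_nonneg _ _ _
  have hdecay := hf.inner_eigenvector (hprof.isGrushinImage hL hν hξ.le hμ.le hφ) hS.le hST.le le_rfl
  set eT := Real.exp (lam * (T / 8)) with heT
  have heT1 : 1 ≤ eT := Real.one_le_exp (by positivity)
  set ea := Real.exp (ξ * a₂ ^ 2 / 2) with hea
  have hea1 : 1 ≤ ea := Real.one_le_exp (by positivity)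
  clear_value lam I eT ea M₀ cl R cr G P s θ
  have hleft : |n| * (1 + L⁻¹) * growth ν ξ a₂ ≤ μ ^ k * (cl * ea) := by
    rw [growth_of_pos ha₂0, ← hea]
    have h1 := Real.rpow_nonneg ha₂0.le (ν + 1 / 2)
    calc |n| * (1 + L⁻¹) * (a₂ ^ (ν + 1 / 2) * ea)
        ≤ 2 * (4 * μ) ^ k * (1 + L⁻¹) * (a₂ ^ (ν + 1 / 2) * ea) := by gcongr
      _ = μ ^ k * (cl * ea) := by rw [hcl, mul_pow]; ring
  have hright : |μ * ∫ x in Ioo 0 L, growth ν ξ x ^ 2 * ψ x| * (L + 1) / growth ν ξ a₁ ≤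
      μ * (cr * eT) := by
    have h1 : a₁ ^ (ν + 1 / 2) * Real.exp (ξ * a ^ 2 / 2) ≤ growth ν ξ a₁ := by
      rw [growth_of_pos ha₁]
      gcongr
    rw [abs_mul, abs_of_pos hμ, div_le_iff₀ (growth_pos ha₁)]
    calc μ * |∫ x in Ioo 0 L, growth ν ξ x ^ 2 * ψ x| * (L + 1)
        ≤ μ * (R * (Real.exp (ξ * a ^ 2 / 2) * eT)) * (L + 1) := by gcongr
      _ = μ * (cr * eT) * (a₁ ^ (ν + 1 / 2) * Real.exp (ξ * a ^ 2 / 2)) := by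
          rw [hcr]; field_simp
      _ ≤ μ * (cr * eT) * growth ν ξ a₁ := by gcongr
  have hM : 3 + 2 * ((ν + 1 / 2) / a₁ + ξ * a₂) ≤ M₀ * μ := by
    have h1 : ξ * a₂ ≤ μ * a₂ := by gcongr
    have h2 : 0 ≤ (ν + 1 / 2) / a₁ := by positivity
    have h3 := mul_le_mul_of_nonneg_left hμ1 h2
    rw [hM₀]
    linarith
  have hsum : |n| * (1 + L⁻¹) * growth ν ξ a₂ +
      |μ * ∫ x in Ioo 0 L, growth ν ξ x ^ 2 * ψ x| * (L + 1) / growth ν ξ a₁ ≤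
      μ ^ k * ((cl + cr) * (ea * eT)) := by
    have h1 : μ ≤ μ ^ k := by simpa using pow_le_pow_right₀ hμ1 hk1
    have h2 : cl * ea ≤ cl * (ea * eT) :=
      mul_le_mul_of_nonneg_left (le_mul_of_one_le_right (by positivity) heT1) hcl0
    have h3 : cr * eT ≤ cr * (ea * eT) :=
      mul_le_mul_of_nonneg_left (le_mul_of_one_le_left (by positivity) hea1) hcr0
    have h4 : μ * (cr * eT) ≤ μ ^ k * (cr * (ea * eT)) :=
      mul_le_mul h1 h3 (by positivity) (by positivity)
    have h5 : μ ^ k * (cl * ea) ≤ μ ^ k * (cl * (ea * eT)) :=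
      mul_le_mul_of_nonneg_left h2 (by positivity)
    calc _ ≤ μ ^ k * (cl * ea) + μ * (cr * eT) := add_le_add hleft hright
      _ ≤ μ ^ k * (cl * (ea * eT)) + μ ^ k * (cr * (ea * eT)) := add_le_add h5 h4
      _ = μ ^ k * ((cl + cr) * (ea * eT)) := by ring
  have hpoly : μ ^ (k + 2) ≤ P * Real.exp (θ * μ) := by
    rw [hP]; exact pow_le_factorial_mul_exp hθ0 hμ.le _
  set H := D * Real.sqrt L * (G * Real.exp (4 * L ^ 2 / θ)) with hH
  have hH0 : 0 ≤ H := by positivity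
  clear_value H
  have hobs' : μ * |inner ℝ (f (T / 2)) φ| ≤
      H * (P * (M₀ * (cl + cr))) * (Real.exp (θ * μ) * Real.exp (θ * μ) * (ea * eT)) * I := by
    have e1 : 0 ≤ growth ν ξ a₂ := growth_nonneg _
    have e2 : 0 ≤ growth ν ξ a₁ := growth_nonneg _
    refine (mul_le_of_observation hobs hM hsum hpoly hμ hD0 (Real.sqrt_nonneg _) hG0
      (Real.exp_pos _).le (Real.exp_pos _).le hI0 hM₀0.le (by positivity)).trans_eq ?_
    rw [hH]; ring
  -- Balance in λ: -T/2 from the decay, at most T/8 from e^(2θλ), and T/8 from Agmon; the sum is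
  -- negative. In ξ there remains (s + a₂²)/2 = (a + ε/2)²/2.
  have hexp : Real.exp (-lam * (T - T / 2)) *
      (Real.exp (θ * μ) * Real.exp (θ * μ) * (ea * eT)) ≤
      Real.exp (ξ * (a + ε / 2) ^ 2 / 2) := by
    rw [hea, heT, ← Real.exp_add, ← Real.exp_add, ← Real.exp_add, ← Real.exp_add]
    refine Real.exp_le_exp.2 ?_
    have h1 : μ = lam + 2 * ξ * (ν + 1) := by rw [hlamdef]; ring
    have h2 := mul_le_mul_of_nonneg_left hθT hlam
    have h3 := mul_le_mul_of_nonneg_left hθs hξ.le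
    have h4 : (a + ε / 2) ^ 2 = s + a₂ ^ 2 := by rw [hs]; ring
    have h5 : 0 ≤ lam * T := mul_nonneg hlam hT.le
    have h6 : θ * μ = lam * θ + ξ * (2 * (ν + 1) * θ) := by rw [h1]; ring
    rw [h4, h6]
    linarith
  rw [hdecay, ← hlamdef, abs_mul, Real.abs_exp]
  calc μ * (Real.exp (-lam * (T - T / 2)) * |inner ℝ (f (T / 2)) φ|)
      = Real.exp (-lam * (T - T / 2)) * (μ * |inner ℝ (f (T / 2)) φ|) := by ring
    _ ≤ Real.exp (-lam * (T - T / 2)) * (H * (P * (M₀ * (cl + cr))) *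
        (Real.exp (θ * μ) * Real.exp (θ * μ) * (ea * eT)) * I) :=
        mul_le_mul_of_nonneg_left hobs' (Real.exp_pos _).le
    _ = H * (P * (M₀ * (cl + cr))) * (Real.exp (-lam * (T - T / 2)) *
        (Real.exp (θ * μ) * Real.exp (θ * μ) * (ea * eT))) * I := by ring
    _ ≤ H * (P * (M₀ * (cl + cr))) * Real.exp (ξ * (a + ε / 2) ^ 2 / 2) * I := by
        gcongr

end Observability

/-! ### From the modes to the solution. -/

theorem norm_sq_le_of_forall_profile {L ν ξ B : ℝ} (hL : 0 < L) (hν : 0 < ν) (hξ : 0 ≤ ξ)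
    (u : L2Interval L)
    (h : ∀ (μ : ℝ) (ψ p : ℝ → ℝ) (φ : L2Interval L), 0 < μ → IsProfile L ν ξ μ ψ p →
      φ =ᵐ[intervalMeasure L] (fun x => growth ν ξ x * ψ x) → ‖φ‖ = 1 → μ * |inner ℝ u φ| ≤ B) :
    ‖u‖ ^ 2 ≤ L ^ 4 * B ^ 2 := by
  refine norm_sq_le_of_forall_eigenvector (grushinResolvent hL.le hν hξ) _
    (fun ι _ v hv => sum_norm_grushinResolvent_sq_le hL.le hν hξ ι v hv)
    (isSymmetric_grushinResolvent hL.le hν hξ)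
    (grushinResolvent_injective hL.le hν hξ) _ _ (sq_nonneg _) fun m φ hm hφ hmφ => ?_
  have hm0 := grushinResolvent_eigenvalue_pos hL.le hν hξ hm hφ hmφ
  obtain ⟨ψ, p, hprof, hφψ⟩ := exists_isProfile hL hν hξ hm0 hmφ
  have h1 := h m⁻¹ ψ p φ (inv_pos.2 hm0) hprof hφψ hφ
  rw [inv_mul_le_iff₀ hm0] at h1
  rw [← sq_abs, ← mul_pow]
  exact pow_le_pow_left₀ (abs_nonneg _) h1 2

/-- The left side is e^(ξr²). Dividing ξ by a square root in (0, 1] only enlarges the exponent, and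
the second exponential is added for free. -/
theorem sq_exp_half_mul_le {ξ r δ : ℝ} (x : ℝ) (hξ : 0 ≤ ξ) (hδ : 0 < δ) (hδ' : δ < 2 / 3) :
    Real.exp (ξ * r ^ 2 / 2) ^ 2 ≤
      Real.exp (ξ / Real.sqrt (1 - 3 * δ / 2) * r ^ 2) + Real.exp x := by
  have h1 : 0 < Real.sqrt (1 - 3 * δ / 2) := Real.sqrt_pos.2 (by linarith)
  have h2 : Real.sqrt (1 - 3 * δ / 2) ≤ 1 := Real.sqrt_le_one.2 (by linarith)
  have h3 : ξ ≤ ξ / Real.sqrt (1 - 3 * δ / 2) := le_div_self hξ h1 h2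
  rw [← Real.exp_nat_mul]
  refine (Real.exp_le_exp.2 ?_).trans (le_add_of_nonneg_right (Real.exp_pos _).le)
  have h4 := mul_le_mul_of_nonneg_right h3 (sq_nonneg r)
  push_cast
  linarith

/-- The modes are observed in L¹ in time on (0, T/2); Cauchy–Schwarz turns this into the L² norm and
costs T/2. -/
theorem sq_integral_restrictNorm_le {L a b T : ℝ} (ha : 0 ≤ a) (hbL : b ≤ L) (hT : 0 < T)
    {f : ℝ → L2Interval L} (hf : ContinuousOn f (Icc 0 T)) :
    (∫ t in (0 : ℝ)..(T / 2), restrictNorm a b (f t)) ^ 2 ≤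
      T / 2 * ∫ t in Ioo 0 T, ∫ x in Ioo a b, |f t x| ^ 2 := by
  have hS : 0 < T / 2 := half_pos hT
  have hqc : ContinuousOn (fun t => restrictNorm a b (f t)) (Icc 0 T) :=
    (continuous_restrictNorm a b).comp_continuousOn hf
  have hqi : IntegrableOn (fun t => restrictNorm a b (f t) ^ 2) (Ioo 0 T) :=
    ((hqc.pow 2).integrableOn_Icc).mono_set Ioo_subset_Icc_self
  have hrhs (t : ℝ) : ∫ x in Ioo a b, |f t x| ^ 2 = restrictNorm a b (f t) ^ 2 :=
    (restrictNorm_sq ha hbL _).symm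
  simp only [hrhs]
  refine (sq_intervalIntegral_le hS (hqc.mono (Icc_subset_Icc_right (by linarith)))).trans
    (mul_le_mul_of_nonneg_left ?_ hS.le)
  rw [← setIntegral_Ioo_eq_intervalIntegral hS.le]
  exact setIntegral_mono_set hqi (Eventually.of_forall fun t => sq_nonneg _)
    (Ioo_subset_Ioo_right (by linarith)).eventuallyLE

theorem mainTheorem9 (L ν a b : ℝ) (hν : 0 < ν) (ha : 0 < a) (hab : a < b) (hbL : b ≤ L)
    (T : ℝ) (hT : 0 < T) (ε : ℝ) (hε : 0 < ε) (δ : ℝ) (hδ : 0 < δ) (hδ' : δ < 2 / 3) :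
    ∃ ξ₀ : ℝ, 0 < ξ₀ ∧ ∃ C : ℝ, 0 < C ∧
      ∀ ξ : ℝ, ξ₀ ≤ ξ → ∀ (f₀ : L2Interval L) (f : ℝ → L2Interval L),
        IsGrushinSolution L ν ξ T f₀ f →
          ∫ x in Ioo 0 L, |f T x| ^ 2 ≤
            C * (Real.exp (ξ / Real.sqrt (1 - 3 * δ / 2) * (a + ε / 2) ^ 2) +
                Real.exp (2 * ε * ξ)) *
              ∫ t in Ioo 0 T, ∫ x in Ioo a b, |f t x| ^ 2 := by
  have hL : 0 < L := ha.trans (hab.trans_le hbL)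
  obtain ⟨ξ₀, hξ₀, K₀, hK₀, hmode⟩ := exists_forall_profile_le hν ha hab hbL hT hε
  -- L⁴ is the Hilbert–Schmidt constant and T/2 comes from Cauchy–Schwarz in time; the + 1 makes the
  -- constant positive, K₀ being only nonnegative.
  refine ⟨ξ₀, hξ₀, L ^ 4 * K₀ ^ 2 * (T / 2) + 1, by positivity, fun ξ hξ f₀ f hf => ?_⟩
  have hξ0 : 0 < ξ := hξ₀.trans_le hξ
  have hnorm := norm_sq_le_of_forall_profile hL hν hξ0.le (f T) (hmode ξ hξ f₀ f hf)
  have hIY := sq_integral_restrictNorm_le ha.le hbL hT hf.continuousOn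
  have hee := sq_exp_half_mul_le (r := a + ε / 2) (2 * ε * ξ) hξ0.le hδ hδ'
  have hlhs : ∫ x in Ioo 0 L, |f T x| ^ 2 = ‖f T‖ ^ 2 := by
    rw [norm_sq_eq_integral]
    simp only [sq_abs]
  have hY0 : 0 ≤ ∫ t in Ioo 0 T, ∫ x in Ioo a b, |f t x| ^ 2 :=
    integral_nonneg fun t => integral_nonneg fun x => sq_nonneg _
  rw [hlhs]
  generalize (∫ t in Ioo 0 T, ∫ x in Ioo a b, |f t x| ^ 2) = Y at *
  generalize (∫ t in (0 : ℝ)..(T / 2), restrictNorm a b (f t)) = I at *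
  generalize Real.exp (ξ / Real.sqrt (1 - 3 * δ / 2) * (a + ε / 2) ^ 2) +
    Real.exp (2 * ε * ξ) = F at *
  generalize Real.exp (ξ * (a + ε / 2) ^ 2 / 2) = e at *
  have hF0 : 0 ≤ F := (sq_nonneg e).trans hee
  calc ‖f T‖ ^ 2 ≤ L ^ 4 * (K₀ * e * I) ^ 2 := hnorm
    _ = L ^ 4 * K₀ ^ 2 * (e ^ 2 * I ^ 2) := by ring
    _ ≤ L ^ 4 * K₀ ^ 2 * (F * (T / 2 * Y)) :=
        mul_le_mul_of_nonneg_left (mul_le_mul hee hIY (sq_nonneg _) hF0) (by positivity)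
    _ = L ^ 4 * K₀ ^ 2 * (T / 2) * F * Y := by ring
    _ ≤ (L ^ 4 * K₀ ^ 2 * (T / 2) + 1) * F * Y :=
        mul_le_mul_of_nonneg_right (mul_le_mul_of_nonneg_right (by linarith) hF0) hY0
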